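/- A conditional simple temporal network with uncertainty (CSTNU) consists of a finite set $X_e$ of executable timepoints, a finite set $X_c$ of contingent timepoints, a finite set $P$ of propositions, a map $O$ assigning to each proposition the timepoint at which it is observed, for each $c\in X_c$ exactly one contingent constraint $l_c\le c-e_c\le u_c$ with $e_c\in X_e$ and $l_c,u_c\in\mathbb R$, $0\le l_c$, and a finite list of requirement constraints $\psi_r\rightarrow(l_r\le x_r-y_r\le u_r)$ with $x_r,y_r\in X_e\cup X_c$, $l_r,u_r\in\mathbb R$ and $\psi_r$ a label, that is, a (possibly empty) conjunction of propositions and negated propositions that does not contain both a proposition and its negation. It is strongly controllable if there are real times for the timepoints in $X_e$ such that, for all real times for the timepoints in $X_c$ that satisfy all contingent constraints and for all truth values of the propositions, every requirement constraint whose label is true is satisfied. An STNU is the same structure without propositions and labels (all requirement constraints are unconditional), and it is strongly controllable if there are real times for the timepoints in $X_e$ such that, for all real times for the timepoints in $X_c$ that satisfy all contingent constraints, all requirement constraints are satisfied. Let $n=|X_e|+|X_c|$ be the number of timepoints and $m$ the number of constraints (requirement and contingent ones together). **Theorem 4.** (1) A CSTNU is strongly controllable if and only if the STNU obtained from it by dropping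 all labels is strongly controllable. (2) Checking strong controllability of a CSTNU is in P: for CSTNUs with rational bounds, written as words with all numbers in binary and all timepoints and propositions accounted for explicitly, strong controllability is decided by a Turing machine in time polynomial in the length of the word. (3) Strong controllability of a CSTNU with real bounds can be decided in $O(mn)$ time, that is, in at most $C(mn+1)$ steps for a constant $C$, by a program for a random access machine that copies, adds, subtracts and compares integers and real numbers, and accesses memory by address, at unit cost. -/

import Mathlib

/-! ## Temporal networks with uncertainty -/

/-- Timepoints: `e` executable ones (left) and `c` contingent ones (right). -/
abbrev Timepoint (e c : ℕ) : Type := Fin e ⊕ Fin c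

/-- The number of a timepoint in the list of all timepoints, executable ones first. -/
def Timepoint.idx {e c : ℕ} : Timepoint e c → ℕ
  | Sum.inl i => i
  | Sum.inr j => e + j

/-- The contingent constraint `0 ≤ lo ≤ c - start ≤ hi` on a contingent timepoint `c`. -/
structure ContingentLink (𝕜 : Type) [Zero 𝕜] [LE 𝕜] (e : ℕ) where
  start : Fin e
  lo : 𝕜
  hi : 𝕜
  lo_nonneg : 0 ≤ lo

/-- The constraint `lo ≤ x - y ≤ hi` between two timepoints. -/
structure Requirement (𝕜 : Type) (e c : ℕ) where
  x : Timepoint e c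
  y : Timepoint e c
  lo : 𝕜
  hi : 𝕜

/-- A label: a conjunction of propositions `(i, true)` and negated propositions `(i, false)`
that does not contain both a proposition and its negation. -/
structure Label (p : ℕ) where
  lits : List (Fin p × Bool)
  consistent : ∀ i, ¬ ((i, true) ∈ lits ∧ (i, false) ∈ lits)

/-- The label is true when the propositions take the values `π`. -/
def Label.Holds {p : ℕ} (ψ : Label p) (π : Fin p → Bool) : Prop :=
  ∀ a ∈ ψ.lits, π a.1 = a.2

/-- Simple temporal networks with uncertainty. Each contingent timepoint `j` is the end of exactly
one contingent constraint, `links j`. -/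
structure STNU (𝕜 : Type) [Zero 𝕜] [LE 𝕜] where
  numExec : ℕ
  numCtg : ℕ
  links : Fin numCtg → ContingentLink 𝕜 numExec
  reqs : List (Requirement 𝕜 numExec numCtg)

/-- Conditional simple temporal networks with uncertainty. -/
structure CSTNU (𝕜 : Type) [Zero 𝕜] [LE 𝕜] where
  numExec : ℕ
  numCtg : ℕ
  numProp : ℕ
  links : Fin numCtg → ContingentLink 𝕜 numExec
  /-- The constraints `ψ → lo ≤ x - y ≤ hi`. -/
  reqs : List (Label numProp × Requirement 𝕜 numExec numCtg)
  /-- The timepoint at which a proposition is observed. -/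
  obs : Fin numProp → Timepoint numExec numCtg

/-- The times `t` of the contingent timepoints satisfy the contingent constraints, given the
times `s` of the executable ones. -/
def RespectsLinks {e c : ℕ} (links : Fin c → ContingentLink ℝ e)
    (s : Fin e → ℝ) (t : Fin c → ℝ) : Prop :=
  ∀ j, (links j).lo ≤ t j - s (links j).start ∧ t j - s (links j).start ≤ (links j).hi

/-- The requirement holds when the timepoints take place at the times `s` and `t`. -/
def Requirement.Holds {e c : ℕ} (r : Requirement ℝ e c) (s : Fin e → ℝ) (t : Fin c → ℝ) : Prop :=
  r.lo ≤ Sum.elim s t r.x - Sum.elim s t r.y ∧ Sum.elim s t r.x - Sum.elim s t r.y ≤ r.hi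

/-- Some schedule of the executable timepoints satisfies all requirements whatever nature does. -/
def STNU.StronglyControllable (N : STNU ℝ) : Prop :=
  ∃ s : Fin N.numExec → ℝ, ∀ t : Fin N.numCtg → ℝ, RespectsLinks N.links s t →
    ∀ r ∈ N.reqs, r.Holds s t

/-- Some schedule of the executable timepoints satisfies all enforced requirements, whatever
nature does and whatever values the propositions take. -/
def CSTNU.StronglyControllable (N : CSTNU ℝ) : Prop :=
  ∃ s : Fin N.numExec → ℝ, ∀ t : Fin N.numCtg → ℝ, RespectsLinks N.links s t →
    ∀ π : Fin N.numProp → Bool, ∀ r ∈ N.reqs, r.1.Holds π → r.2.Holds s t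

/-- The STNU in which all constraints are unconditional. -/
def CSTNU.dropLabels {𝕜 : Type} [Zero 𝕜] [LE 𝕜] (N : CSTNU 𝕜) : STNU 𝕜 where
  numExec := N.numExec
  numCtg := N.numCtg
  links := N.links
  reqs := N.reqs.map Prod.snd

/-- A CSTNU with rational bounds, seen as one with real bounds. -/
noncomputable def CSTNU.toReal (N : CSTNU ℚ) : CSTNU ℝ where
  numExec := N.numExec
  numCtg := N.numCtg
  numProp := N.numProp
  links j :=
    { start := (N.links j).start
      lo := ((N.links j).lo : ℝ)
      hi := ((N.links j).hi : ℝ)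
      lo_nonneg := Rat.cast_nonneg.mpr (N.links j).lo_nonneg }
  reqs := N.reqs.map fun r => (r.1, { x := r.2.x, y := r.2.y, lo := (r.2.lo : ℝ), hi := (r.2.hi : ℝ) })
  obs := N.obs

/-- The number `n` of timepoints. -/
def CSTNU.numTimepoints {𝕜 : Type} [Zero 𝕜] [LE 𝕜] (N : CSTNU 𝕜) : ℕ := N.numExec + N.numCtg

/-- The number `m` of constraints, requirement and contingent ones. -/
def CSTNU.numConstraints {𝕜 : Type} [Zero 𝕜] [LE 𝕜] (N : CSTNU 𝕜) : ℕ := N.reqs.length + N.numCtg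

/-! ## Written form of a network -/

/-- The record of a constraint `lo ≤ x - y ≤ hi`, timepoints being given by their numbers. -/
def constraintRecord {𝕜 : Type} (x y : ℕ) (lo hi : 𝕜) : List (ℕ ⊕ 𝕜) :=
  [Sum.inl x, Sum.inl y, Sum.inr lo, Sum.inr hi]

/-- The record of a label: the number of its literals, then each literal with its sign. -/
def Label.record {p : ℕ} (𝕜 : Type) (ψ : Label p) : List (ℕ ⊕ 𝕜) :=
  Sum.inl ψ.lits.length :: ψ.lits.flatMap fun a => [Sum.inl (a.1 : ℕ), Sum.inl a.2.toNat]

/-- A network written as a list of numbers: the cardinalities, the list of the executable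
timepoints, the contingent constraints, the requirement constraints, the labels of the latter, and
the observation timepoints. -/
def CSTNU.record {𝕜 : Type} [Zero 𝕜] [LE 𝕜] (N : CSTNU 𝕜) : List (ℕ ⊕ 𝕜) :=
  [Sum.inl N.numExec, Sum.inl N.numCtg, Sum.inl N.numProp, Sum.inl N.reqs.length]
  ++ (List.range N.numExec).map Sum.inl
  ++ (List.finRange N.numCtg).flatMap (fun j : Fin N.numCtg => constraintRecord
      (N.numExec + (j : ℕ)) ((N.links j).start : ℕ) (N.links j).lo (N.links j).hi)
  ++ N.reqs.flatMap (fun r => constraintRecord r.2.x.idx r.2.y.idx r.2.lo r.2.hi)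
  ++ N.reqs.flatMap (fun r => r.1.record 𝕜)
  ++ (List.finRange N.numProp).map (fun i => Sum.inl (N.obs i).idx)

/-! ## Polynomial time on Turing machines -/

open Computability in
/-- A natural number in binary, ended by a comma. -/
def encodeNatWord (n : ℕ) : List Γ' := encodingNatΓ'.encode n ++ [Γ'.comma]

open Computability in
/-- A rational number: a sign bit, then numerator and denominator in lowest terms in binary. -/
def encodeRatWord (q : ℚ) : List Γ' :=
  Γ'.bit (decide (q < 0)) :: (encodeNatWord q.num.natAbs ++ encodeNatWord q.den)

/-- The input word of a network with rational bounds. -/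
def CSTNU.encode (N : CSTNU ℚ) : List Computability.Γ' :=
  N.record.flatMap (Sum.elim encodeNatWord encodeRatWord)

open Classical in
/-- The decision problem `S`, whose instances are given as the words `enc a`, is in P: some Turing
machine decides it in time polynomial in the length of the word. -/
def InP {α Γ : Type} (enc : α → List Γ) (S : α → Prop) : Prop :=
  Nonempty (Turing.TM2ComputableInPolyTime enc Computability.encodeBool fun a => decide (S a))

/-! ## Random access machines with real numbers

The machine has registers and memory cells for natural numbers (which also serve as addresses), and
registers and memory cells for real numbers. Each instruction costs one step. Numbers can only be
copied, added, subtracted and compared. -/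

/-- Instructions. Arguments are register numbers except for the constant `k` and the targets `l`;
`N` refers to natural numbers and `R` to real numbers. -/
inductive RAMInstr where
  /-- `n_d := k` -/
  | constN (d k : ℕ)
  /-- `n_d := n_a + n_b` -/
  | addN (d a b : ℕ)
  /-- `n_d := max (n_a - n_b) 0` -/
  | subN (d a b : ℕ)
  /-- `n_d := memN[n_a]` -/
  | loadN (d a : ℕ)
  /-- `memN[n_a] := n_b` -/
  | storeN (a b : ℕ)
  /-- `r_d := r_a + r_b` -/
  | addR (d a b : ℕ)
  /-- `r_d := r_a - r_b` -/
  | subR (d a b : ℕ)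
  /-- `r_d := memR[n_a]` -/
  | loadR (d a : ℕ)
  /-- `memR[n_a] := r_b` -/
  | storeR (a b : ℕ)
  /-- go to instruction `l` -/
  | jump (l : ℕ)
  /-- if `n_a < n_b` go to instruction `l` -/
  | jumpLtN (a b l : ℕ)
  /-- if `r_a < r_b` go to instruction `l` -/
  | jumpLtR (a b l : ℕ)
  /-- stop with the given answer -/
  | halt (answer : Bool)

/-- Configurations: program counter, registers and memory cells. -/
structure RAMState where
  pc : ℕ
  regN : ℕ → ℕ
  regR : ℕ → ℝ
  memN : ℕ → ℕ
  memR : ℕ → ℝ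

/-- The effect of one instruction. -/
noncomputable def RAMInstr.exec (σ : RAMState) : RAMInstr → RAMState
  | constN d k => { σ with pc := σ.pc + 1, regN := Function.update σ.regN d k }
  | addN d a b => { σ with pc := σ.pc + 1, regN := Function.update σ.regN d (σ.regN a + σ.regN b) }
  | subN d a b => { σ with pc := σ.pc + 1, regN := Function.update σ.regN d (σ.regN a - σ.regN b) }
  | loadN d a => { σ with pc := σ.pc + 1, regN := Function.update σ.regN d (σ.memN (σ.regN a)) }
  | storeN a b => { σ with pc := σ.pc + 1, memN := Function.update σ.memN (σ.regN a) (σ.regN b) }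
  | addR d a b => { σ with pc := σ.pc + 1, regR := Function.update σ.regR d (σ.regR a + σ.regR b) }
  | subR d a b => { σ with pc := σ.pc + 1, regR := Function.update σ.regR d (σ.regR a - σ.regR b) }
  | loadR d a => { σ with pc := σ.pc + 1, regR := Function.update σ.regR d (σ.memR (σ.regN a)) }
  | storeR a b => { σ with pc := σ.pc + 1, memR := Function.update σ.memR (σ.regN a) (σ.regR b) }
  | jump l => { σ with pc := l }
  | jumpLtN a b l => { σ with pc := if σ.regN a < σ.regN b then l else σ.pc + 1 }
  | jumpLtR a b l => { σ with pc := if σ.regR a < σ.regR b then l else σ.pc + 1 }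
  | halt _ => σ

/-- One step of a program; nothing happens beyond its end. -/
noncomputable def ramStep (prog : List RAMInstr) (σ : RAMState) : RAMState :=
  match prog[σ.pc]? with
  | some i => i.exec σ
  | none => σ

/-- The initial configuration: entry `i` of the input is in memory cell `i` of its kind, natural
register `0` holds the length of the input, and all the rest is `0`. -/
def ramInit (input : List (ℕ ⊕ ℝ)) : RAMState where
  pc := 0
  regN := Function.update (fun _ => 0) 0 input.length
  regR := fun _ => 0
  memN := fun i => (input[i]?.elim 0 (Sum.elim id fun _ => 0))
  memR := fun i => (input[i]?.elim 0 (Sum.elim (fun _ => 0) id))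

/-- The program reaches the instruction `halt answer` after at most `T` steps. -/
def RAMAnswers (prog : List RAMInstr) (input : List (ℕ ⊕ ℝ)) (answer : Bool) (T : ℕ) : Prop :=
  ∃ k ≤ T, prog[((ramStep prog)^[k] (ramInit input)).pc]? = some (RAMInstr.halt answer)

open Classical in
/-- Some program solves the decision problem `S` on all instances `a`, given as `enc a`, in at most
`C * (f a + 1)` steps for a constant `C`, that is, in `O(f)` time. -/
def DecidableInTime {α : Type} (enc : α → List (ℕ ⊕ ℝ)) (S : α → Prop) (f : α → ℕ) : Prop :=
  ∃ (prog : List RAMInstr) (C : ℕ), ∀ a, RAMAnswers prog (enc a) (decide (S a)) (C * (f a + 1))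

/-! ## Structured programs and their compilation to flat code -/

/-! Labels play no role because the schedule is fixed before the propositions get their values: the
label of any single requirement can be made true by a suitable valuation (`Label.exists_holds`), so
every requirement has to hold anyway.

Without labels, an empty contingent range makes controllability vacuous. Otherwise every contingent
timepoint is its start plus a delay that ranges over its interval independently of all others. A
requirement on two different timepoints is hardest when one delay is greatest and the other least,
so it amounts to two difference constraints between executable timepoints; a requirement between a
timepoint and itself only says that `lo ≤ 0 ≤ hi` (`Requirement.sat_edges_iff`). Controllability
thus becomes satisfiability of two difference constraints per requirement, which Bellman-Ford
decides (`DiffConstraints.exists_sat_iff`): relax all constraints, starting from zero, as many times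
as there are executable timepoints, and test the result. The proof avoids paths and cycles. If
solutions exist, there is a greatest nonpositive one, the iterates stay above it, and every round
makes at least one more variable reach it.

For membership in P, data are coded as binary trees on a stack, and the functions computable in
polynomial time on them (`PolyFun`) are closed under pairing, case distinction and size-bounded
folds. The algorithm is written with these combinators, compiled to flat code and then to a Turing
machine. The number of rounds is polynomial because the word lists the executable timepoints; the
fractions are never reduced, but a relaxation adds an input weight to a stored value, and this
lengthens the latter only additively (`flen_fadd_le`).

For the time bound, the same compiler turns an explicit program into machine code. A requirement
costs a constant number of steps per round. One additional round checks the result, and an early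
exit in the absence of requirements keeps the total in `O(mn)`. -/

/-- Structured programs over basic operations `O` and tests `T`. -/
inductive Cmd (O T : Type) where
  | skip
  | op (o : O)
  | seq (p q : Cmd O T)
  | ite (t : T) (p q : Cmd O T)
  | loop (t : T) (p : Cmd O T)

/-- Instructions of flat code. -/
inductive Flat (O T : Type) where
  | op (o : O)
  | jump (l : ℕ)
  | cjump (t : T) (l : ℕ)

namespace Cmd

variable {O T D : Type}

scoped infixr:60 " ;; " => Cmd.seq

/-- `Run act tst p d n d'`: started in `d`, the program `p` ends in `d'` after at most `n` steps. -/
inductive Run (act : O → D → D) (tst : T → D → Bool) : Cmd O T → D → ℕ → D → Prop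
  | skip {d n} : Run act tst .skip d n d
  | op {o d n} : 1 ≤ n → Run act tst (.op o) d n (act o d)
  | seq {p q d d' d'' k m n} : Run act tst p d k d' → Run act tst q d' m d'' → k + m ≤ n →
      Run act tst (.seq p q) d n d''
  | iteT {t p q d d' m n} : tst t d = true → Run act tst p d m d' → m + 1 ≤ n →
      Run act tst (.ite t p q) d n d'
  | iteF {t p q d d' m n} : tst t d = false → Run act tst q d m d' → m + 2 ≤ n →
      Run act tst (.ite t p q) d n d'
  | loopF {t p d n} : tst t d = false → 2 ≤ n → Run act tst (.loop t p) d n d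
  | loopT {t p d d' d'' k m n} : tst t d = true → Run act tst p d k d' →
      Run act tst (.loop t p) d' m d'' → k + m + 2 ≤ n → Run act tst (.loop t p) d n d''

variable {act : O → D → D} {tst : T → D → Bool}

theorem Run.mono {p : Cmd O T} {d d' : D} {m n : ℕ} (h : Run act tst p d m d') (hmn : m ≤ n) :
    Run act tst p d n d' := by
  cases h with
  | skip => exact .skip
  | op h => exact .op (h.trans hmn)
  | seq h₁ h₂ h => exact .seq h₁ h₂ (h.trans hmn)
  | iteT h₁ h₂ h => exact .iteT h₁ h₂ (h.trans hmn)
  | iteF h₁ h₂ h => exact .iteF h₁ h₂ (h.trans hmn)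
  | loopF h₁ h => exact .loopF h₁ (h.trans hmn)
  | loopT h₁ h₂ h₃ h => exact .loopT h₁ h₂ h₃ (h.trans hmn)

/-- The number of instructions of the compiled program. -/
def size : Cmd O T → ℕ
  | skip => 0
  | op _ => 1
  | seq p q => p.size + q.size
  | ite _ p q => q.size + p.size + 2
  | loop _ p => p.size + 3

/-- The flat code of a program, to be placed at address `b`. -/
def compile : ℕ → Cmd O T → List (Flat O T)
  | _, skip => []
  | _, op o => [.op o]
  | b, seq p q => compile b p ++ compile (b + p.size) q
  | b, ite t p q => .cjump t (b + q.size + 2) :: (compile (b + 1) q ++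
      .jump (b + q.size + p.size + 2) :: compile (b + q.size + 2) p)
  | b, loop t p => .cjump t (b + 2) :: .jump (b + p.size + 3) :: (compile (b + 2) p ++ [.jump b])

@[simp] theorem length_compile (b : ℕ) (p : Cmd O T) : (compile b p).length = p.size := by
  induction p generalizing b <;> (simp_all [compile, size]; try omega)

variable (act tst) in
/-- One step of flat code; nothing happens beyond its end. -/
def flatStep (code : List (Flat O T)) (c : ℕ × D) : ℕ × D :=
  match code[c.1]? with
  | some (.op o) => (c.1 + 1, act o c.2)
  | some (.jump l) => (l, c.2)
  | some (.cjump t l) => (if tst t c.2 = true then l else c.1 + 1, c.2)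
  | none => c

variable (act tst) in
/-- The flat code leads from `c` to `c'` in at most `n` steps, without leaving the code. -/
def FlatRun (code : List (Flat O T)) (n : ℕ) (c c' : ℕ × D) : Prop :=
  ∃ k ≤ n, (flatStep act tst code)^[k] c = c'

theorem FlatRun.trans {code : List (Flat O T)} {m n : ℕ} {c c' c'' : ℕ × D}
    (h : FlatRun act tst code m c c') (h' : FlatRun act tst code n c' c'') :
    FlatRun act tst code (m + n) c c'' := by
  obtain ⟨k, hk, rfl⟩ := h
  obtain ⟨l, hl, rfl⟩ := h'
  exact ⟨l + k, by omega, Function.iterate_add_apply _ _ _ _⟩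

theorem FlatRun.mono {code : List (Flat O T)} {m n : ℕ} {c c' : ℕ × D}
    (h : FlatRun act tst code m c c') (hmn : m ≤ n) : FlatRun act tst code n c c' :=
  h.imp fun _ hk => ⟨hk.1.trans hmn, hk.2⟩

theorem FlatRun.step {code : List (Flat O T)} {c c' : ℕ × D} (h : flatStep act tst code c = c') :
    FlatRun act tst code 1 c c' := ⟨1, le_rfl, h⟩

/-- Induction on the run. The surrounding code `pre` and `post` is arbitrary because the code of a
subprogram sits inside that of the program, and jump targets are absolute addresses. -/
theorem Run.flatRun {p : Cmd O T} {d d' : D} {n : ℕ} (h : Run act tst p d n d') :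
    ∀ {pre post : List (Flat O T)}, FlatRun act tst (pre ++ compile pre.length p ++ post) n
      (pre.length, d) (pre.length + p.size, d') := by
  induction h with
  | skip => intro pre post; exact ⟨0, by omega, by simp [size]⟩
  | op h => intro pre post; exact (FlatRun.step (by simp [flatStep, compile, size])).mono h
  | @seq p q d d' d'' k m n _ _ h ih₁ ih₂ =>
    intro pre post
    have h₁ := @ih₁ pre (compile (pre.length + p.size) q ++ post)
    have h₂ := @ih₂ (pre ++ compile pre.length p) post
    simp only [compile, size, List.append_assoc, List.length_append, length_compile, ← add_assoc]
      at h₁ h₂ ⊢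
    exact (h₁.trans h₂).mono h
  | @iteT t p q d d' m n ht _ h ih =>
    intro pre post
    have h₁ := @ih (pre ++ .cjump t (pre.length + q.size + 2) :: (compile (pre.length + 1) q ++
      [.jump (pre.length + q.size + p.size + 2)])) post
    simp only [compile, size, List.append_assoc, List.length_append, length_compile, ← add_assoc,
      List.length_cons, List.cons_append, List.length_nil, List.nil_append, zero_add] at h₁ ⊢
    rw [show pre.length + q.size + 1 + 1 = pre.length + q.size + 2 from rfl] at h₁
    -- The code of the branch for `true` comes last and ends where the whole code ends, so the only
    -- overhead is the conditional jump; the other branch, placed in front, needs one more jump.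
    refine (FlatRun.trans (FlatRun.step ?_) (h₁.trans ?_)).mono (m := 1 + (m + 0)) (by omega)
    · simp [flatStep, ht]
    · exact ⟨0, le_rfl, by simp; omega⟩
  | @iteF t p q d d' m n ht _ h ih =>
    intro pre post
    have h₁ := @ih (pre ++ [.cjump t (pre.length + q.size + 2)])
      (.jump (pre.length + q.size + p.size + 2) :: compile (pre.length + q.size + 2) p ++ post)
    simp only [compile, size, List.append_assoc, List.length_append, ← add_assoc,
      List.length_cons, List.cons_append, List.length_nil, List.nil_append, zero_add] at h₁ ⊢
    refine (FlatRun.trans (FlatRun.step ?_) (h₁.trans (FlatRun.step ?_))).mono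
      (m := 1 + (m + 1)) (by omega)
    · simp [flatStep, ht]
    · have : (pre ++ Flat.cjump t (pre.length + q.size + 2) :: (compile (pre.length + 1) q ++
          Flat.jump (pre.length + q.size + p.size + 2) ::
          (compile (pre.length + q.size + 2) p ++ post)))[pre.length + 1 + q.size]? =
          some (.jump (pre.length + q.size + p.size + 2)) := by
        rw [List.getElem?_append_right (by omega), show pre.length + 1 + q.size - pre.length
          = q.size + 1 by omega, List.getElem?_cons_succ, List.getElem?_append_right (by simp)]
        simp
      simp [flatStep, this]
  | @loopF t p d n ht h =>
    intro pre post
    refine (FlatRun.trans (c' := (pre.length + 1, d)) (FlatRun.step ?_) (FlatRun.step ?_)).mono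
      (m := 1 + 1) (by omega)
    · simp [flatStep, compile, ht]
    · simp [flatStep, compile, List.getElem?_append_right, size, ← add_assoc]
  | @loopT t p d d' d'' k m n ht _ _ h ih₁ ih₂ =>
    intro pre post
    have h₁ := @ih₁ (pre ++ [.cjump t (pre.length + 2), .jump (pre.length + p.size + 3)])
      ([.jump pre.length] ++ post)
    have h₂ := @ih₂ pre post
    simp only [compile, size, List.append_assoc, List.length_append, ← add_assoc,
      List.length_cons, List.cons_append, List.length_nil, List.nil_append, zero_add] at h₁ h₂ ⊢
    refine (FlatRun.trans (FlatRun.step ?_) (h₁.trans (FlatRun.trans (FlatRun.step ?_) h₂))).mono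
      (m := 1 + (k + (1 + m))) (by omega)
    · simp [flatStep, ht]
    · have : (pre ++ Flat.cjump t (pre.length + 2) :: Flat.jump (pre.length + p.size + 3) ::
          (compile (pre.length + 2) p ++ Flat.jump pre.length :: post))[pre.length + (1 + 1) +
          p.size]? = some (.jump pre.length) := by
        rw [List.getElem?_append_right (by omega), show pre.length + (1 + 1) + p.size - pre.length
          = p.size + 1 + 1 by omega, List.getElem?_cons_succ, List.getElem?_cons_succ,
          List.getElem?_append_right (by simp)]
        simp
      simp [flatStep, this]

theorem Run.flatRun_compile {p : Cmd O T} {d d' : D} {n : ℕ} (h : Run act tst p d n d')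
    (post : List (Flat O T)) :
    FlatRun act tst (compile 0 p ++ post) n (0, d) (p.size, d') := by
  simpa using h.flatRun (pre := []) (post := post)

end Cmd

/-! ## Stack programs and Turing machines -/

namespace StackMachine

open Computability Turing

/-- The stacks of Booleans. -/
inductive Reg where
  | out | dat | aux | bak | cnt
  deriving DecidableEq

instance : Fintype Reg := ⟨{.out, .dat, .aux, .bak, .cnt}, fun r => by cases r <;> simp⟩

/-- The contents of the input stack and of the stacks of Booleans. -/
structure Stacks where
  inp : List Γ'
  out : List Bool
  dat : List Bool
  aux : List Bool
  bak : List Bool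
  cnt : List Bool

/-- The contents of a stack of Booleans. -/
def Stacks.get (s : Stacks) : Reg → List Bool
  | .out => s.out
  | .dat => s.dat
  | .aux => s.aux
  | .bak => s.bak
  | .cnt => s.cnt

/-- Replace the contents of a stack of Booleans. -/
def Stacks.set (s : Stacks) (l : List Bool) : Reg → Stacks
  | .out => { s with out := l }
  | .dat => { s with dat := l }
  | .aux => { s with aux := l }
  | .bak => { s with bak := l }
  | .cnt => { s with cnt := l }

/-- Basic operations on stacks. -/
inductive Op where
  | push (r : Reg) (b : Bool)
  | pop (r : Reg)
  | popInp

/-- Tests of the top of a stack. -/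
inductive Test where
  | reg (r : Reg) (f : Option Bool → Bool)
  | inp (f : Option Γ' → Bool)

/-- The effect of an operation. -/
def Op.act : Op → Stacks → Stacks
  | push r b, s => s.set (b :: s.get r) r
  | pop r, s => s.set (s.get r).tail r
  | popInp, s => { s with inp := s.inp.tail }

/-- The value of a test. -/
def Test.eval : Test → Stacks → Bool
  | reg r f, s => f (s.get r).head?
  | inp f, s => f s.inp.head?

/-- The alphabets of the stacks of the Turing machine; the input stack is `none`. -/
abbrev Alphabet : Option Reg → Type
  | none => Γ'
  | some _ => Bool

/-- The stacks as a family. -/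
def Stacks.family (s : Stacks) : (k : Option Reg) → List (Alphabet k)
  | none => s.inp
  | some r => s.get r

/-- The address `l`, or the halting address if `l` is beyond the end. -/
def clamp (n l : ℕ) : Fin (n + 1) := ⟨min l n, by omega⟩

/-- The statement at an address of the Turing machine for flat code. -/
def stmt (code : List (Flat Op Test)) (l : Fin (code.length + 1)) :
    TM2.Stmt Alphabet (Fin (code.length + 1)) Bool :=
  match code[(l : ℕ)]? with
  | some (.op (.push r b)) => .push (some r) (fun _ => b) (.goto fun _ => clamp _ (l + 1))
  | some (.op (.pop r)) => .pop (some r) (fun v _ => v) (.goto fun _ => clamp _ (l + 1))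
  | some (.op .popInp) => .pop none (fun v _ => v) (.goto fun _ => clamp _ (l + 1))
  | some (.jump m) => .goto fun _ => clamp _ m
  | some (.cjump (.reg r f) m) => .peek (some r) (fun _ o => f o)
      (.branch id (.goto fun _ => clamp _ m) (.goto fun _ => clamp _ (l + 1)))
  | some (.cjump (.inp f) m) => .peek none (fun _ o => f o)
      (.branch id (.goto fun _ => clamp _ m) (.goto fun _ => clamp _ (l + 1)))
  | none => .load (fun _ => false) .halt

/-- The Turing machine for flat code. -/
def machine (code : List (Flat Op Test)) : FinTM2 where
  K := Option Reg
  k₀ := none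
  k₁ := some .out
  Γ := Alphabet
  Λ := Fin (code.length + 1)
  main := 0
  σ := Bool
  initialState := false
  Γk₀Fin := inferInstanceAs (Fintype Γ')
  m := stmt code

theorem update_family_some (s : Stacks) (r : Reg) (l : List Bool) :
    Function.update s.family (some r) l = (s.set l r).family := by
  funext k
  rcases k with _ | k
  · cases r <;> rfl
  · rcases eq_or_ne k r with rfl | h
    · rw [Function.update_self]
      cases k <;> rfl
    · rw [Function.update_of_ne (by simpa using h)]
      cases r <;> cases k <;> first | rfl | exact absurd rfl h

theorem update_family_none (s : Stacks) (l : List Γ') :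
    Function.update s.family none l = ({ s with inp := l } : Stacks).family := by
  funext k
  rcases k with _ | k
  · rfl
  · cases k <;> rfl

theorem clamp_eq {n l : ℕ} (h : l ≤ n) : ((clamp n l : Fin (n + 1)) : ℕ) = l := min_eq_left h

/-- A step of flat code is a step of the Turing machine. -/
theorem step_machine (code : List (Flat Op Test)) (c : ℕ × Stacks) (v : Bool)
    (hc : c.1 < code.length) :
    ∃ v', TM2.step (stmt code) ⟨some (clamp _ c.1), v, c.2.family⟩ = some
      ⟨some (clamp _ (Cmd.flatStep Op.act Test.eval code c).1), v',
        (Cmd.flatStep Op.act Test.eval code c).2.family⟩ := by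
  obtain ⟨l, s⟩ := c
  have hl := clamp_eq hc.le
  have hs : code[l]? = some code[l] := List.getElem?_eq_getElem hc
  simp only [TM2.step, stmt, hl, hs, Cmd.flatStep]
  rcases code[l] with (⟨r, b⟩ | r | _) | m | ⟨r | f, m⟩
  · exact ⟨v, congrArg (fun S => some (⟨_, v, S⟩ : TM2.Cfg Alphabet (Fin (code.length + 1)) Bool)) (update_family_some s r _)⟩
  · exact ⟨v, congrArg (fun S => some (⟨_, v, S⟩ : TM2.Cfg Alphabet (Fin (code.length + 1)) Bool)) (update_family_some s r _)⟩
  · exact ⟨v, congrArg (fun S => some (⟨_, v, S⟩ : TM2.Cfg Alphabet (Fin (code.length + 1)) Bool)) (update_family_none s _)⟩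
  · exact ⟨v, rfl⟩
  · rename_i f
    refine ⟨f (s.get r).head?, ?_⟩
    cases h : f (s.get r).head? <;> simp [TM2.stepAux, Test.eval, Stacks.family, h]
  · refine ⟨f s.inp.head?, ?_⟩
    cases h : f s.inp.head? <;> simp [TM2.stepAux, Test.eval, Stacks.family, h]

theorem flatStep_of_le {code : List (Flat Op Test)} {c : ℕ × Stacks} (h : code.length ≤ c.1)
    (n : ℕ) : (Cmd.flatStep Op.act Test.eval code)^[n] c = c :=
  Function.iterate_fixed (by simp [Cmd.flatStep, List.getElem?_eq_none h]) n

/-- Inside the code the two kinds of steps correspond one to one. Every address beyond the end is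
clamped to the halting statement, which accounts for the extra step. -/
theorem machine_halts (code : List (Flat Op Test)) (s' : Stacks) :
    ∀ (n : ℕ) (c : ℕ × Stacks) (v : Bool),
      (Cmd.flatStep Op.act Test.eval code)^[n] c = (code.length, s') →
      ∃ k ≤ n + 1, (flip bind (TM2.step (stmt code)))^[k]
        (some ⟨some (clamp _ c.1), v, c.2.family⟩) = some ⟨none, false, s'.family⟩ := by
  -- The halting statement also resets the internal state to `false`, as the halting configuration
  -- of a `FinTM2` has to contain the initial internal state.
  have last (l : ℕ) (hl : code.length ≤ l) (v : Bool) : TM2.step (stmt code)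
      ⟨some (clamp _ l), v, s'.family⟩ = some ⟨none, false, s'.family⟩ := by
    have : ((clamp code.length l : Fin (code.length + 1)) : ℕ) = code.length := min_eq_right hl
    simp [TM2.step, stmt, this, TM2.stepAux]
  intro n
  induction n with
  | zero =>
    intro c v h
    obtain rfl : c = (code.length, s') := h
    exact ⟨1, by omega, last _ le_rfl v⟩
  | succ n ih =>
    intro c v h
    rcases lt_or_ge c.1 code.length with hc | hc
    · obtain ⟨v', hv⟩ := step_machine code c v hc
      obtain ⟨k, hk, hk'⟩ := ih _ v' h
      refine ⟨k + 1, by omega, ?_⟩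
      rw [Function.iterate_succ_apply, ← hk', ← hv]
      rfl
    · rw [flatStep_of_le hc] at h
      subst h
      exact ⟨1, by omega, last _ le_rfl v⟩

theorem initList_machine (code : List (Flat Op Test)) (l : List Γ') :
    initList (machine code) l = ⟨some (0 : Fin (code.length + 1)), false, (⟨l, [], [], [], [], []⟩ : Stacks).family⟩ := by
  have : (initList (machine code) l).stk = (⟨l, [], [], [], [], []⟩ : Stacks).family := by
    funext k
    rcases k with _ | k
    · rfl
    · cases k <;> rfl
  exact congrArg (fun S => (⟨some 0, false, S⟩ : TM2.Cfg Alphabet (Fin (code.length + 1)) Bool)) this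

theorem haltList_machine (code : List (Flat Op Test)) (l : List Bool) :
    haltList (machine code) l = ⟨none, false, (⟨[], l, [], [], [], []⟩ : Stacks).family⟩ := by
  have : (haltList (machine code) l).stk = (⟨[], l, [], [], [], []⟩ : Stacks).family := by
    funext k
    rcases k with _ | k
    · rfl
    · cases k <;> rfl
  exact congrArg (fun S => (⟨none, false, S⟩ : TM2.Cfg Alphabet (Fin (code.length + 1)) Bool)) this

/-- A stack program that runs in polynomial time yields a Turing machine that does. -/
theorem polyTime_of_run {α : Type} (enc : α → List Γ') (f : α → Bool) (p : Cmd Op Test)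
    (time : Polynomial ℕ)
    (h : ∀ a, p.Run Op.act Test.eval ⟨enc a, [], [], [], [], []⟩ (time.eval (enc a).length)
      ⟨[], [f a], [], [], [], []⟩) :
    Nonempty (TM2ComputableInPolyTime enc encodeBool f) := by
  have key (a : α) : ∃ k ≤ (time + 1).eval (enc a).length,
      (flip bind (TM2.step (stmt (p.compile 0))))^[k]
        (some ⟨some 0, false, (⟨enc a, [], [], [], [], []⟩ : Stacks).family⟩) =
        some ⟨none, false, (⟨[], [f a], [], [], [], []⟩ : Stacks).family⟩ := by
    obtain ⟨k, hk, hk'⟩ := (h a).flatRun_compile []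
    rw [List.append_nil, ← Cmd.length_compile 0 p] at hk'
    obtain ⟨l, hl, hl'⟩ := machine_halts _ _ k _ false hk'
    exact ⟨l, by simp; omega, hl'⟩
  choose k hk hk' using key
  refine ⟨⟨⟨machine (p.compile 0), Equiv.refl _, Equiv.refl _⟩, time + 1, fun a =>
    ⟨⟨k a, ?_⟩, hk a⟩⟩⟩
  exact ((congrArg (fun c => (flip bind (machine (p.compile 0)).step)^[k a] (some c))
    ((congrArg (initList (machine (p.compile 0))) (List.map_id (enc a))).trans
      (initList_machine (p.compile 0) (enc a)))).trans
    (hk' a)).trans (congrArg some (haltList_machine (p.compile 0) [f a]).symm)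

end StackMachine

/-! ## Trees on a stack -/

/-- Binary trees. -/
inductive BTree where
  | leaf
  | node (a b : BTree)

namespace BTree

/-- The prefix code of a tree. -/
def code : BTree → List Bool
  | leaf => [false]
  | node a b => true :: (a.code ++ b.code)

/-- The length of the code of a tree. -/
def size : BTree → ℕ
  | leaf => 1
  | node a b => a.size + b.size + 1

@[simp] theorem length_code (t : BTree) : t.code.length = t.size := by
  induction t <;> simp_all [code, size]

theorem size_pos (t : BTree) : 0 < t.size := by cases t <;> simp [size]

end BTree

namespace StackMachine

open Computability Cmd

/-- Runs of stack programs. -/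
abbrev Exec (p : Cmd Op Test) (s : Stacks) (n : ℕ) (s' : Stacks) : Prop :=
  Run Op.act Test.eval p s n s'

/-- The stack `r` is not empty. -/
def notEmpty (r : Reg) : Test := .reg r Option.isSome

/-- The top of the stack `r` is `true`. -/
def topTrue (r : Reg) : Test := .reg r fun o => o == some true

/-- Move the top tree of the data stack, reversed, to the stack `r`. -/
def moveTree (r : Reg) : Cmd Op Test :=
  .op (.push .cnt true) ;; .loop (notEmpty .cnt) (.ite (topTrue .dat)
    (.op (.pop .dat) ;; .op (.push r true) ;; .op (.push .cnt true))
    (.op (.pop .dat) ;; .op (.push r false) ;; .op (.pop .cnt)))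

/-- Empty the stack `r`, doing `p b` for each element `b`. -/
def pour (r : Reg) (p : Bool → Cmd Op Test) : Cmd Op Test :=
  .loop (notEmpty r) (.ite (topTrue r) (.op (.pop r) ;; p true) (.op (.pop r) ;; p false))

/-- The stack `.cnt` counts in unary the trees still to be read: a node bit replaces one pending
tree by two, a leaf bit removes one. The claim extends a given run that starts after the tree, so
that the induction can treat the two subtrees of a node one after the other. A symbol costs at most
7 steps. -/
theorem exec_moveTree_loop (r : Reg) (hr : r = .aux ∨ r = .bak) (t : BTree) :
    ∀ (s : Stacks) (rest c : List Bool) (n : ℕ) (s' : Stacks), s.dat = t.code ++ rest →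
      s.cnt = true :: c →
      Exec (.loop (notEmpty .cnt) (.ite (topTrue .dat)
        (.op (.pop .dat) ;; .op (.push r true) ;; .op (.push .cnt true))
        (.op (.pop .dat) ;; .op (.push r false) ;; .op (.pop .cnt))))
        (({ s with dat := rest, cnt := c } : Stacks).set (t.code.reverse ++ s.get r) r) n s' →
      Exec (.loop (notEmpty .cnt) (.ite (topTrue .dat)
        (.op (.pop .dat) ;; .op (.push r true) ;; .op (.push .cnt true))
        (.op (.pop .dat) ;; .op (.push r false) ;; .op (.pop .cnt)))) s (n + 7 * t.size) s' := by
  induction t with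
  | leaf =>
    rintro ⟨i, o, d, x, y, k⟩ rest c n s' rfl rfl h
    refine .loopT rfl (.iteF rfl (.seq (.op le_rfl) (.seq (.op le_rfl) (.op le_rfl) le_rfl) le_rfl)
      le_rfl) ?_ (k := 5) (m := n) (by simp [BTree.size]; omega)
    rcases hr with rfl | rfl <;> exact h
  | node a b iha ihb =>
    rintro ⟨i, o, d, x, y, k⟩ rest c n s' rfl rfl h
    refine .loopT rfl (.iteT rfl (.seq (.op le_rfl) (.seq (.op le_rfl) (.op le_rfl) le_rfl) le_rfl)
      le_rfl) ?_ (k := 4) (m := n + 7 * b.size + 7 * a.size) (by simp [BTree.size]; omega)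
    refine iha _ (b.code ++ rest) (true :: c) _ _ ?_ ?_ (ihb _ rest c _ _ ?_ ?_ ?_) <;>
      rcases hr with rfl | rfl <;> simp_all [Op.act, Stacks.get, Stacks.set, BTree.code]

theorem exec_moveTree_aux (t : BTree) (i : List Γ') (o rest x y : List Bool) :
    Exec (moveTree .aux) ⟨i, o, t.code ++ rest, x, y, []⟩ (7 * t.size + 3)
      ⟨i, o, rest, t.code.reverse ++ x, y, []⟩ :=
  .seq (.op le_rfl) (exec_moveTree_loop .aux (.inl rfl) t _ rest [] 2 _ rfl rfl
    (.loopF rfl le_rfl)) (by omega)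

theorem exec_moveTree_bak (t : BTree) (i : List Γ') (o rest x y : List Bool) :
    Exec (moveTree .bak) ⟨i, o, t.code ++ rest, x, y, []⟩ (7 * t.size + 3)
      ⟨i, o, rest, x, t.code.reverse ++ y, []⟩ :=
  .seq (.op le_rfl) (exec_moveTree_loop .bak (.inr rfl) t _ rest [] 2 _ rfl rfl
    (.loopF rfl le_rfl)) (by omega)

theorem exec_pour_cons {r : Reg} {p : Bool → Cmd Op Test} {b : Bool} {l : List Bool}
    {s s' s'' : Stacks} {k m n : ℕ} (hs : s.get r = b :: l)
    (hp : Exec (p b) (s.set l r) k s') (h : Exec (pour r p) s' m s'') (hn : k + m + 5 ≤ n) :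
    Exec (pour r p) s n s'' := by
  have hset : s.set l r = (Op.pop r).act s := by simp [Op.act, hs]
  rw [hset] at hp
  cases b
  · exact .loopT (by simp [Test.eval, notEmpty, hs]) (.iteF (by simp [Test.eval, topTrue, hs])
      (.seq (.op le_rfl) hp le_rfl) le_rfl) h (by omega)
  · exact .loopT (by simp [Test.eval, notEmpty, hs]) (.iteT (by simp [Test.eval, topTrue, hs])
      (.seq (.op le_rfl) hp le_rfl) le_rfl) h (by omega)

theorem exec_pour_nil {r : Reg} {p : Bool → Cmd Op Test} {s : Stacks} {n : ℕ}
    (hs : s.get r = []) (hn : 2 ≤ n) : Exec (pour r p) s n s :=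
  .loopF (by simp [Test.eval, notEmpty, hs]) hn

theorem exec_pour_aux_dat (x : List Bool) (i : List Γ') (o d y c : List Bool) :
    Exec (pour .aux fun b => .op (.push .dat b)) ⟨i, o, d, x, y, c⟩ (6 * x.length + 2)
      ⟨i, o, x.reverse ++ d, [], y, c⟩ := by
  induction x generalizing d with
  | nil => exact exec_pour_nil rfl (by simp)
  | cons b x ih =>
    refine exec_pour_cons rfl (.op le_rfl) (m := 6 * x.length + 2) ?_ (by simp; omega)
    simpa [Op.act, Stacks.get, Stacks.set] using ih (b :: d)

theorem exec_pour_bak_dat (y : List Bool) (i : List Γ') (o d x c : List Bool) :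
    Exec (pour .bak fun b => .op (.push .dat b)) ⟨i, o, d, x, y, c⟩ (6 * y.length + 2)
      ⟨i, o, y.reverse ++ d, x, [], c⟩ := by
  induction y generalizing d with
  | nil => exact exec_pour_nil rfl (by simp)
  | cons b y ih =>
    refine exec_pour_cons rfl (.op le_rfl) (m := 6 * y.length + 2) ?_ (by simp; omega)
    simpa [Op.act, Stacks.get, Stacks.set] using ih (b :: d)

theorem exec_pour_bak_aux (y : List Bool) (i : List Γ') (o d x c : List Bool) :
    Exec (pour .bak fun b => .op (.push .aux b)) ⟨i, o, d, x, y, c⟩ (6 * y.length + 2)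
      ⟨i, o, d, y.reverse ++ x, [], c⟩ := by
  induction y generalizing x with
  | nil => exact exec_pour_nil rfl (by simp)
  | cons b y ih =>
    refine exec_pour_cons rfl (.op le_rfl) (m := 6 * y.length + 2) ?_ (by simp; omega)
    simpa [Op.act, Stacks.get, Stacks.set] using ih (b :: x)

theorem exec_pour_aux_both (x : List Bool) (i : List Γ') (o d y c : List Bool) :
    Exec (pour .aux fun b => .op (.push .dat b) ;; .op (.push .bak b)) ⟨i, o, d, x, y, c⟩
      (7 * x.length + 2) ⟨i, o, x.reverse ++ d, [], x.reverse ++ y, c⟩ := by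
  induction x generalizing d y with
  | nil => exact exec_pour_nil rfl (by simp)
  | cons b x ih =>
    refine exec_pour_cons rfl (.seq (.op le_rfl) (.op le_rfl) le_rfl) (m := 7 * x.length + 2) ?_
      (by simp; omega)
    simpa [Op.act, Stacks.get, Stacks.set] using ih (b :: d) (b :: y)

theorem exec_pour_aux_skip (x : List Bool) (i : List Γ') (o d y c : List Bool) :
    Exec (pour .aux fun _ => .skip) ⟨i, o, d, x, y, c⟩ (5 * x.length + 2) ⟨i, o, d, [], y, c⟩ := by
  induction x with
  | nil => exact exec_pour_nil rfl (by simp)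
  | cons b x ih => exact exec_pour_cons rfl (k := 0) .skip ih (by simp; omega)

/-- Remove the top tree of the data stack. -/
def dropTree : Cmd Op Test := moveTree .aux ;; pour .aux fun _ => .skip

/-- Exchange the two top trees of the data stack. -/
def swapTrees : Cmd Op Test :=
  moveTree .aux ;; moveTree .bak ;; pour .aux (fun b => .op (.push .dat b)) ;;
    pour .bak fun b => .op (.push .dat b)

/-- Copy the top tree of the data stack. -/
def dupTree : Cmd Op Test :=
  moveTree .aux ;; pour .aux (fun b => .op (.push .dat b) ;; .op (.push .bak b)) ;;
    pour .bak (fun b => .op (.push .aux b)) ;; pour .aux fun b => .op (.push .dat b)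

/-- The state with data stack `d` and empty auxiliary stacks. -/
abbrev data (i : List Γ') (o d : List Bool) : Stacks := ⟨i, o, d, [], [], []⟩

theorem exec_dropTree (t : BTree) (i : List Γ') (o d : List Bool) :
    Exec dropTree (data i o (t.code ++ d)) (20 * t.size) (data i o d) := by
  refine .seq (exec_moveTree_aux t i o d [] []) (exec_pour_aux_skip _ i o d [] []) ?_
  have := t.size_pos
  simp; omega

/-- Every transfer reverses, so two transfers restore a tree; the stack holding `a` is poured back
first, which leaves `a` below `b`. -/
theorem exec_swapTrees (a b : BTree) (i : List Γ') (o d : List Bool) :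
    Exec swapTrees (data i o (a.code ++ (b.code ++ d))) (20 * (a.size + b.size))
      (data i o (b.code ++ (a.code ++ d))) := by
  have h₁ := exec_pour_aux_dat (a.code.reverse ++ []) i o d (b.code.reverse ++ []) []
  have h₂ := exec_pour_bak_dat (b.code.reverse ++ []) i o ((a.code.reverse ++ []).reverse ++ d) [] []
  have := a.size_pos
  have := b.size_pos
  have h := Run.seq (exec_moveTree_aux a i o _ [] []) (.seq (exec_moveTree_bak b i o d _ [])
    (.seq h₁ h₂ le_rfl) le_rfl) (n := 20 * (a.size + b.size)) (by simp; omega)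
  simpa [data, swapTrees] using h

/-- The copy that arrives on `.bak` is in the right order already, and pouring it directly onto the
data stack would reverse it; hence the detour over `.aux`. -/
theorem exec_dupTree (t : BTree) (i : List Γ') (o d : List Bool) :
    Exec dupTree (data i o (t.code ++ d)) (40 * t.size) (data i o (t.code ++ (t.code ++ d))) := by
  have h₁ := exec_pour_aux_both (t.code.reverse ++ []) i o d [] []
  have h₂ := exec_pour_bak_aux ((t.code.reverse ++ []).reverse ++ []) i o
    ((t.code.reverse ++ []).reverse ++ d) [] []
  have h₃ := exec_pour_aux_dat (((t.code.reverse ++ []).reverse ++ []).reverse ++ []) i o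
    ((t.code.reverse ++ []).reverse ++ d) [] []
  have := t.size_pos
  have h := Run.seq (exec_moveTree_aux t i o d [] []) (.seq h₁ (.seq h₂ h₃ le_rfl) le_rfl)
    (n := 40 * t.size) (by simp; omega)
  simpa [data, dupTree] using h

end StackMachine

/-! ## Polynomial time functions on trees -/

theorem Polynomial.eval_nat_mono (p : Polynomial ℕ) : Monotone fun n => p.eval n := by
  intro a b h
  simp only [Polynomial.eval_eq_sum]
  exact Finset.sum_le_sum fun i _ => Nat.mul_le_mul_left _ (Nat.pow_le_pow_left h i)

namespace StackMachine

open Computability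
open BTree (leaf node code)
open Cmd (Run)
open scoped Cmd

variable {ι κ σ : Type} {u v w : ι → BTree}

/-- Some program turns the tree `u i` on top of the data stack into `v i` in polynomial time. -/
def TreePoly (u v : ι → BTree) : Prop :=
  ∃ (p : Cmd Op Test) (q : Polynomial ℕ), ∀ t, (v t).size ≤ q.eval (u t).size ∧
    ∀ i o d, Exec p (data i o ((u t).code ++ d)) (q.eval (u t).size) (data i o ((v t).code ++ d))

theorem TreePoly.of_bound (p : Cmd Op Test) (q r : Polynomial ℕ)
    (hq : ∀ t, (v t).size ≤ q.eval (u t).size)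
    (hr : ∀ t i o d,
      Exec p (data i o ((u t).code ++ d)) (r.eval (u t).size) (data i o ((v t).code ++ d))) :
    TreePoly u v :=
  ⟨p, q + r, fun t => ⟨(hq t).trans (by simp), fun i o d => (hr t i o d).mono (by simp)⟩⟩

theorem TreePoly.reindex (h : TreePoly u v) (g : κ → ι) :
    TreePoly (fun k => u (g k)) fun k => v (g k) := by
  obtain ⟨p, q, h⟩ := h
  exact ⟨p, q, fun k => h (g k)⟩

theorem TreePoly.id : TreePoly u u :=
  .of_bound .skip .X 0 (by simp) fun _ _ _ _ => .skip

theorem TreePoly.comp (hf : TreePoly v w) (hg : TreePoly u v) : TreePoly u w := by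
  obtain ⟨p, q, hp⟩ := hf
  obtain ⟨p', q', hp'⟩ := hg
  have hm t : q.eval (v t).size ≤ (q.comp q').eval (u t).size := by
    rw [Polynomial.eval_comp]
    exact q.eval_nat_mono (hp' t).1
  exact .of_bound (p' ;; p) (q.comp q') (q' + q.comp q') (fun t => (hp _).1.trans (hm t))
    fun t i o d => .seq ((hp' t).2 i o d) ((hp t).2 i o d)
      (by rw [Polynomial.eval_add]; exact Nat.add_le_add_left (hm t) _)

theorem exec_push_node (a b : BTree) (i : List Γ') (o d : List Bool) :
    Exec (.op (.push .dat true)) (data i o (a.code ++ (b.code ++ d))) 1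
      (data i o ((node a b).code ++ d)) := by
  simpa [Op.act, Stacks.set, Stacks.get, code] using Run.op (o := Op.push .dat true)
    (act := Op.act) (tst := Test.eval) (d := data i o (a.code ++ (b.code ++ d))) (le_refl 1)

theorem exec_pop_node (a b : BTree) (i : List Γ') (o d : List Bool) :
    Exec (.op (.pop .dat)) (data i o ((node a b).code ++ d)) 1
      (data i o (a.code ++ (b.code ++ d))) := by
  simpa [Op.act, Stacks.set, Stacks.get, code] using Run.op (o := Op.pop .dat)
    (act := Op.act) (tst := Test.eval) (d := data i o ((node a b).code ++ d)) (le_refl 1)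

theorem TreePoly.leaf : TreePoly u fun _ => BTree.leaf :=
  .of_bound (dropTree ;; .op (.push .dat false)) 1 (20 * .X + 1) (fun t => by simp [BTree.size])
    fun t i o d => .seq (exec_dropTree (u t) i o d) (.op le_rfl) (by simp)

/-- Compute `w` on a copy of the input, bring the original to the top, compute `v` from it, and push
the bit that joins the two trees. This works because a program leaves whatever lies below its
argument untouched. -/
theorem TreePoly.node (hf : TreePoly u v) (hg : TreePoly u w) :
    TreePoly u fun t => BTree.node (v t) (w t) := by
  obtain ⟨p, q, hp⟩ := hf
  obtain ⟨p', q', hp'⟩ := hg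
  refine .of_bound (dupTree ;; p' ;; swapTrees ;; p ;; .op (.push .dat true)) (q + q' + 1)
    (40 * .X + (q' + (20 * (.X + q') + (q + 1)))) (fun t => ?_) fun t i o d => ?_
  · simpa [BTree.size] using Nat.add_le_add (hp t).1 (hp' t).1
  · have h := Run.seq (exec_dupTree (u t) i o d) (.seq ((hp' t).2 i o _)
      (.seq (exec_swapTrees (w t) (u t) i o d) (.seq ((hp t).2 i o _)
        (exec_push_node _ _ i o d) le_rfl) le_rfl) le_rfl) le_rfl
    have := (hp' t).1
    exact h.mono (by simp; omega)

theorem TreePoly.left : TreePoly (fun t => BTree.node (v t) (w t)) v :=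
  .of_bound (.op (.pop .dat) ;; swapTrees ;; dropTree) .X (40 * .X)
    (fun t => by simp [BTree.size]; omega) fun t i o d =>
    .seq (exec_pop_node (v t) (w t) i o d) (.seq (exec_swapTrees _ _ i o d)
      (exec_dropTree _ i o _) le_rfl) (by simp [BTree.size]; omega)

theorem TreePoly.right : TreePoly (fun t => BTree.node (v t) (w t)) w :=
  .of_bound (.op (.pop .dat) ;; dropTree) .X (20 * .X)
    (fun t => by simp [BTree.size]; omega) fun t i o d =>
    .seq (exec_pop_node (v t) (w t) i o d) (exec_dropTree _ i o _)
      (by simp [BTree.size]; omega)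

/-- Whether a tree is a leaf. -/
def _root_.BTree.isLeaf : BTree → Bool
  | .leaf => true
  | .node _ _ => false

/-- Each branch has to be correct only on the inputs that reach it, which is why it is considered on
a subtype of the index type. The test looks at the first bit of the code of `c t`. -/
theorem TreePoly.cond {c : ι → BTree} (hc : TreePoly u c)
    (hf : TreePoly (fun t : {t // (c t).isLeaf = true} => u t) fun t => v t)
    (hg : TreePoly (fun t : {t // (c t).isLeaf = false} => u t) fun t => v t) : TreePoly u v := by
  obtain ⟨p, q, hp⟩ := hc
  obtain ⟨p', q', hp'⟩ := hf
  obtain ⟨p'', q'', hp''⟩ := hg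
  refine .of_bound (dupTree ;; p ;; .ite (topTrue .dat) (dropTree ;; p'') (dropTree ;; p'))
    (q' + q'') (40 * .X + (q + (20 * q + q' + q'' + 2))) (fun t => ?_) fun t i o d => ?_
  · cases h : (c t).isLeaf
    · have := (hp'' ⟨t, h⟩).1
      simp at this ⊢; omega
    · have := (hp' ⟨t, h⟩).1
      simp at this ⊢; omega
  · have h₁ := (hp t).1
    refine .seq (exec_dupTree (u t) i o d) (.seq ((hp t).2 i o _)
      (m := (20 * q + q' + q'' + 2).eval (u t).size) ?_ le_rfl) (by simp)
    have h₂ := exec_dropTree (c t) i o ((u t).code ++ d)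
    cases h : c t with
    | leaf =>
      rw [h] at h₁ h₂
      exact .iteF rfl (.seq h₂ ((hp' ⟨t, by rw [h]; rfl⟩).2 i o d) le_rfl) (by simp; omega)
    | node a b =>
      rw [h] at h₁ h₂
      exact .iteT rfl (.seq h₂ ((hp'' ⟨t, by rw [h]; rfl⟩).2 i o d) le_rfl) (by simp; omega)

/-- The length of the rightmost branch. -/
def _root_.BTree.spine : BTree → ℕ
  | .leaf => 0
  | .node _ b => b.spine + 1

theorem _root_.BTree.spine_le_size (t : BTree) : t.spine ≤ t.size := by
  induction t <;> simp_all [BTree.spine, BTree.size]; omega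

/-- The tree `n` on top serves as counter: removing its root and left subtree leaves the right
subtree, whose spine is shorter by one. `N` and `S` bound the counter and all states that occur; a
pass consists of one drop, two swaps and `p`. -/
theorem exec_iterate {f : σ → σ} {e : σ → BTree} {p : Cmd Op Test} {q : Polynomial ℕ}
    (hp : ∀ x, (e (f x)).size ≤ q.eval (e x).size ∧ ∀ i o d,
      Exec p (data i o ((e x).code ++ d)) (q.eval (e x).size) (data i o ((e (f x)).code ++ d)))
    (S N : ℕ) (i : List Γ') (o d : List Bool) (n : BTree) :
    ∀ a : σ, n.size ≤ N → (∀ k ≤ n.spine, (e (f^[k] a)).size ≤ S) →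
      Exec (.loop (topTrue .dat) (.op (.pop .dat) ;; dropTree ;; swapTrees ;; p ;; swapTrees))
        (data i o (n.code ++ ((e a).code ++ d)))
        (n.spine * (60 * N + 40 * S + q.eval S + 3) + 2)
        (data i o (leaf.code ++ ((e (f^[n.spine] a)).code ++ d))) := by
  induction n with
  | leaf => exact fun a _ _ => .loopF rfl (Nat.le_add_left _ _)
  | node h n _ ih =>
    intro a hN hS
    have hS' k (hk : k ≤ n.spine) : (e (f^[k] (f a))).size ≤ S := hS (k + 1) (by simpa [BTree.spine])
    have h₀ : (e a).size ≤ S := hS 0 (by simp)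
    have h₁ : (e (f a)).size ≤ S := hS' 0 (by simp)
    have h₂ : q.eval (e a).size ≤ q.eval S := q.eval_nat_mono h₀
    simp only [BTree.size] at hN
    refine .loopT rfl (.seq (exec_pop_node h n i o _) (.seq (exec_dropTree h i o _)
      (.seq (exec_swapTrees n (e a) i o d) (.seq ((hp a).2 i o _)
      (exec_swapTrees (e (f a)) n i o d) le_rfl) le_rfl) le_rfl) le_rfl)
      (ih (f a) (by omega) hS') ?_
    simp only [BTree.spine, Nat.add_mul, one_mul]
    omega

/-- The bound `r` on all intermediate states is a real hypothesis: the size bound of a single step,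
composed with itself polynomially often, need not be polynomial. -/
theorem TreePoly.iterate {f : σ → σ} {e : σ → BTree} {a : ι → σ} {n : ι → BTree}
    (hf : TreePoly e fun x => e (f x)) (ha : TreePoly u fun t => e (a t)) (hn : TreePoly u n)
    (r : Polynomial ℕ)
    (hr : ∀ t, ∀ k ≤ (n t).spine, (e (f^[k] (a t))).size ≤ r.eval (u t).size) :
    TreePoly u fun t => e (f^[(n t).spine] (a t)) := by
  obtain ⟨p, q, hp⟩ := hf
  obtain ⟨p', q', hp'⟩ := ha
  obtain ⟨p'', q'', hp''⟩ := hn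
  refine .of_bound (dupTree ;; p'' ;; swapTrees ;; p' ;; swapTrees ;;
    .loop (topTrue .dat) (.op (.pop .dat) ;; dropTree ;; swapTrees ;; p ;; swapTrees) ;;
    .op (.pop .dat)) r (40 * .X + (q'' + (20 * (q'' + .X) + (q' + (20 * (q' + q'') +
      (q'' * (60 * q'' + 40 * r + q.comp r + 3) + 2 + 1)))))) (fun t => hr t _ le_rfl)
    fun t i o d => ?_
  have hN := (hp'' t).1
  have hA : (e (a t)).size ≤ _ := (hp' t).1
  have hs := (n t).spine_le_size
  have h₁ := exec_iterate hp (r.eval (u t).size) (q''.eval (u t).size) i o d (n t) (a t) hN (hr t)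
  have h₂ : Exec (.op (.pop .dat))
    (data i o (BTree.leaf.code ++ ((e (f^[(n t).spine] (a t))).code ++ d))) 1
    (data i o ((e (f^[(n t).spine] (a t))).code ++ d)) := .op le_rfl
  refine (Run.seq (exec_dupTree (u t) i o d) (.seq ((hp'' t).2 i o _)
    (.seq (exec_swapTrees _ _ i o d) (.seq ((hp' t).2 i o _) (.seq (exec_swapTrees _ _ i o d)
    (.seq h₁ h₂ le_rfl) le_rfl) le_rfl) le_rfl) le_rfl) le_rfl).mono ?_
  have := Nat.mul_le_mul_right (60 * q''.eval (u t).size + 40 * r.eval (u t).size +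
    q.eval (r.eval (u t).size) + 3) (hs.trans hN)
  simp [Polynomial.eval_comp]
  omega

end StackMachine

/-! ## Polynomial time functions on data types -/

/-- Types whose elements are written as trees. -/
class TreeCode (α : Type) where
  toTree : α → BTree

namespace TreeCode

variable {α β γ δ σ : Type} [TreeCode α] [TreeCode β] [TreeCode γ] [TreeCode δ] [TreeCode σ]

instance : TreeCode Bool := ⟨fun b => bif b then .node .leaf .leaf else .leaf⟩

instance : TreeCode (α × β) := ⟨fun x => .node (toTree x.1) (toTree x.2)⟩

/-- The tree of a list. -/
def listTree : List α → BTree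
  | [] => .leaf
  | a :: l => .node (toTree a) (listTree l)

instance : TreeCode (List α) := ⟨listTree⟩

/-- The size of the tree of `a`. -/
def sz (a : α) : ℕ := (toTree a).size

@[simp] theorem sz_pair (a : α) (b : β) : sz (a, b) = sz a + sz b + 1 := rfl

@[simp] theorem sz_nil : sz ([] : List α) = 1 := rfl

@[simp] theorem sz_cons (a : α) (l : List α) : sz (a :: l) = sz a + sz l + 1 := rfl

theorem sz_bool (b : Bool) : sz b ≤ 3 := by cases b <;> decide

theorem sz_append (l l' : List α) : sz (l ++ l') + 1 = sz l + sz l' := by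
  induction l with
  | nil => simp [Nat.add_comm]
  | cons a l ih => simp; omega

theorem sz_le_of_mem {a : α} {l : List α} (h : a ∈ l) : sz a ≤ sz l := by
  induction l with
  | nil => simp at h
  | cons b l ih =>
    rcases List.mem_cons.1 h with rfl | h
    · simp; omega
    · have := ih h
      simp; omega

theorem length_le_sz (l : List α) : l.length ≤ sz l := by
  induction l with
  | nil => simp
  | cons b l ih => simp; omega

theorem sz_drop_le (l : List α) (k : ℕ) : sz (l.drop k) ≤ sz l := by
  induction l generalizing k with
  | nil => simp
  | cons b l ih =>
    cases k with
    | zero => simp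
    | succ k => have := ih k; simp; omega

theorem sz_list_le (l : List α) (B : ℕ) (h : ∀ a ∈ l, sz a ≤ B) : sz l ≤ l.length * (B + 1) + 1 := by
  induction l with
  | nil => simp
  | cons b l ih =>
    have := ih fun a ha => h a (by simp [ha])
    have := h b (by simp)
    simp [Nat.add_mul]; omega

@[simp] theorem spine_toTree (l : List α) : (toTree l).spine = l.length := by
  induction l with
  | nil => rfl
  | cons a l ih => exact congrArg (· + 1) ih

end TreeCode

open TreeCode StackMachine

/-- The function `f` is computed on trees in polynomial time. -/
@[fun_prop]
def PolyFun {α β : Type} [TreeCode α] [TreeCode β] (f : α → β) : Prop :=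
  TreePoly toTree fun a => toTree (f a)

namespace PolyFun

variable {α β γ δ σ : Type} [TreeCode α] [TreeCode β] [TreeCode γ] [TreeCode δ] [TreeCode σ]

theorem sz_le {f : α → β} (hf : PolyFun f) : ∃ q : Polynomial ℕ, ∀ a, sz (f a) ≤ q.eval (sz a) := by
  obtain ⟨p, q, h⟩ := hf
  exact ⟨q, fun a => (h a).1⟩

@[fun_prop]
theorem id' : PolyFun fun a : α => a := TreePoly.id

@[fun_prop]
theorem comp {f : β → γ} {g : α → β} (hf : PolyFun f) (hg : PolyFun g) :
    PolyFun fun a => f (g a) := (TreePoly.reindex hf g).comp hg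

theorem _root_.StackMachine.TreePoly.const {ι : Type} {u : ι → BTree} (t : BTree) :
    TreePoly u fun _ => t := by
  induction t with
  | leaf => exact .leaf
  | node a b iha ihb => exact iha.node ihb

@[fun_prop]
theorem const (b : β) : PolyFun fun _ : α => b := TreePoly.const (toTree b)

@[fun_prop]
theorem mk {f : α → β} {g : α → γ} (hf : PolyFun f) (hg : PolyFun g) :
    PolyFun fun a => (f a, g a) := TreePoly.node hf hg

@[fun_prop]
theorem fst : PolyFun fun a : α × β => a.1 := TreePoly.left (w := fun a : α × β => toTree a.2)

@[fun_prop]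
theorem snd : PolyFun fun a : α × β => a.2 := TreePoly.right (v := fun a : α × β => toTree a.1)

@[fun_prop]
theorem cond {c : α → Bool} {f g : α → β} (hc : PolyFun c) (hf : PolyFun f) (hg : PolyFun g) :
    PolyFun fun a => bif c a then f a else g a := by
  refine TreePoly.cond hc ?_ ?_
  -- The tree of a Boolean is a leaf exactly when it is `false`, so the leaf branch belongs to `g`.
  · convert TreePoly.reindex hg fun t : {t // (toTree (c t)).isLeaf = true} => t.1 with t
    obtain ⟨t, ht⟩ := t
    cases h : c t
    · simp [h]
    · rw [h] at ht; cases ht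
  · convert TreePoly.reindex hf fun t : {t // (toTree (c t)).isLeaf = false} => t.1 with t
    obtain ⟨t, ht⟩ := t
    cases h : c t
    · rw [h] at ht; cases ht
    · simp [h]

@[fun_prop]
theorem cons {f : α → β} {g : α → List β} (hf : PolyFun f) (hg : PolyFun g) :
    PolyFun fun a => f a :: g a := TreePoly.node hf hg

/-- A nonempty list is coded like the pair of its head and tail, so the code of `(a, f a)` is
already that of `(a, head, tail)` and nothing has to be computed to split the list. -/
theorem listCase {f : α → List β} {g : α → γ} {h : α → β → List β → γ} (hf : PolyFun f)
    (hg : PolyFun g) (hh : PolyFun fun x : α × β × List β => h x.1 x.2.1 x.2.2) :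
    PolyFun fun a => (List.casesOn (f a) (g a) (h a) : γ) := by
  refine TreePoly.cond hf ?_ ?_
  · convert TreePoly.reindex hg fun t : {t // (toTree (f t)).isLeaf = true} => t.1 with t
    obtain ⟨t, ht⟩ := t
    cases h : f t
    · simp [h]
    · rw [h] at ht; cases ht
  · have ne (t : {t // (toTree (f t)).isLeaf = false}) : f t.1 ≠ [] := by
      obtain ⟨t, ht⟩ := t
      intro h
      rw [h] at ht; cases ht
    have h₁ := TreePoly.reindex (id'.mk hf) fun t : {t // (toTree (f t)).isLeaf = false} => t.1
    have h₂ := TreePoly.reindex hh fun t : {t // (toTree (f t)).isLeaf = false} =>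
      (t.1, (f t.1).head (ne t), (f t.1).tail)
    have e₁ (t : {t // (toTree (f t)).isLeaf = false}) :
        toTree (t.1, (f t.1).head (ne t), (f t.1).tail) = toTree (t.1, f t.1) :=
      congrArg (fun l => toTree (t.1, l)) (List.cons_head_tail (ne t))
    have e₂ (t : {t // (toTree (f t)).isLeaf = false}) :
        toTree (h t.1 ((f t.1).head (ne t)) (f t.1).tail) =
          toTree (List.casesOn (f t.1) (g t.1) (h t.1) : γ) := by
      have := ne t
      obtain ⟨b, m, e⟩ := List.exists_cons_of_ne_nil this
      simp only [e, List.head_cons, List.tail_cons]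
    simp only [e₁, e₂] at h₂
    exact TreePoly.comp h₂ h₁

@[fun_prop]
theorem headD {f : α → List β} (d : β) (hf : PolyFun f) : PolyFun fun a => (f a).headD d :=
  (hf.listCase (h := fun _ b _ => b) (const d) (by fun_prop)).comp id' |> fun h => by
    convert h with a
    cases f a <;> rfl

@[fun_prop]
theorem tail {f : α → List β} (hf : PolyFun f) : PolyFun fun a => (f a).tail := by
  convert hf.listCase (h := fun _ _ l => l) (const []) (by fun_prop) with a
  cases f a <;> rfl

@[fun_prop]
theorem not {f : α → Bool} (hf : PolyFun f) : PolyFun fun a => !f a := by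
  convert hf.cond (const false) (const true) with a
  cases f a <;> rfl

@[fun_prop]
theorem and {f g : α → Bool} (hf : PolyFun f) (hg : PolyFun g) : PolyFun fun a => f a && g a := by
  convert hf.cond hg (const false) with a
  cases f a <;> rfl

@[fun_prop]
theorem or {f g : α → Bool} (hf : PolyFun f) (hg : PolyFun g) : PolyFun fun a => f a || g a := by
  convert hf.cond (const true) hg with a
  cases f a <;> rfl

@[fun_prop]
theorem xor {f g : α → Bool} (hf : PolyFun f) (hg : PolyFun g) : PolyFun fun a => f a ^^ g a := by
  convert hf.cond hg.not hg with a
  cases f a <;> simp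

theorem iterate {f : σ → σ} {s : α → σ} {l : α → List β} (hf : PolyFun f) (hs : PolyFun s)
    (hl : PolyFun l) (q : Polynomial ℕ)
    (hq : ∀ a, ∀ k ≤ (l a).length, sz (f^[k] (s a)) ≤ q.eval (sz a)) :
    PolyFun fun a => f^[(l a).length] (s a) := by
  have h := TreePoly.iterate hf hs hl q fun a k hk => hq a k (by rwa [spine_toTree] at hk)
  simp only [spine_toTree] at h
  exact h

/-- The fold is an iteration on triples of parameter, accumulator and remaining list, with the list
itself as counter. The bound on partial folds is what `iterate` needs. -/
theorem foldl_bound {l : α → List β} {s : α → σ} {f : α → σ → β → σ} (hl : PolyFun l)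
    (hs : PolyFun s) (hf : PolyFun fun x : α × σ × β => f x.1 x.2.1 x.2.2) (q : Polynomial ℕ)
    (hq : ∀ a k, sz (((l a).take k).foldl (f a) (s a)) ≤ q.eval (sz a)) :
    PolyFun fun a => (l a).foldl (f a) (s a) := by
  let step : α × σ × List β → α × σ × List β := fun x =>
    List.casesOn x.2.2 x fun b l => (x.1, f x.1 x.2.1 b, l)
  have hstep : PolyFun step := by
    refine listCase (α := α × σ × List β) (h := fun x b l => (x.1, f x.1 x.2.1 b, l)) (by fun_prop) (by fun_prop) ?_
    refine mk (by fun_prop) (mk (hf.comp (g := fun x : (α × σ × List β) × β × List β =>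
      (x.1.1, x.1.2.1, x.2.1)) (by fun_prop)) (by fun_prop))
  have key (k : ℕ) (a : α) (t : σ) (m : List β) :
      step^[k] (a, t, m) = (a, (m.take k).foldl (f a) t, m.drop k) := by
    induction k generalizing t m with
    | zero => simp
    | succ k ih =>
      rw [Function.iterate_succ_apply]
      cases m with
      | nil => exact (ih t []).trans (by simp)
      | cons b m => exact (ih _ m).trans (by simp)
  obtain ⟨r, hr⟩ := hl.sz_le
  have h := hstep.iterate (s := fun a => (a, s a, l a)) (by fun_prop) hl (.X + (q + r + 1) + 1)
    fun a k _ => by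
      rw [key]
      have := hq a k
      have := hr a
      have := sz_drop_le (l a) k
      simp; omega
  simp only [key, List.take_length] at h
  exact (fst.comp snd).comp h

/-- Folds in which each step adds at most a polynomial amount to the size of the state. -/
theorem foldl {l : α → List β} {s : α → σ} {f : α → σ → β → σ} (hl : PolyFun l)
    (hs : PolyFun s) (hf : PolyFun fun x : α × σ × β => f x.1 x.2.1 x.2.2) (q : Polynomial ℕ)
    (hq : ∀ a t, ∀ b ∈ l a, sz (f a t b) ≤ sz t + q.eval (sz a)) :
    PolyFun fun a => (l a).foldl (f a) (s a) := by
  obtain ⟨r, hr⟩ := hl.sz_le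
  obtain ⟨r', hr'⟩ := hs.sz_le
  refine foldl_bound hl hs hf (r' + r * q) fun a k => ?_
  have key (m : List β) (t : σ) (hm : ∀ b ∈ m, b ∈ l a) :
      sz (m.foldl (f a) t) ≤ sz t + m.length * q.eval (sz a) := by
    induction m generalizing t with
    | nil => simp
    | cons b m ih =>
      have h₁ := ih (f a t b) fun b hb => hm b (by simp [hb])
      have h₂ := hq a t b (hm b (by simp))
      simp [Nat.add_mul]; omega
  have h₁ := key _ (s a) fun b hb => List.mem_of_mem_take (i := k) hb
  have h₂ := Nat.mul_le_mul_right (q.eval (sz a))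
    (((List.length_take_le' k (l a)).trans (length_le_sz _)).trans (hr a))
  have := hr' a
  simp; omega

@[fun_prop]
theorem reverse {l : α → List β} (hl : PolyFun l) : PolyFun fun a => (l a).reverse := by
  obtain ⟨r, hr⟩ := hl.sz_le
  have h := foldl hl (const ([] : List β)) (f := fun _ t b => b :: t) (by fun_prop) (r + 1)
    fun a t b hb => by
      have := hr a
      have := sz_le_of_mem hb
      simp; omega
  simpa using h

theorem foldr {l : α → List β} {s : α → σ} {f : α → β → σ → σ} (hl : PolyFun l)
    (hs : PolyFun s) (hf : PolyFun fun x : α × β × σ => f x.1 x.2.1 x.2.2) (q : Polynomial ℕ)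
    (hq : ∀ a t, ∀ b ∈ l a, sz (f a b t) ≤ sz t + q.eval (sz a)) :
    PolyFun fun a => (l a).foldr (f a) (s a) := by
  have h := foldl hl.reverse hs (f := fun a t b => f a b t)
    (hf.comp (g := fun x : α × σ × β => (x.1, x.2.2, x.2.1)) (by fun_prop)) q
    fun a t b hb => hq a t b (by simpa using hb)
  simpa using h

theorem map {l : α → List β} {f : α → β → γ} (hl : PolyFun l)
    (hf : PolyFun fun x : α × β => f x.1 x.2) : PolyFun fun a => (l a).map (f a) := by
  obtain ⟨r, hr⟩ := hl.sz_le
  obtain ⟨q, hq⟩ := hf.sz_le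
  have h := foldr hl (const ([] : List γ)) (f := fun a b t => f a b :: t)
    (cons (hf.comp (g := fun x : α × β × List γ => (x.1, x.2.1)) (by fun_prop)) (by fun_prop))
    (q.comp (.X + r + 1) + 1) fun a t b hb => by
      have h₁ := hq (a, b)
      have h₂ : q.eval (sz (a, b)) ≤ q.eval (sz a + r.eval (sz a) + 1) :=
        q.eval_nat_mono (by have := hr a; have := sz_le_of_mem hb; simp; omega)
      simp [Polynomial.eval_comp]
      simp at h₁ h₂
      omega
  have e a : (l a).map (f a) = (l a).foldr (fun b t => f a b :: t) [] := by
    induction l a with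
    | nil => rfl
    | cons b m ih => simp only [List.map_cons, List.foldr_cons, ih]
  simpa only [e] using h

@[fun_prop]
theorem append {f g : α → List β} (hf : PolyFun f) (hg : PolyFun g) :
    PolyFun fun a => f a ++ g a := by
  obtain ⟨r, hr⟩ := hf.sz_le
  have h := foldr hf hg (f := fun _ b t => b :: t) (by fun_prop) (r + 1) fun a t b hb => by
      have := hr a
      have := sz_le_of_mem hb
      simp; omega
  have e a : f a ++ g a = (f a).foldr (fun b t => b :: t) (g a) := by
    induction f a with
    | nil => rfl
    | cons b m ih => simp only [List.cons_append, List.foldr_cons, ih]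
  simpa only [e] using h

theorem all {l : α → List β} {f : α → β → Bool} (hl : PolyFun l)
    (hf : PolyFun fun x : α × β => f x.1 x.2) : PolyFun fun a => (l a).all (f a) := by
  have h := foldr hl (const true) (f := fun a b t => f a b && t)
    (and (hf.comp (g := fun x : α × β × Bool => (x.1, x.2.1)) (by fun_prop)) (by fun_prop)) 3
    fun a t b _ => by
      have := sz_bool (f a b && t)
      simp; omega
  have e a : (l a).all (f a) = (l a).foldr (fun b t => f a b && t) true := by
    induction l a with
    | nil => rfl
    | cons b m ih => simp [ih]
  simpa only [e] using h

end PolyFun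

/-! ## Binary arithmetic -/

open TreeCode

namespace Binary

/-- The value of a list of bits, least significant bit first. -/
def bval : List Bool → ℕ
  | [] => 0
  | b :: l => b.toNat + 2 * bval l

/-- The pairs of bits at the same place, the shorter list being padded by zeros. -/
def zipPad : List Bool → List Bool → List (Bool × Bool)
  | [], y => y.map fun b => (false, b)
  | a :: x, y => (a, y.headD false) :: zipPad x y.tail

/-- One step of an addition: the state consists of the carry and the reversed sum so far. -/
def addStep (s : Bool × List Bool) (d : Bool × Bool) : Bool × List Bool :=
  (bif d.1 then d.2 || s.1 else d.2 && s.1, (d.1 ^^ (d.2 ^^ s.1)) :: s.2)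

/-- Addition. -/
def add (x y : List Bool) : List Bool :=
  ((zipPad x y).foldl addStep (false, [])).2.reverse ++
    [((zipPad x y).foldl addStep (false, [])).1]

/-- Comparison. -/
def lt (x y : List Bool) : Bool :=
  (zipPad x y).foldl (fun r d => bif d.1 ^^ d.2 then d.2 else r) false

/-- Multiplication. -/
def mul (x y : List Bool) : List Bool :=
  x.foldr (fun b s => add (bif b then y else []) (false :: s)) []

/-- Equality of values. -/
def keq (x y : List Bool) : Bool := !lt x y && !lt y x

theorem bval_append (x y : List Bool) : bval (x ++ y) = bval x + 2 ^ x.length * bval y := by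
  induction x with
  | nil => simp [bval]
  | cons a x ih => simp [bval, ih, pow_succ]; ring

/-- The numbers formed by the first and second components. -/
theorem bval_zipPad (x y : List Bool) : bval ((zipPad x y).map Prod.fst) = bval x ∧
    bval ((zipPad x y).map Prod.snd) = bval y := by
  induction x generalizing y with
  | nil =>
    refine ⟨?_, by simp [zipPad, Function.comp_def]⟩
    induction y with
    | nil => rfl
    | cons b y ih => simpa [zipPad, bval, Function.comp_def] using ih
  | cons a x ih =>
    refine ⟨by simp [zipPad, bval, (ih _).1], ?_⟩
    cases y <;> simp [zipPad, bval, (ih _).2]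

/-- The invariant of addition with carry: the digits found so far, plus the carry and the unread
digits of both numbers weighted by the current power of two, have a constant sum. -/
theorem bval_foldl_addStep (l : List (Bool × Bool)) (s : Bool × List Bool) :
    bval ((l.foldl addStep s).2.reverse ++ [(l.foldl addStep s).1]) =
      bval s.2.reverse + 2 ^ s.2.length *
        (s.1.toNat + bval (l.map Prod.fst) + bval (l.map Prod.snd)) := by
  induction l generalizing s with
  | nil => simp [bval_append, bval]
  | cons d l ih =>
    rw [List.foldl_cons, ih]
    obtain ⟨c, r⟩ := s
    obtain ⟨a, b⟩ := d
    cases a <;> cases b <;> cases c <;> simp [addStep, bval_append, bval, pow_succ] <;> ring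

@[simp] theorem bval_add (x y : List Bool) : bval (add x y) = bval x + bval y := by
  rw [add, bval_foldl_addStep, (bval_zipPad x y).1, (bval_zipPad x y).2]
  simp [bval]

/-- Bits are read from the least significant one, so each difference overrules the verdict `r`
reached before, and the most significant difference decides. -/
theorem foldl_lt (l : List (Bool × Bool)) (r : Bool) :
    l.foldl (fun r d => bif d.1 ^^ d.2 then d.2 else r) r = true ↔
      bval (l.map Prod.fst) < bval (l.map Prod.snd) ∨
        bval (l.map Prod.fst) = bval (l.map Prod.snd) ∧ r = true := by
  induction l generalizing r with
  | nil => simp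
  | cons d l ih =>
    rw [List.foldl_cons, ih]
    obtain ⟨a, b⟩ := d
    cases a <;> cases b <;> simp [bval] <;> omega

@[simp] theorem lt_iff (x y : List Bool) : lt x y = true ↔ bval x < bval y := by
  rw [lt, foldl_lt, (bval_zipPad x y).1, (bval_zipPad x y).2]
  simp

@[simp] theorem keq_iff (x y : List Bool) : keq x y = true ↔ bval x = bval y := by
  have h₁ := lt_iff x y
  have h₂ := lt_iff y x
  simp only [keq, Bool.and_eq_true, Bool.not_eq_true', ← Bool.not_eq_true, h₁, h₂]
  omega

@[simp] theorem bval_mul (x y : List Bool) : bval (mul x y) = bval x * bval y := by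
  induction x with
  | nil => simp [mul, bval]
  | cons b x ih =>
    have : mul (b :: x) y = add (bif b then y else []) (false :: mul x y) := rfl
    rw [this, bval_add, bval, bval, ih]
    cases b <;> simp [bval] <;> ring

theorem length_zipPad (x y : List Bool) : (zipPad x y).length = max x.length y.length := by
  induction x generalizing y with
  | nil => simp [zipPad]
  | cons a x ih => cases y <;> simp [zipPad, ih]

theorem length_foldl_addStep (l : List (Bool × Bool)) (s : Bool × List Bool) :
    (l.foldl addStep s).2.length = s.2.length + l.length := by
  induction l generalizing s with
  | nil => simp
  | cons d l ih => simp [ih, addStep]; omega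

theorem length_add (x y : List Bool) : (add x y).length = max x.length y.length + 1 := by
  simp [add, length_foldl_addStep, length_zipPad]

/-- Each bit of `x` lengthens the partial product by at most two places, one for the shift and one
for the carry. That `y` counts only once is essential for `flen_fadd_le`. -/
theorem length_mul_le (x y : List Bool) : (mul x y).length ≤ 2 * x.length + y.length := by
  induction x with
  | nil => simp [mul]
  | cons b x ih =>
    have : mul (b :: x) y = add (bif b then y else []) (false :: mul x y) := rfl
    rw [this, length_add]
    cases b <;> simp <;> omega

theorem sz_bits_le (x : List Bool) : sz x ≤ 4 * x.length + 1 := by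
  have := sz_list_le x 3 fun b _ => sz_bool b
  omega

variable {α : Type} [TreeCode α]

theorem polyFun_zipPad {f g : α → List Bool} (hf : PolyFun f) (hg : PolyFun g) :
    PolyFun fun a => zipPad (f a) (g a) := by
  let step : List Bool × List (Bool × Bool) → Bool → List Bool × List (Bool × Bool) :=
    fun s a => (s.1.tail, (a, s.1.headD false) :: s.2)
  have h := PolyFun.foldl hf (s := fun a => (g a, ([] : List (Bool × Bool))))
    (f := fun _ s b => step s b) (by fun_prop) (by fun_prop) 8 fun a t b _ => by
      have h₁ := sz_bool b
      have h₂ := sz_bool (t.1.headD false)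
      have h₃ := sz_drop_le t.1 1
      obtain ⟨t₁, t₂⟩ := t
      simp [step] at h₂ h₃ ⊢
      omega
  have e (x y : List Bool) (m : List (Bool × Bool)) :
      (x.foldl step (y, m)).2.reverse ++ (x.foldl step (y, m)).1.map (fun b => (false, b)) =
        m.reverse ++ zipPad x y := by
    induction x generalizing y m with
    | nil => rfl
    | cons a x ih =>
      rw [List.foldl_cons, ih]
      simp [zipPad]
  have h' := PolyFun.append (PolyFun.reverse (PolyFun.snd.comp h))
    (PolyFun.map (f := fun _ b => (false, b)) (PolyFun.fst.comp h) (by fun_prop))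
  simpa only [e, List.reverse_nil, List.nil_append] using h'

@[fun_prop]
theorem polyFun_add {f g : α → List Bool} (hf : PolyFun f) (hg : PolyFun g) :
    PolyFun fun a => add (f a) (g a) := by
  have hz := polyFun_zipPad hf hg
  have h := PolyFun.foldl hz (s := fun _ => (false, ([] : List Bool)))
    (f := fun _ s b => addStep s b) (by fun_prop) (by unfold addStep; fun_prop) 8 fun a t b _ => by
      have h₁ := sz_bool (addStep t b).1
      have h₂ := sz_bool (b.1 ^^ (b.2 ^^ t.1))
      obtain ⟨t₁, t₂⟩ := t
      simp [addStep] at h₁ h₂ ⊢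
      omega
  unfold add
  fun_prop

@[fun_prop]
theorem polyFun_lt {f g : α → List Bool} (hf : PolyFun f) (hg : PolyFun g) :
    PolyFun fun a => lt (f a) (g a) := by
  unfold lt
  exact PolyFun.foldl (polyFun_zipPad hf hg) (s := fun _ => false)
    (f := fun _ r d => bif d.1 ^^ d.2 then d.2 else r) (by fun_prop) (by fun_prop) 3
    fun a t b _ => by
      have := sz_bool (bif b.1 ^^ b.2 then b.2 else t)
      simp; omega

@[fun_prop]
theorem polyFun_keq {f g : α → List Bool} (hf : PolyFun f) (hg : PolyFun g) :
    PolyFun fun a => keq (f a) (g a) := by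
  unfold keq
  fun_prop

@[fun_prop]
theorem polyFun_mul {f g : α → List Bool} (hf : PolyFun f) (hg : PolyFun g) :
    PolyFun fun a => mul (f a) (g a) := by
  obtain ⟨q, hq⟩ := hg.sz_le
  obtain ⟨r, hr⟩ := hf.sz_le
  have hg' := hg.comp (PolyFun.fst (α := α) (β := List Bool × Bool))
  have h := PolyFun.foldl_bound (l := fun a => (f a).reverse) (s := fun _ => ([] : List Bool))
    (f := fun a s b => add (bif b then g a else []) (false :: s)) (by fun_prop) (by fun_prop)
    (by fun_prop) (4 * (q + 2 * r) + 1) fun a k => by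
      -- The bound is on lengths, not tree sizes: the trees of the two bits differ in size, so one
      -- addition can enlarge the tree of a long list by more than a fixed amount.
      have key (m s : List Bool) :
          (m.foldl (fun s b => add (bif b then g a else []) (false :: s)) s).length ≤
            max (g a).length s.length + 2 * m.length := by
        induction m generalizing s with
        | nil => simp
        | cons b m ih =>
          refine (ih _).trans ?_
          rw [length_add]
          cases b <;> simp <;> omega
      have h₁ := key ((f a).reverse.take k) []
      have h₂ := sz_bits_le (((f a).reverse.take k).foldl
        (fun s b => add (bif b then g a else []) (false :: s)) [])
      have h₃ := List.length_take_le' k (f a).reverse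
      have := hq a
      have := hr a
      have := length_le_sz (g a)
      have := length_le_sz (f a)
      simp at h₁ h₂ h₃ ⊢
      omega
  simpa [mul] using h

end Binary

/-! ## Fractions and association lists -/

open TreeCode

/-- For folds whose growth is best measured otherwise than by tree size: the invariant may depend on
the number of steps done, and yields the size bound only at the end. -/
theorem PolyFun.foldl_inv {α β σ : Type} [TreeCode α] [TreeCode β] [TreeCode σ] {l : α → List β}
    {s : α → σ} {f : α → σ → β → σ} (hl : PolyFun l) (hs : PolyFun s)
    (hf : PolyFun fun x : α × σ × β => f x.1 x.2.1 x.2.2) (I : α → ℕ → σ → Prop)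
    (h₀ : ∀ a, I a 0 (s a)) (h₁ : ∀ a k t, ∀ b ∈ l a, I a k t → I a (k + 1) (f a t b))
    (q : Polynomial ℕ) (hq : ∀ a k t, k ≤ (l a).length → I a k t → sz t ≤ q.eval (sz a)) :
    PolyFun fun a => (l a).foldl (f a) (s a) := by
  refine foldl_bound hl hs hf q fun a k => ?_
  have key (m : List β) (hm : ∀ b ∈ m, b ∈ l a) (j : ℕ) (t : σ) (ht : I a j t) :
      I a (j + m.length) (m.foldl (f a) t) := by
    induction m generalizing j t with
    | nil => exact ht
    | cons b m ih =>
      have := ih (fun b hb => hm b (by simp [hb])) (j + 1) _ (h₁ a j t b (hm b (by simp)) ht)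
      rwa [Nat.add_right_comm] at this
  exact hq a _ _ (by simp) (key _ (fun b hb => List.mem_of_mem_take hb) 0 _ (h₀ a))

namespace Binary

variable {α β : Type} [TreeCode α] [TreeCode β]

/-- `(a, b, q)` stands for `(a - b) / q`. -/
abbrev Frac : Type := List Bool × List Bool × List Bool

/-- The zero fraction. -/
def fzero : Frac := ([], [], [true])

/-- Addition of fractions. -/
def fadd (w d : Frac) : Frac :=
  (add (mul w.2.2 d.1) (mul w.1 d.2.2), add (mul w.2.2 d.2.1) (mul w.2.1 d.2.2), mul w.2.2 d.2.2)

/-- Negation of fractions. -/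
def fneg (w : Frac) : Frac := (w.2.1, w.1, w.2.2)

/-- Comparison of fractions. -/
def flt (w d : Frac) : Bool :=
  lt (add (mul w.1 d.2.2) (mul d.2.1 w.2.2)) (add (mul d.1 w.2.2) (mul w.2.1 d.2.2))

@[fun_prop]
theorem polyFun_fadd {f g : α → Frac} (hf : PolyFun f) (hg : PolyFun g) :
    PolyFun fun a => fadd (f a) (g a) := by
  unfold fadd
  fun_prop

@[fun_prop]
theorem polyFun_fneg {f : α → Frac} (hf : PolyFun f) : PolyFun fun a => fneg (f a) := by
  unfold fneg
  fun_prop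

@[fun_prop]
theorem polyFun_flt {f g : α → Frac} (hf : PolyFun f) (hg : PolyFun g) :
    PolyFun fun a => flt (f a) (g a) := by
  unfold flt
  fun_prop

/-- The value of a fraction. -/
noncomputable def fval (w : Frac) : ℝ := ((bval w.1 : ℝ) - bval w.2.1) / bval w.2.2

/-- The fraction `w` has the value `x`, and its denominator is not zero. -/
def Frac.Is (w : Frac) (x : ℝ) : Prop := bval w.2.2 ≠ 0 ∧ fval w = x

theorem Frac.Is.zero : Frac.Is fzero 0 := by simp [Frac.Is, fzero, fval, bval]

theorem Frac.Is.add {w d : Frac} {x y : ℝ} (hw : w.Is x) (hd : d.Is y) : (fadd w d).Is (x + y) := by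
  obtain ⟨hw, rfl⟩ := hw
  obtain ⟨hd, rfl⟩ := hd
  refine ⟨by simp [fadd, hw, hd], ?_⟩
  have h₁ : (bval w.2.2 : ℝ) ≠ 0 := by exact_mod_cast hw
  have h₂ : (bval d.2.2 : ℝ) ≠ 0 := by exact_mod_cast hd
  simp only [fadd, fval, bval_add, bval_mul]
  push_cast
  field_simp
  ring

theorem Frac.Is.neg {w : Frac} {x : ℝ} (hw : w.Is x) : (fneg w).Is (-x) := by
  obtain ⟨hw, rfl⟩ := hw
  exact ⟨hw, by simp [fneg, fval, ← neg_div]⟩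

theorem Frac.Is.lt_iff {w d : Frac} {x y : ℝ} (hw : w.Is x) (hd : d.Is y) :
    flt w d = true ↔ x < y := by
  obtain ⟨hw, rfl⟩ := hw
  obtain ⟨hd, rfl⟩ := hd
  have h₁ : (0 : ℝ) < bval w.2.2 := by exact_mod_cast Nat.pos_of_ne_zero hw
  have h₂ : (0 : ℝ) < bval d.2.2 := by exact_mod_cast Nat.pos_of_ne_zero hd
  rw [flt, Binary.lt_iff, fval, fval, div_lt_div_iff₀ h₁ h₂, ← Nat.cast_lt (α := ℝ)]
  simp only [bval_add, bval_mul]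
  push_cast
  constructor <;> intro h <;> linarith

/-- The greatest length of a component. -/
def flen (w : Frac) : ℕ := max w.1.length (max w.2.1.length w.2.2.length)

/-- In all products the factor from `w` comes first, so by `length_mul_le` the length of `d` enters
with coefficient one. In `relax` the argument `w` is an input weight and `d` a stored value; hence
stored values grow linearly, not exponentially, in the number of relaxations. -/
theorem flen_fadd_le (w d : Frac) : flen (fadd w d) ≤ flen d + 2 * flen w + 1 := by
  have := length_mul_le w.2.2 d.1
  have := length_mul_le w.1 d.2.2
  have := length_mul_le w.2.2 d.2.1
  have := length_mul_le w.2.1 d.2.2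
  have := length_mul_le w.2.2 d.2.2
  simp only [flen, fadd, length_add]
  omega

theorem sz_frac_le (w : Frac) : sz w ≤ 12 * flen w + 5 := by
  have h₁ := sz_bits_le w.1
  have h₂ := sz_bits_le w.2.1
  have h₃ := sz_bits_le w.2.2
  obtain ⟨a, b, c⟩ := w
  simp [flen] at *
  omega

theorem flen_le_sz (w : Frac) : flen w ≤ sz w := by
  have h₁ := length_le_sz w.1
  have h₂ := length_le_sz w.2.1
  have h₃ := length_le_sz w.2.2
  obtain ⟨a, b, c⟩ := w
  simp [flen] at *
  omega

/-- The value of the first entry for the key `k`, or zero if there is none. -/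
def lookup (d : List (List Bool × Frac)) (k : List Bool) : Frac :=
  d.foldr (fun e r => bif keq e.1 k then e.2 else r) fzero

@[fun_prop]
theorem polyFun_lookup {f : α → List (List Bool × Frac)} {g : α → List Bool} (hf : PolyFun f)
    (hg : PolyFun g) : PolyFun fun a => lookup (f a) (g a) := by
  obtain ⟨r, hr⟩ := hf.sz_le
  have hg' := hg.comp (PolyFun.fst (α := α) (β := (List Bool × Frac) × Frac))
  unfold lookup
  refine PolyFun.foldr (s := fun _ => fzero)
    (f := fun a (e : List Bool × Frac) r => bif keq e.1 (g a) then e.2 else r) hf (by fun_prop)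
    (by fun_prop) r fun a t b hb => ?_
  have h₁ := sz_le_of_mem hb
  have h₂ := hr a
  obtain ⟨b₁, b₂⟩ := b
  cases keq b₁ (g a)
  · simp
  · simp at h₁ ⊢; omega

/-- If the edge `(a, b, w)`, that is, the constraint `a - b ≤ w`, is violated by the values `d`,
enter a smaller value for `a`. -/
def relax (d : List (List Bool × Frac)) (e : List Bool × List Bool × Frac) :
    List (List Bool × Frac) :=
  bif flt (fadd e.2.2 (lookup d e.2.1)) (lookup d e.1)
  then (e.1, fadd e.2.2 (lookup d e.2.1)) :: d else d

@[fun_prop]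
theorem polyFun_relax {f : α → List (List Bool × Frac)} {g : α → List Bool × List Bool × Frac}
    (hf : PolyFun f) (hg : PolyFun g) : PolyFun fun a => relax (f a) (g a) := by
  unfold relax
  fun_prop

theorem flen_lookup_le {d : List (List Bool × Frac)} {B : ℕ} (hB : 1 ≤ B)
    (h : ∀ e ∈ d, flen e.2 ≤ B) (k : List Bool) : flen (lookup d k) ≤ B := by
  induction d with
  | nil => simpa [lookup, flen, fzero] using hB
  | cons e d ih =>
    have h₁ := ih fun e he => h e (by simp [he])
    have h₂ := h e (by simp)
    have : lookup (e :: d) k = bif keq e.1 k then e.2 else lookup d k := rfl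
    rw [this]
    cases keq e.1 k <;> assumption

/-- After `k` relaxations there are at most `k` entries, their keys come from the input, and each
fraction has length at most `1 + k * (2 * r + 1)` for the input bound `r`; the `1` is the length of
`fzero`. -/
theorem polyFun_foldl_relax {f : α → List (List Bool × List Bool × Frac)} (hf : PolyFun f) :
    PolyFun fun a => (f a).foldl relax [] := by
  obtain ⟨r, hr⟩ := hf.sz_le
  refine PolyFun.foldl_inv (f := fun _ => relax) hf (by fun_prop) (by fun_prop)
    (fun a k d => d.length ≤ k ∧
      ∀ e ∈ d, sz e.1 ≤ r.eval (sz a) ∧ flen e.2 ≤ 1 + k * (2 * r.eval (sz a) + 1))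
    (fun a => by simp) ?_ (r * (r + 12 * (1 + r * (2 * r + 1)) + 6 + 1) + 1) ?_
  · intro a k d e he ⟨hk, hd⟩
    have h₁ := (sz_le_of_mem he).trans (hr a)
    have h₂ : sz e.1 ≤ r.eval (sz a) ∧ sz e.2.2 ≤ r.eval (sz a) := by
      obtain ⟨e₁, e₂, e₃⟩ := e
      simp at h₁ ⊢; omega
    have h₃ := flen_lookup_le (d := d) (Nat.le_add_right 1 _) (fun e he => (hd e he).2) e.2.1
    have h₄ := flen_fadd_le e.2.2 (lookup d e.2.1)
    have h₅ := flen_le_sz e.2.2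
    have hd' : ∀ e ∈ d, sz e.1 ≤ r.eval (sz a) ∧
        flen e.2 ≤ 1 + (k + 1) * (2 * r.eval (sz a) + 1) := fun e he =>
      ⟨(hd e he).1, (hd e he).2.trans (by gcongr; omega)⟩
    unfold relax
    cases flt (fadd e.2.2 (lookup d e.2.1)) (lookup d e.1) with
    | false => exact ⟨by simp; omega, hd'⟩
    | true =>
      refine ⟨by simpa using hk, fun e' he' => ?_⟩
      rcases List.mem_cons.1 he' with rfl | he'
      · refine ⟨h₂.1, ?_⟩
        simp only [Nat.add_mul, one_mul]
        omega
      · exact hd' e' he'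
  · intro a k d hk ⟨hd, hd'⟩
    have hk' : k ≤ r.eval (sz a) := (hk.trans (length_le_sz _)).trans (hr a)
    have h₁ := Nat.mul_le_mul_right (2 * r.eval (sz a) + 1) hk'
    have h₂ := sz_list_le d (r.eval (sz a) + 12 * (1 + r.eval (sz a) * (2 * r.eval (sz a) + 1)) + 6)
      fun e he => by
        have h₃ := hd' e he
        have h₄ := sz_frac_le e.2
        obtain ⟨e₁, e₂⟩ := e
        simp at h₃ h₄ ⊢
        omega
    have h₅ := Nat.mul_le_mul_right
      (r.eval (sz a) + 12 * (1 + r.eval (sz a) * (2 * r.eval (sz a) + 1)) + 6 + 1) (hd.trans hk')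
    simp
    omega

theorem polyFun_flatMap {f : α → List β} {γ : Type} [TreeCode γ] {g : α → β → List γ}
    (hf : PolyFun f) (hg : PolyFun fun x : α × β => g x.1 x.2) :
    PolyFun fun a => (f a).flatMap (g a) := by
  obtain ⟨r, hr⟩ := hf.sz_le
  obtain ⟨q, hq⟩ := hg.sz_le
  have hg' := hg.comp (g := fun x : α × β × List γ => (x.1, x.2.1)) (by fun_prop)
  have h := PolyFun.foldr hf (s := fun _ => ([] : List γ)) (f := fun a b t => g a b ++ t)
    (by fun_prop) (by fun_prop) (q.comp (.X + r + 1)) fun a t b hb => by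
      have h₁ := hq (a, b)
      have h₂ : q.eval (sz (a, b)) ≤ q.eval (sz a + r.eval (sz a) + 1) :=
        q.eval_nat_mono (by have := hr a; have := sz_le_of_mem hb; simp; omega)
      have h₃ := sz_append (g a b) t
      simp [Polynomial.eval_comp]
      simp only [] at h₁ h₂
      omega
  have e a : (f a).flatMap (g a) = (f a).foldr (fun b t => g a b ++ t) [] := by
    induction f a with
    | nil => rfl
    | cons b m ih => simp only [List.flatMap_cons, List.foldr_cons, ih]
  simpa only [e] using h

/-- Relax all edges `es` once for each element of `exs`, and check that they hold then. -/
def solvable (exs : List (List Bool)) (es : List (List Bool × List Bool × Frac)) : Bool :=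
  es.all fun e => !flt (fadd e.2.2 (lookup ((exs.flatMap fun _ => es).foldl relax []) e.2.1))
    (lookup ((exs.flatMap fun _ => es).foldl relax []) e.1)

@[fun_prop]
theorem polyFun_solvable {f : α → List (List Bool)} {g : α → List (List Bool × List Bool × Frac)}
    (hf : PolyFun f) (hg : PolyFun g) : PolyFun fun a => solvable (f a) (g a) := by
  have hg' := hg.comp (PolyFun.fst (α := α) (β := List Bool))
  have h := polyFun_foldl_relax (polyFun_flatMap (g := fun a _ => g a) hf hg')
  have key (D : α → List (List Bool × Frac)) (hD : PolyFun D) :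
      PolyFun fun a => (g a).all fun e =>
        !flt (fadd e.2.2 (lookup (D a) e.2.1)) (lookup (D a) e.1) := by
    have hD' := hD.comp (PolyFun.fst (α := α) (β := List Bool × List Bool × Frac))
    exact PolyFun.all hg (by fun_prop)
  exact key _ h

/-- The record of a constraint: the two timepoints and the two bounds. -/
abbrev Rec : Type := List Bool × List Bool × Frac × Frac

/-- The executable timepoint on which `x` depends, and the bounds on the distance to it. -/
def resolve (cs : List Rec) (x : List Bool) : List Bool × Frac × Frac :=
  cs.foldr (fun c r => bif keq c.1 x then c.2 else r) (x, fzero, fzero)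

@[fun_prop]
theorem polyFun_resolve {f : α → List Rec} {g : α → List Bool} (hf : PolyFun f) (hg : PolyFun g) :
    PolyFun fun a => resolve (f a) (g a) := by
  obtain ⟨r, hr⟩ := hf.sz_le
  have hg' := hg.comp (PolyFun.fst (α := α) (β := Rec × List Bool × Frac × Frac))
  unfold resolve
  refine PolyFun.foldr (s := fun a => (g a, fzero, fzero))
    (f := fun a (c : Rec) r => bif keq c.1 (g a) then c.2 else r) hf (by fun_prop)
    (by fun_prop) r fun a t b hb => ?_
  have h₁ := sz_le_of_mem hb
  have h₂ := hr a
  obtain ⟨b₁, b₂⟩ := b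
  obtain ⟨t₁, t₂⟩ := t
  cases keq b₁ (g a) <;> simp only [sz_pair, Bool.cond_true, Bool.cond_false] at h₁ ⊢ <;> omega

/-- The edges that express a requirement constraint. -/
def recEdges (cs : List Rec) (r : Rec) : List (List Bool × List Bool × Frac) :=
  bif keq r.1 r.2.1 then
    [((resolve cs r.1).1, (resolve cs r.1).1, r.2.2.2),
      ((resolve cs r.1).1, (resolve cs r.1).1, fneg r.2.2.1)]
  else
    [((resolve cs r.1).1, (resolve cs r.2.1).1,
        fadd (fadd r.2.2.2 (fneg (resolve cs r.1).2.2)) (resolve cs r.2.1).2.1),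
      ((resolve cs r.2.1).1, (resolve cs r.1).1,
        fadd (fadd (fneg r.2.2.1) (resolve cs r.1).2.1) (fneg (resolve cs r.2.1).2.2))]

@[fun_prop]
theorem polyFun_recEdges {f : α → List Rec} {g : α → Rec} (hf : PolyFun f) (hg : PolyFun g) :
    PolyFun fun a => recEdges (f a) (g a) := by
  unfold recEdges
  fun_prop

/-- Decide controllability, given the executable timepoints, the contingent constraints and the
requirement constraints. -/
def controllable (exs : List (List Bool)) (cs rs : List Rec) : Bool :=
  !(cs.all fun c => !flt c.2.2.2 c.2.2.1) || solvable exs (rs.flatMap (recEdges cs))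

@[fun_prop]
theorem polyFun_controllable {f : α → List (List Bool)} {g h : α → List Rec} (hf : PolyFun f)
    (hg : PolyFun g) (hh : PolyFun h) : PolyFun fun a => controllable (f a) (g a) (h a) := by
  have h₁ := PolyFun.all (f := fun _ c => !flt c.2.2.2 c.2.2.1) hg (by fun_prop)
  have hg' := hg.comp (PolyFun.fst (α := α) (β := Rec))
  have h₂ := polyFun_flatMap (g := fun a r => recEdges (g a) r) hh (by fun_prop)
  unfold controllable
  fun_prop

end Binary

/-! ## Parsing -/

open TreeCode Computability

namespace Binary

variable {α β : Type} [TreeCode α] [TreeCode β]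

/-- The symbols of the input: a comma is `(true, false)`, a bit `b` is `(false, b)`. -/
def symbol : Γ' → Bool × Bool
  | .comma => (true, false)
  | .bit b => (false, b)
  | _ => (false, false)

/-- The words between commas. -/
def tokens (l : List (Bool × Bool)) : List (List Bool) :=
  l.foldr (fun s t => bif s.1 then [] :: t else (s.2 :: t.headD []) :: t.tail) []

theorem sz_headD_tail (t : List (List Bool)) : sz (t.headD []) + sz t.tail ≤ sz t + 1 := by
  cases t <;> simp; omega

@[fun_prop]
theorem polyFun_tokens {f : α → List (Bool × Bool)} (hf : PolyFun f) :
    PolyFun fun a => tokens (f a) :=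
  PolyFun.foldr (s := fun _ => ([] : List (List Bool)))
    (f := fun _ (s : Bool × Bool) t => bif s.1 then [] :: t else (s.2 :: t.headD []) :: t.tail)
    hf (by fun_prop) (by fun_prop) 6 fun a t b _ => by
      have h₁ := sz_headD_tail t
      have h₂ := sz_bool b.2
      cases b.1 <;> simp at * <;> omega

/-- The first `bval k` elements of a list, and the others. -/
def splitN {β : Type} (k : List Bool) (l : List β) : List β × List β :=
  ((l.foldl (fun (s : List Bool × List β × List β) x => bif lt s.1 k
    then (add s.1 [true], x :: s.2.1, s.2.2) else (s.1, s.2.1, x :: s.2.2)) ([], [], [])).2.1.reverse,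
  (l.foldl (fun (s : List Bool × List β × List β) x => bif lt s.1 k
    then (add s.1 [true], x :: s.2.1, s.2.2) else (s.1, s.2.1, x :: s.2.2)) ([], [], [])).2.2.reverse)

/-- The fold runs along the list and compares a binary counter with `k`; counting up to `bval k`
itself could take exponentially many steps. The identity is shown from any counter value, with `bval
k - bval s.1` elements left to take. -/
theorem splitN_eq {β : Type} (k : List Bool) (l : List β) :
    splitN k l = (l.take (bval k), l.drop (bval k)) := by
  have key (s : List Bool × List β × List β) : 
      ((l.foldl (fun (s : List Bool × List β × List β) x => bif lt s.1 k
        then (add s.1 [true], x :: s.2.1, s.2.2) else (s.1, s.2.1, x :: s.2.2)) s).2 =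
        ((l.take (bval k - bval s.1)).reverse ++ s.2.1,
          (l.drop (bval k - bval s.1)).reverse ++ s.2.2)) := by
    induction l generalizing s with
    | nil => simp
    | cons x l ih =>
      rw [List.foldl_cons, ih]
      have h := lt_iff s.1 k
      cases hlt : lt s.1 k with
      | true =>
        obtain ⟨m, hm⟩ : ∃ m, bval k - bval s.1 = m + 1 := ⟨bval k - bval s.1 - 1, by
          have := h.1 hlt; omega⟩
        have hm' : bval k - (bval s.1 + bval [true]) = m := by simp [bval]; omega
        simp [hm, hm']
      | false =>
        have : bval k - bval s.1 = 0 := by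
          rw [hlt] at h; simp at h; omega
        simp [this]
  simp [splitN, key, bval]

@[fun_prop]
theorem polyFun_splitN {f : α → List Bool} {g : α → List β} (hf : PolyFun f) (hg : PolyFun g) :
    PolyFun fun a => splitN (f a) (g a) := by
  obtain ⟨r, hr⟩ := hg.sz_le
  have hf' := hf.comp (PolyFun.fst (α := α) (β := (List Bool × List β × List β) × β))
  have h := PolyFun.foldl_inv hg (s := fun _ => (([], [], []) : List Bool × List β × List β))
    (f := fun a s x => bif lt s.1 (f a)
      then (add s.1 [true], x :: s.2.1, s.2.2) else (s.1, s.2.1, x :: s.2.2))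
    (by fun_prop) (by fun_prop)
    -- The first increment makes the empty counter two bits long, each later one adds a bit.
    (fun a k t => t.1.length ≤ 2 * k ∧ sz t.2.1 + sz t.2.2 ≤ 2 + k * (r.eval (sz a) + 1))
    (fun a => by simp) (fun a k t b hb ⟨h₁, h₂⟩ => by
      have h₃ := length_add t.1 [true]
      have h₄ := (sz_le_of_mem hb).trans (hr a)
      obtain ⟨t₁, t₂, t₃⟩ := t
      cases lt t₁ (f a) <;> simp [Nat.add_mul] at * <;> omega)
    (8 * r + 1 + (2 + r * (r + 1)) + 2) (fun a k t hk ⟨h₁, h₂⟩ => by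
      have h₃ := sz_bits_le t.1
      have h₄ := (hk.trans (length_le_sz _)).trans (hr a)
      have h₅ := Nat.mul_le_mul_right (r.eval (sz a) + 1) h₄
      obtain ⟨t₁, t₂, t₃⟩ := t
      simp at h₁ h₂ h₃ ⊢
      omega)
  unfold splitN
  fun_prop

/-- The fraction written as a word that starts with a sign, and a denominator. -/
def toFrac (x y : List Bool) : Frac :=
  bif x.headD false then ([], x.tail, y) else (x.tail, [], y)

@[fun_prop]
theorem polyFun_toFrac {f g : α → List Bool} (hf : PolyFun f) (hg : PolyFun g) :
    PolyFun fun a => toFrac (f a) (g a) := by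
  unfold toFrac
  fun_prop

/-- The record at the beginning of a list of words. -/
def toRec (l : List (List Bool)) : Rec :=
  (l.headD [], l.tail.headD [], toFrac (l.tail.tail.headD []) (l.tail.tail.tail.headD []),
    toFrac (l.tail.tail.tail.tail.headD []) (l.tail.tail.tail.tail.tail.headD []))

@[fun_prop]
theorem polyFun_toRec {f : α → List (List Bool)} (hf : PolyFun f) :
    PolyFun fun a => toRec (f a) := by
  unfold toRec
  fun_prop

/-- Read a record. -/
def recStep (s : List (List Bool) × List Rec) : List (List Bool) × List Rec :=
  (s.1.tail.tail.tail.tail.tail.tail, toRec s.1 :: s.2)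

/-- The records in a list of words. -/
def records (l : List (List Bool)) : List Rec :=
  (l.foldl (fun s _ => recStep s) (l, [])).2.reverse

theorem sz_tail_le (l : List β) : sz l.tail ≤ sz l := by
  cases l <;> simp; omega

-- A record is read once per word, which is more often than needed, so that the list of words can
-- drive the fold; surplus records are cut off in `controllableTokens`. Each record is computed from
-- a suffix of the words and so has polynomially bounded size.
@[fun_prop]
theorem polyFun_records {f : α → List (List Bool)} (hf : PolyFun f) :
    PolyFun fun a => records (f a) := by
  obtain ⟨r, hr⟩ := hf.sz_le
  obtain ⟨q, hq⟩ := (polyFun_toRec PolyFun.id').sz_le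
  have h := PolyFun.foldl_inv hf (s := fun a => (f a, ([] : List Rec)))
    (f := fun _ s _ => recStep s) (by fun_prop) (by unfold recStep; fun_prop)
    (fun a k t => sz t.1 ≤ sz (f a) ∧ sz t.2 ≤ 1 + k * (q.eval (r.eval (sz a)) + 1))
    (fun a => by simp) (fun a k t b _ ⟨h₁, h₂⟩ => by
      refine ⟨?_, ?_⟩
      · simp only [recStep]
        exact ((((((sz_tail_le _).trans (sz_tail_le _)).trans (sz_tail_le _)).trans
          (sz_tail_le _)).trans (sz_tail_le _)).trans (sz_tail_le _)).trans h₁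
      · have h₃ := (hq t.1).trans (q.eval_nat_mono (h₁.trans (hr a)))
        simp [recStep, Nat.add_mul]
        simp only [] at h₃
        omega)
    (r + (1 + r * (q.comp r + 1)) + 1) (fun a k t hk ⟨h₁, h₂⟩ => by
      have h₄ := (hk.trans (length_le_sz _)).trans (hr a)
      have h₅ := Nat.mul_le_mul_right (q.eval (r.eval (sz a)) + 1) h₄
      have := hr a
      obtain ⟨t₁, t₂⟩ := t
      simp [Polynomial.eval_comp] at h₁ h₂ ⊢
      omega)
  unfold records
  fun_prop

/-- Decide controllability of a network written as a list of words. -/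
def controllableTokens (t : List (List Bool)) : Bool :=
  controllable (splitN (t.headD []) t.tail.tail.tail.tail).1
    (splitN (t.tail.headD []) (records (splitN (t.headD []) t.tail.tail.tail.tail).2)).1
    (splitN (t.tail.tail.tail.headD [])
      (splitN (t.tail.headD []) (records (splitN (t.headD []) t.tail.tail.tail.tail).2)).2).1

theorem polyFun_controllableTokens : PolyFun controllableTokens := by
  have h₁ : PolyFun fun t : List (List Bool) => splitN (t.headD []) t.tail.tail.tail.tail := by
    fun_prop
  have h₂ : PolyFun fun t : List (List Bool) => splitN (t.tail.headD [])
      (records (splitN (t.headD []) t.tail.tail.tail.tail).2) :=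
    polyFun_splitN (by fun_prop) (polyFun_records (PolyFun.snd.comp h₁))
  exact polyFun_controllable (PolyFun.fst.comp h₁) (PolyFun.fst.comp h₂)
    (PolyFun.fst.comp (polyFun_splitN (by fun_prop) (PolyFun.snd.comp h₂)))

theorem polyFun_controllableWord :
    PolyFun fun w : List (Bool × Bool) => controllableTokens (tokens w) :=
  polyFun_controllableTokens.comp (polyFun_tokens PolyFun.id')

end Binary

/-! ## From polynomial time functions to Turing machines -/

namespace StackMachine

open Computability TreeCode Binary
open Cmd (Run)
open scoped Cmd

/-- Push two bits on the auxiliary stack. -/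
def pushAux (s : Bool × Bool) : Cmd Op Test := .op (.push .aux s.1) ;; .op (.push .aux s.2)

/-- Move the input to the auxiliary stack. -/
def readInput : Cmd Op Test :=
  .loop (.inp Option.isSome) (.ite (.inp fun o => o == some .comma)
    (.op .popInp ;; pushAux (true, false)) (.ite (.inp fun o => o == some (.bit true))
      (.op .popInp ;; pushAux (false, true)) (.op .popInp ;; pushAux (false, false))))

/-- Move a bit from the auxiliary stack to the data stack. -/
def moveBit : Cmd Op Test :=
  .ite (topTrue .aux)
    (.op (.pop .aux) ;; .op (.push .dat false) ;; .op (.push .dat false) ;; .op (.push .dat true))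
    (.op (.pop .aux) ;; .op (.push .dat false))

/-- Turn the contents of the auxiliary stack into a list on the data stack. -/
def buildList : Cmd Op Test :=
  .loop (notEmpty .aux) (moveBit ;; moveBit ;; .op (.push .dat true) ;; .op (.push .dat true))

/-- Move the answer to the output stack. -/
def writeOutput : Cmd Op Test :=
  .ite (topTrue .dat)
    (.op (.pop .dat) ;; .op (.pop .dat) ;; .op (.pop .dat) ;; .op (.push .out true))
    (.op (.pop .dat) ;; .op (.push .out false))

theorem exec_readInput (w : List Γ') (o d x y c : List Bool) :
    Exec readInput ⟨w, o, d, x, y, c⟩ (10 * w.length + 2)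
      ⟨[], o, d, ((w.map symbol).reverse.flatMap fun s => [s.2, s.1]) ++ x, y, c⟩ := by
  induction w generalizing x with
  | nil => exact .loopF rfl (by simp)
  | cons s w ih =>
    have h := ih ((symbol s).2 :: (symbol s).1 :: x)
    have e : ((((s :: w).map symbol).reverse.flatMap fun s => [s.2, s.1]) ++ x) =
      ((w.map symbol).reverse.flatMap fun s => [s.2, s.1]) ++
        (symbol s).2 :: (symbol s).1 :: x := by simp
    rw [e]
    refine .loopT rfl (k := 8) ?_ h (by simp; omega)
    rcases s with _ | b | _ | _ | _
    · exact .iteF rfl (.iteF rfl (.seq (.op le_rfl) (.seq (.op le_rfl) (.op le_rfl) le_rfl) le_rfl)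
        le_rfl) (by omega)
    · cases b
      · exact .iteF rfl (.iteF rfl (.seq (.op le_rfl) (.seq (.op le_rfl) (.op le_rfl) le_rfl)
          le_rfl) le_rfl) (by omega)
      · exact .iteF rfl (.iteT rfl (.seq (.op le_rfl) (.seq (.op le_rfl) (.op le_rfl) le_rfl)
          le_rfl) le_rfl) (by omega)
    · exact .iteF rfl (.iteF rfl (.seq (.op le_rfl) (.seq (.op le_rfl) (.op le_rfl) le_rfl) le_rfl)
        le_rfl) (by omega)
    · exact .iteF rfl (.iteF rfl (.seq (.op le_rfl) (.seq (.op le_rfl) (.op le_rfl) le_rfl) le_rfl)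
        le_rfl) (by omega)
    · exact .iteT rfl (.seq (.op le_rfl) (.seq (.op le_rfl) (.op le_rfl) le_rfl) le_rfl)
        (by omega)

theorem exec_moveBit (b : Bool) (i : List Γ') (o d x y c : List Bool) :
    Exec moveBit ⟨i, o, d, b :: x, y, c⟩ 5 ⟨i, o, (toTree b).code ++ d, x, y, c⟩ := by
  cases b
  · exact .iteF rfl (.seq (.op le_rfl) (.op le_rfl) le_rfl) (by omega)
  · exact .iteT rfl (.seq (.op le_rfl) (.seq (.op le_rfl) (.seq (.op le_rfl) (.op le_rfl) le_rfl)
      le_rfl) le_rfl) (by omega)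

/-- A prefix code is pushed from its end: for each pair the second bit, the first bit, and two node
bits, one for the pair and one for the list cell. The list comes out reversed, which undoes the
reversal in `readInput`. -/
theorem exec_buildList (l m : List (Bool × Bool)) (i : List Γ') (o y c : List Bool) :
    Exec buildList ⟨i, o, (toTree m).code, l.flatMap fun s => [s.2, s.1], y, c⟩
      (14 * l.length + 2) ⟨i, o, (toTree (l.reverse ++ m)).code, [], y, c⟩ := by
  induction l generalizing m with
  | nil => exact .loopF rfl (by simp)
  | cons s l ih =>
    have h := ih (s :: m)
    have e : (s :: l).reverse ++ m = l.reverse ++ s :: m := by simp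
    have e' : (toTree (s :: m)).code =
        true :: true :: ((toTree s.1).code ++ ((toTree s.2).code ++ (toTree m).code)) := by
      simp [toTree, listTree, BTree.code]
    rw [e]
    rw [e'] at h
    exact .loopT rfl (.seq (exec_moveBit s.2 i o _ _ y c) (.seq (exec_moveBit s.1 i o _ _ y c)
      (.seq (.op le_rfl) (.op le_rfl) le_rfl) le_rfl) le_rfl) h (by simp; omega)

theorem exec_writeOutput (b : Bool) :
    Exec writeOutput (data [] [] ((toTree b).code ++ [])) 5 ⟨[], [b], [], [], [], []⟩ := by
  cases b
  · exact .iteF rfl (.seq (.op le_rfl) (.op le_rfl) le_rfl) (by omega)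
  · exact .iteT rfl (.seq (.op le_rfl) (.seq (.op le_rfl) (.seq (.op le_rfl) (.op le_rfl) le_rfl)
      le_rfl) le_rfl) (by omega)

/-- The word on the input stack is first turned into the tree of a list of bit pairs, in linear time
and with linear size; then the program for `f` takes over. -/
theorem _root_.PolyFun.polyTime {f : List (Bool × Bool) → Bool} (hf : PolyFun f) {α : Type}
    (enc : α → List Γ') : Nonempty (Turing.TM2ComputableInPolyTime enc encodeBool
      fun a => f ((enc a).map symbol)) := by
  obtain ⟨p, q, h⟩ := hf
  refine polyTime_of_run enc _
    -- The leaf pushed first is the empty list that `buildList` extends.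
    (.op (.push .dat false) ;; readInput ;; buildList ;; p ;; writeOutput)
    (24 * .X + 10 + q.comp (8 * .X + 1)) fun a => ?_
  have h₁ := exec_readInput (enc a) [] [false] [] [] []
  rw [List.append_nil] at h₁
  have h₂ := exec_buildList ((enc a).map symbol).reverse [] [] [] [] []
  rw [List.append_nil, List.reverse_reverse] at h₂
  have h₃ := (h ((enc a).map symbol)).2 [] [] []
  rw [List.append_nil] at h₃
  refine .seq (.op le_rfl) (.seq h₁ (.seq h₂ (.seq h₃ (exec_writeOutput _) le_rfl) le_rfl) le_rfl) ?_
  have h₄ := q.eval_nat_mono (sz_list_le ((enc a).map symbol) 7 fun s _ => by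
    have h₁ := sz_bool s.1
    have h₂ := sz_bool s.2
    obtain ⟨s₁, s₂⟩ := s
    simp at h₁ h₂ ⊢; omega)
  have h₅ : (toTree ((enc a).map symbol)).size = sz ((enc a).map symbol) := rfl
  rw [h₅]
  simp [Polynomial.eval_comp] at h₄ ⊢
  rw [show 8 * (enc a).length = (enc a).length * 8 from mul_comm _ _]
  omega

end StackMachine

/-! ## Difference constraints -/

namespace DiffConstraints

variable {V : Type}

/-- The constraints `s a ≤ w + s b`, for `(a, b, w)` in the list, hold. -/
def Sat (E : List (V × V × ℝ)) (s : V → ℝ) : Prop := ∀ e ∈ E, s e.1 ≤ e.2.2 + s e.2.1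

/-- A satisfiable list of constraints has a greatest nonpositive solution. -/
theorem exists_greatest [Finite V] {E : List (V × V × ℝ)} (h : ∃ s, Sat E s) :
    ∃ m, Sat E m ∧ m ≤ 0 ∧ ∀ s, Sat E s → s ≤ 0 → s ≤ m := by
  obtain ⟨s₀, hs₀⟩ := h
  obtain ⟨c, hc⟩ := Set.finite_range s₀ |>.bddAbove
  -- Difference constraints are invariant under translation, so a solution can be shifted below
  -- zero.
  have h₀ : Sat E (fun v => s₀ v - c) ∧ (fun v => s₀ v - c) ≤ 0 :=
    ⟨fun e he => by have := hs₀ e he; simp only; linarith,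
      fun v => sub_nonpos.2 (hc ⟨v, rfl⟩)⟩
  let A (v : V) : Set ℝ := {x | ∃ s, (Sat E s ∧ s ≤ 0) ∧ s v = x}
  have hA v : BddAbove (A v) := ⟨0, by rintro _ ⟨s, hs, rfl⟩; exact hs.2 v⟩
  have hne v : (A v).Nonempty := ⟨_, _, h₀, rfl⟩
  -- Solutions of difference constraints are closed under pointwise suprema; zero bounds the ones
  -- considered.
  refine ⟨fun v => sSup (A v), fun e he => ?_, fun v => ?_, fun s hs hs' v => ?_⟩
  · refine csSup_le (hne _) ?_
    rintro _ ⟨s, hs, rfl⟩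
    exact (hs.1 e he).trans (by gcongr; exact le_csSup (hA _) ⟨s, hs, rfl⟩)
  · refine csSup_le (hne _) ?_
    rintro _ ⟨s, hs, rfl⟩
    exact hs.2 v
  · exact le_csSup (hA _) ⟨s, ⟨hs, hs'⟩, rfl⟩

variable [DecidableEq V]

/-- If a constraint is violated, decrease the value of its first variable as required. -/
noncomputable def relax (d : V → ℝ) (e : V × V × ℝ) : V → ℝ :=
  if e.2.2 + d e.2.1 < d e.1 then Function.update d e.1 (e.2.2 + d e.2.1) else d

theorem relax_le (d : V → ℝ) (e : V × V × ℝ) : relax d e ≤ d := by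
  unfold relax
  split_ifs with h
  · exact update_le_iff.2 ⟨h.le, fun _ _ => le_rfl⟩
  · exact le_rfl

theorem relax_fst_le (d : V → ℝ) (e : V × V × ℝ) : relax d e e.1 ≤ e.2.2 + d e.2.1 := by
  unfold relax
  split_ifs with h
  · simp
  · exact not_lt.1 h

theorem le_relax {s d : V → ℝ} {e : V × V × ℝ} (hs : s e.1 ≤ e.2.2 + s e.2.1) (hd : s ≤ d) :
    s ≤ relax d e := by
  unfold relax
  split_ifs with h
  · exact le_update_iff.2 ⟨hs.trans (by gcongr; exact hd _), fun _ _ => hd _⟩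
  · exact hd

/-- Relax all constraints. -/
noncomputable def round (E : List (V × V × ℝ)) (d : V → ℝ) : V → ℝ := E.foldl relax d

theorem round_le (E : List (V × V × ℝ)) (d : V → ℝ) : round E d ≤ d := by
  induction E generalizing d with
  | nil => exact le_rfl
  | cons e E ih => exact (ih _).trans (relax_le d e)

theorem le_round {E : List (V × V × ℝ)} {s d : V → ℝ} (hs : Sat E s) (hd : s ≤ d) :
    s ≤ round E d := by
  induction E generalizing d with
  | nil => exact hd
  | cons e E ih =>
    exact ih (fun e he => hs e (by simp [he])) (le_relax (hs e (by simp)) hd)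

/-- Values only decrease during a round. So when `e` is relaxed, its right-hand side is at most the
initial one, and later relaxations cannot undo the effect: updating in place is no worse than
updating simultaneously. -/
theorem round_fst_le {E : List (V × V × ℝ)} (d : V → ℝ) {e : V × V × ℝ} (he : e ∈ E) :
    round E d e.1 ≤ e.2.2 + d e.2.1 := by
  induction E generalizing d with
  | nil => simp at he
  | cons e' E ih =>
    rcases List.mem_cons.1 he with rfl | he
    · exact (round_le E _ _).trans (relax_fst_le d e)
    · exact (ih (relax d e') he).trans (by gcongr; exact relax_le d e' _)

variable [Fintype V]

/-- Unless all values have reached those of the greatest nonpositive solution, another one does so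
in the next round. -/
theorem exists_reached {E : List (V × V × ℝ)} {m d : V → ℝ} (hm : Sat E m)
    (hm' : ∀ s, Sat E s → s ≤ 0 → s ≤ m) (hd : m ≤ d) (hd₀ : d ≤ 0) (hne : d ≠ m) :
    ∃ v, d v ≠ m v ∧ round E d v = m v := by
  classical
  by_contra! hcon
  have hr := le_round hm hd
  have hpos v (hv : d v ≠ m v) : 0 < round E d v - m v :=
    sub_pos.2 (lt_of_le_of_ne (hr v) (hcon v hv).symm)
  obtain ⟨v₀, hv₀⟩ := Function.ne_iff.1 hne
  -- Among the variables not yet reached, take one whose gap `ε` to `m` after the round is least. If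
  -- no such variable is reached in the round, then `ε` is positive.
  obtain ⟨v₁, hv₁, hmin⟩ := (Finset.univ.filter fun v => d v ≠ m v).exists_min_image
    (fun v => round E d v - m v) ⟨v₀, by simpa using hv₀⟩
  simp only [Finset.mem_filter, Finset.mem_univ, true_and] at hv₁ hmin
  set ε := round E d v₁ - m v₁
  have hε : 0 < ε := hpos v₁ hv₁
  -- Raising `m` by `ε` on all unreached variables gives a larger nonpositive solution, contrary to
  -- maximality.
  let m' : V → ℝ := fun v => if d v = m v then m v else m v + ε
  have h₁ : Sat E m' := by
    intro e he
    have h := hm e he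
    simp only [m']
    split_ifs with ha hb hb
    · exact h
    · linarith
    -- The critical case, in which only the left side is raised: the right side has its final value
    -- already in `d`, so the round has pushed `e.1` to at most that bound, and the gap at `e.1` is
    -- at least `ε`.
    · have := hmin e.1 ha
      have := round_fst_le d he
      linarith
    · linarith
  have h₂ : m' ≤ 0 := by
    intro v
    simp only [m']
    split_ifs with hv
    · exact (hd v).trans (hd₀ v)
    · have := hmin v hv
      have := round_le E d v
      have := hd₀ v
      linarith
  have := hm' m' h₁ h₂ v₁
  simp only [m', if_neg hv₁] at this
  linarith

/-- The Bellman-Ford algorithm decides satisfiability. -/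
theorem exists_sat_iff (E : List (V × V × ℝ)) :
    (∃ s, Sat E s) ↔ Sat E ((round E)^[Fintype.card V] 0) := by
  classical
  refine ⟨fun h => ?_, fun h => ⟨_, h⟩⟩
  obtain ⟨m, hm, hm₀, hm'⟩ := exists_greatest h
  -- After `k` rounds at least `k` variables have their final values, and reached values never
  -- change again.
  have key (k : ℕ) : m ≤ (round E)^[k] 0 ∧ (round E)^[k] 0 ≤ 0 ∧ (k ≤ Fintype.card V →
      k ≤ (Finset.univ.filter fun v => (round E)^[k] 0 v = m v).card) := by
    induction k with
    | zero => exact ⟨hm₀, le_rfl, by simp⟩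
    | succ k ih =>
      obtain ⟨h₁, h₂, h₃⟩ := ih
      rw [Function.iterate_succ_apply']
      set d := (round E)^[k] 0
      have hle := round_le E d
      have hge := le_round hm h₁
      refine ⟨hge, hle.trans h₂, fun hk => ?_⟩
      have hsub : (Finset.univ.filter fun v => d v = m v) ⊆
          Finset.univ.filter fun v => round E d v = m v := by
        intro v
        simp only [Finset.mem_filter, Finset.mem_univ, true_and]
        exact fun hv => le_antisymm (hv ▸ hle v) (hge v)
      by_cases hdm : d = m
      · refine hk.trans (Finset.card_le_card (s := Finset.univ) fun v _ => hsub ?_)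
        simp [hdm]
      · obtain ⟨v, hv, hv'⟩ := exists_reached hm hm' h₁ h₂ hdm
        refine Nat.succ_le_of_lt ((h₃ (by omega)).trans_lt (Finset.card_lt_card ?_))
        exact Finset.ssubset_iff_subset_ne.2 ⟨hsub, fun h => hv (by
          have : v ∈ Finset.univ.filter fun v => round E d v = m v := by simpa using hv'
          rw [← h] at this
          simpa using this)⟩
  obtain ⟨_, _, h⟩ := key (Fintype.card V)
  have huniv := Finset.eq_univ_of_card _ (le_antisymm (Finset.card_le_univ _) (h le_rfl))
  have : (round E)^[Fintype.card V] 0 = m := by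
    funext v
    have : v ∈ Finset.univ.filter fun v => (round E)^[Fintype.card V] 0 v = m v := by
      rw [huniv]; simp
    simpa using this
  rwa [this]

end DiffConstraints

/-! ## Strong controllability as a system of difference constraints -/

open DiffConstraints

section Reduction

variable {e c : ℕ}

/-- The executable timepoint on which a timepoint depends. -/
def Timepoint.base {𝕜 : Type} [Zero 𝕜] [LE 𝕜] (links : Fin c → ContingentLink 𝕜 e) :
    Timepoint e c → Fin e
  | Sum.inl i => i
  | Sum.inr j => (links j).start

/-- The least distance of a timepoint to the executable timepoint on which it depends. -/
def Timepoint.minDelay {𝕜 : Type} [Zero 𝕜] [LE 𝕜] (links : Fin c → ContingentLink 𝕜 e) :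
    Timepoint e c → 𝕜
  | Sum.inl _ => 0
  | Sum.inr j => (links j).lo

/-- The greatest distance of a timepoint to the executable timepoint on which it depends. -/
def Timepoint.maxDelay {𝕜 : Type} [Zero 𝕜] [LE 𝕜] (links : Fin c → ContingentLink 𝕜 e) :
    Timepoint e c → 𝕜
  | Sum.inl _ => 0
  | Sum.inr j => (links j).hi

/-- The constraints on the executable timepoints that express a requirement. -/
noncomputable def Requirement.edges (links : Fin c → ContingentLink ℝ e) (r : Requirement ℝ e c) :
    List (Fin e × Fin e × ℝ) :=
  if r.x = r.y then
    [(r.x.base links, r.x.base links, r.hi), (r.x.base links, r.x.base links, -r.lo)]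
  else [(r.x.base links, r.y.base links, r.hi + -r.x.maxDelay links + r.y.minDelay links),
    (r.y.base links, r.x.base links, -r.lo + r.x.minDelay links + -r.y.maxDelay links)]

theorem RespectsLinks.delay {links : Fin c → ContingentLink ℝ e} {s : Fin e → ℝ} {t : Fin c → ℝ}
    (h : RespectsLinks links s t) (x : Timepoint e c) :
    s (x.base links) + x.minDelay links ≤ Sum.elim s t x ∧
      Sum.elim s t x ≤ s (x.base links) + x.maxDelay links := by
  rcases x with i | j
  · simp [Timepoint.base, Timepoint.minDelay, Timepoint.maxDelay]
  · have := h j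
    simp only [Timepoint.base, Timepoint.minDelay, Timepoint.maxDelay, Sum.elim_inr]
    constructor <;> linarith

/-- Two different timepoints can take place as late and as early as possible, respectively. -/
theorem exists_extreme {links : Fin c → ContingentLink ℝ e}
    (hl : ∀ j, (links j).lo ≤ (links j).hi) (s : Fin e → ℝ) {x y : Timepoint e c} (hxy : x ≠ y) :
    ∃ t, RespectsLinks links s t ∧ Sum.elim s t x = s (x.base links) + x.maxDelay links ∧
      Sum.elim s t y = s (y.base links) + y.minDelay links := by
  classical
  -- `x` takes its greatest delay and all other contingent timepoints their least one, which is
  -- possible for `y` too as it differs from `x`.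
  refine ⟨fun j => s (links j).start + if Sum.inr j = x then (links j).hi else (links j).lo,
    fun j => ?_, ?_, ?_⟩
  · have := hl j
    dsimp only
    split_ifs <;> constructor <;> linarith
  · rcases x with i | j <;> simp [Timepoint.base, Timepoint.maxDelay]
  · rcases y with i | j
    · simp [Timepoint.base, Timepoint.minDelay]
    · simp [Timepoint.base, Timepoint.minDelay, hxy.symm]

/-- The extreme values of `x - y` are attained with one timepoint as late and the other as early as
possible. Delays are independent even if the timepoints have the same start; only for `x = y` do
they cancel. -/
theorem Requirement.sat_edges_iff {links : Fin c → ContingentLink ℝ e}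
    (hl : ∀ j, (links j).lo ≤ (links j).hi) (r : Requirement ℝ e c) (s : Fin e → ℝ) :
    Sat (r.edges links) s ↔ ∀ t, RespectsLinks links s t → r.Holds s t := by
  by_cases hxy : r.x = r.y
  -- A requirement says something only if nature has an admissible choice; nonempty ranges provide
  -- one.
  · have : ∃ t, RespectsLinks links s t :=
      ⟨fun j => s (links j).start + (links j).lo, fun j => by simpa using hl j⟩
    simp only [Sat, Requirement.edges, if_pos hxy, Requirement.Holds,
      List.forall_mem_cons, List.not_mem_nil, false_imp_iff, implies_true, and_true]
    constructor
    · intro h t _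
      rw [hxy, sub_self]
      constructor <;> linarith
    · intro h
      obtain ⟨t, ht⟩ := this
      have := h t ht
      rw [hxy, sub_self] at this
      constructor <;> linarith
  · simp only [Sat, Requirement.edges, if_neg hxy, Requirement.Holds,
      List.forall_mem_cons, List.not_mem_nil, false_imp_iff, implies_true, and_true]
    constructor
    · intro h t ht
      have h₁ := ht.delay r.x
      have h₂ := ht.delay r.y
      constructor <;> linarith
    · intro h
      obtain ⟨t, ht, h₁, h₂⟩ := exists_extreme hl s hxy
      obtain ⟨t', ht', h₁', h₂'⟩ := exists_extreme hl s (Ne.symm hxy)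
      have h₃ := h t ht
      have h₄ := h t' ht'
      constructor <;> linarith

end Reduction

/-! ### Elimination of labels and the criterion for strong controllability -/

/-- Make exactly the propositions true that occur unnegated; by consistency none of them occurs
negated. -/
theorem Label.exists_holds {p : ℕ} (ψ : Label p) : ∃ π, ψ.Holds π := by
  classical
  refine ⟨fun i => decide ((i, true) ∈ ψ.lits), ?_⟩
  rintro ⟨i, b⟩ h
  cases b
  · simpa using fun h' => ψ.consistent i ⟨h', h⟩
  · simpa using h

namespace CSTNU

/-- The schedule and the contingent times are chosen before the valuation, so the latter may be
adapted to each constraint separately; the labels need not be jointly satisfiable. -/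
theorem stronglyControllable_iff_dropLabels (N : CSTNU ℝ) :
    N.StronglyControllable ↔ N.dropLabels.StronglyControllable := by
  constructor
  · rintro ⟨s, hs⟩
    refine ⟨s, fun t ht r hr => ?_⟩
    obtain ⟨a, ha, rfl⟩ := List.mem_map.1 hr
    obtain ⟨π, hπ⟩ := a.1.exists_holds
    exact hs t ht π a ha hπ
  · rintro ⟨s, hs⟩
    exact ⟨s, fun t ht π r hr _ => hs t ht r.2 (List.mem_map.2 ⟨r, hr, rfl⟩)⟩

/-- The constraints on the executable timepoints that express all requirements. -/
noncomputable def edges (N : CSTNU ℝ) : List (Fin N.numExec × Fin N.numExec × ℝ) :=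
  N.reqs.flatMap fun r => r.2.edges N.links

/-- With an empty contingent range there are no admissible contingent times and every schedule
works. Otherwise `Requirement.sat_edges_iff` applies to each requirement, for the same schedule. -/
theorem stronglyControllable_iff (N : CSTNU ℝ) : N.StronglyControllable ↔
    (∃ j, (N.links j).hi < (N.links j).lo) ∨ ∃ s, Sat N.edges s := by
  rw [stronglyControllable_iff_dropLabels]
  by_cases hl : ∃ j, (N.links j).hi < (N.links j).lo
  · refine iff_of_true ⟨fun _ => 0, fun t ht => ?_⟩ (Or.inl hl)
    obtain ⟨j, hj⟩ := hl
    have : (N.links j).lo ≤ _ ∧ _ ≤ (N.links j).hi := ht j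
    exact absurd (this.1.trans this.2) (not_le.2 hj)
  · rw [or_iff_right hl]
    push Not at hl
    refine exists_congr fun s => ?_
    have h (r) := Requirement.sat_edges_iff hl r s
    constructor
    · intro hs e he
      obtain ⟨r, hr, he⟩ := List.mem_flatMap.1 he
      exact (h r.2).2 (fun t ht => hs t ht r.2 (List.mem_map.2 ⟨r, hr, rfl⟩)) e he
    · intro hs t ht r hr
      obtain ⟨a, ha, rfl⟩ := List.mem_map.1 hr
      exact (h a.2).1 (fun e he => hs e (List.mem_flatMap.2 ⟨a, ha, he⟩)) t ht

theorem stronglyControllable_iff_round (N : CSTNU ℝ) : N.StronglyControllable ↔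
    (∃ j, (N.links j).hi < (N.links j).lo) ∨ Sat N.edges ((round N.edges)^[N.numExec] 0) := by
  rw [stronglyControllable_iff, exists_sat_iff, Fintype.card_fin]

end CSTNU

/-! ## Correctness of the decision procedure on words -/

open Computability

theorem Timepoint.idx_injective {e c : ℕ} : Function.Injective (Timepoint.idx (e := e) (c := c)) := by
  rintro (i | i) (j | j) h <;> simp only [Timepoint.idx] at h
  · rw [Fin.ext h]
  · omega
  · omega
  · rw [Fin.ext (Nat.add_left_cancel h)]

namespace Binary

/-- The words for an entry of a record of a network. -/
def entryTokens : ℕ ⊕ ℚ → List (List Bool)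
  | Sum.inl n => [encodeNat n]
  | Sum.inr q => [decide (q < 0) :: encodeNat q.num.natAbs, encodeNat q.den]

theorem tokens_append (x : List Bool) (w : List Γ') :
    tokens ((x.map Γ'.bit ++ [Γ'.comma] ++ w).map symbol) = x :: tokens (w.map symbol) := by
  induction x with
  | nil => rfl
  | cons b x ih =>
    simp only [List.map_cons, List.cons_append, tokens, List.foldr_cons] at ih ⊢
    rw [ih]
    rfl

/-- The sign bit of a rational number is not followed by a comma and so becomes the first bit of the
numerator's word: a rational number gives two words, a natural number one. -/
theorem tokens_entries (l : List (ℕ ⊕ ℚ)) :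
    tokens ((l.flatMap (Sum.elim encodeNatWord encodeRatWord)).map symbol) =
      l.flatMap entryTokens := by
  induction l with
  | nil => rfl
  | cons a l ih =>
    rcases a with n | q
    · have h := tokens_append (encodeNat n) (l.flatMap (Sum.elim encodeNatWord encodeRatWord))
      rw [ih] at h
      exact h
    · have h₁ := tokens_append (encodeNat q.den) (l.flatMap (Sum.elim encodeNatWord encodeRatWord))
      have h₂ := tokens_append (decide (q < 0) :: encodeNat q.num.natAbs)
        ((encodeNat q.den).map Γ'.bit ++ [Γ'.comma] ++
          l.flatMap (Sum.elim encodeNatWord encodeRatWord))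
      rw [h₁, ih] at h₂
      rw [List.flatMap_cons, List.flatMap_cons]
      convert h₂ using 3
      · simp [encodeRatWord, encodeNatWord, encodingNatΓ', inclusionBoolΓ']
      · rfl

@[simp] theorem bval_encodeNat (n : ℕ) : bval (encodeNat n) = n := by
  have h (p : PosNum) : bval (encodePosNum p) = (p : ℕ) := by
    induction p with
    | one => rfl
    | bit0 p ih => simp [encodePosNum, bval, ih]; omega
    | bit1 p ih => simp [encodePosNum, bval, ih]; omega
  have h' (p : Num) : bval (encodeNum p) = (p : ℕ) := by
    cases p with
    | zero => rfl
    | pos p => exact h p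
  simp [encodeNat, h']

/-- The fraction for a rational number. -/
def ratFrac (q : ℚ) : Frac := toFrac (decide (q < 0) :: encodeNat q.num.natAbs) (encodeNat q.den)

theorem ratFrac_is (q : ℚ) : (ratFrac q).Is q := by
  have hq : (q : ℝ) = (q.num : ℝ) / q.den := by exact_mod_cast (Rat.num_div_den q).symm
  rw [hq]
  by_cases h : q < 0
  · refine ⟨by simp [ratFrac, toFrac, h], ?_⟩
    have hn : (q.num.natAbs : ℤ) = -q.num := Int.ofNat_natAbs_of_nonpos (Rat.num_neg.2 h).le
    have hn' : (q.num.natAbs : ℝ) = -(q.num : ℝ) := by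
      rw [← Int.cast_natCast, hn, Int.cast_neg]
    simp [ratFrac, toFrac, h, fval, bval, hn']
  · refine ⟨by simp [ratFrac, toFrac, h], ?_⟩
    have hn : (q.num.natAbs : ℤ) = q.num := Int.natAbs_of_nonneg (Rat.num_nonneg.2 (not_lt.1 h))
    have hn' : (q.num.natAbs : ℝ) = (q.num : ℝ) := by
      rw [← Int.cast_natCast, hn]
    simp [ratFrac, toFrac, h, fval, bval, hn']

/-- The words for a constraint. -/
def constraintTokens (r : ℕ × ℕ × ℚ × ℚ) : List (List Bool) :=
  (constraintRecord r.1 r.2.1 r.2.2.1 r.2.2.2).flatMap entryTokens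

/-- The record for a constraint. -/
def constraintRec (r : ℕ × ℕ × ℚ × ℚ) : Rec :=
  (encodeNat r.1, encodeNat r.2.1, ratFrac r.2.2.1, ratFrac r.2.2.2)

/-- A constraint occupies six words, two for the timepoints and two for each bound, and one step of
`recStep` consumes them. There are at least as many steps as constraints; what the remaining ones
produce from `junk` is the tail `m`. -/
theorem records_flatMap (l : List (ℕ × ℕ × ℚ × ℚ)) (junk : List (List Bool)) :
    ∃ m, records (l.flatMap constraintTokens ++ junk) = l.map constraintRec ++ m := by
  have h₁ (l : List (ℕ × ℕ × ℚ × ℚ)) (a : List Rec) :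
      recStep^[l.length] (l.flatMap constraintTokens ++ junk, a) =
        (junk, (l.map constraintRec).reverse ++ a) := by
    induction l generalizing a with
    | nil => rfl
    | cons r l ih =>
      have : recStep ((r :: l).flatMap constraintTokens ++ junk, a) =
        (l.flatMap constraintTokens ++ junk, constraintRec r :: a) := rfl
      rw [List.length_cons, Function.iterate_succ_apply, this, ih]
      simp
  have h₂ (k : ℕ) (s : List (List Bool)) (a : List Rec) :
      ∃ m, (recStep^[k] (s, a)).2 = m ++ a := by
    induction k generalizing s a with
    | zero => exact ⟨[], rfl⟩
    | succ k ih =>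
      obtain ⟨m, hm⟩ := ih (s.tail.tail.tail.tail.tail.tail) (toRec s :: a)
      refine ⟨m ++ [toRec s], ?_⟩
      rw [Function.iterate_succ_apply]
      simpa [recStep] using hm
  have h₃ (t : List (List Bool)) (s : List (List Bool) × List Rec) :
      t.foldl (fun s _ => recStep s) s = recStep^[t.length] s := by
    induction t generalizing s with
    | nil => rfl
    | cons a t ih => simp [ih]
  have hlen : l.length ≤ (l.flatMap constraintTokens ++ junk).length := by
    induction l with
    | nil => simp
    | cons r l ih => simp [constraintTokens, constraintRecord, entryTokens] at ih ⊢; omega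
  obtain ⟨k, hk⟩ := Nat.exists_eq_add_of_le' hlen
  obtain ⟨m, hm⟩ := h₂ k junk (l.map constraintRec).reverse
  refine ⟨m.reverse, ?_⟩
  rw [records, h₃, hk, Function.iterate_add_apply, h₁, List.append_nil, hm]
  simp

/-- The word edge `e` stands for the edge `e'`. -/
def EdgeIs {n : ℕ} (e : List Bool × List Bool × Frac) (e' : Fin n × Fin n × ℝ) : Prop :=
  bval e.1 = e'.1 ∧ bval e.2.1 = e'.2.1 ∧ e.2.2.Is e'.2.2

/-- The association list `d` represents the function `D`. -/
def Represents {n : ℕ} (d : List (List Bool × Frac)) (D : Fin n → ℝ) : Prop :=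
  ∀ (k : List Bool) (v : Fin n), bval k = v → (lookup d k).Is (D v)

/-- A new entry at the head shadows older ones for the same key, as in `Function.update`. Keys are
compared by value. -/
theorem Represents.relax {n : ℕ} {d : List (List Bool × Frac)} {D : Fin n → ℝ}
    (h : Represents d D) {e : List Bool × List Bool × Frac} {e' : Fin n × Fin n × ℝ}
    (he : EdgeIs e e') : Represents (relax d e) (DiffConstraints.relax D e') := by
  have h₁ := he.2.2.add (h _ _ he.2.1)
  have h₂ := h₁.lt_iff (h _ _ he.1)
  unfold Binary.relax DiffConstraints.relax
  cases hlt : flt (fadd e.2.2 (lookup d e.2.1)) (lookup d e.1) with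
  | false =>
    rw [hlt] at h₂
    rw [if_neg (by simpa using h₂)]
    exact h
  | true =>
    rw [if_pos (h₂.1 hlt)]
    intro k v hk
    have h₃ : lookup ((e.1, fadd e.2.2 (lookup d e.2.1)) :: d) k =
      bif keq e.1 k then fadd e.2.2 (lookup d e.2.1) else lookup d k := rfl
    rw [cond_true, h₃]
    have h₄ := keq_iff e.1 k
    rw [he.1, hk] at h₄
    cases hk' : keq e.1 k with
    | true =>
      obtain rfl : e'.1 = v := Fin.ext (h₄.1 hk')
      simpa using h₁
    | false =>
      rw [hk'] at h₄
      rw [Function.update_of_ne (by rintro rfl; simp at h₄)]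
      exact h k v hk

theorem Represents.foldl {n : ℕ} {d : List (List Bool × Frac)} {D : Fin n → ℝ}
    (h : Represents d D) {es : List (List Bool × List Bool × Frac)} {E : List (Fin n × Fin n × ℝ)}
    (he : List.Forall₂ EdgeIs es E) : Represents (es.foldl Binary.relax d)
      (DiffConstraints.round E D) := by
  induction he generalizing d D with
  | nil => exact h
  | cons h₁ _ ih => exact ih (h.relax h₁)

theorem Represents.rounds {n : ℕ} {d : List (List Bool × Frac)} {D : Fin n → ℝ}
    (h : Represents d D) {es : List (List Bool × List Bool × Frac)} {E : List (Fin n × Fin n × ℝ)}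
    (he : List.Forall₂ EdgeIs es E) (exs : List (List Bool)) :
    Represents ((exs.flatMap fun _ => es).foldl Binary.relax d)
      ((DiffConstraints.round E)^[exs.length] D) := by
  induction exs generalizing d D with
  | nil => exact h
  | cons _ exs ih =>
    rw [List.flatMap_cons, List.foldl_append]
    exact ih (h.foldl he)

theorem solvable_iff {n : ℕ} {es : List (List Bool × List Bool × Frac)}
    {E : List (Fin n × Fin n × ℝ)} (he : List.Forall₂ EdgeIs es E) (exs : List (List Bool)) :
    solvable exs es = true ↔
      DiffConstraints.Sat E ((DiffConstraints.round E)^[exs.length] 0) := by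
  have h := Represents.rounds (d := []) (D := (0 : Fin n → ℝ)) (fun _ _ _ => Frac.Is.zero) he exs
  unfold solvable
  generalize (exs.flatMap fun _ => es).foldl relax [] = d at h
  generalize (DiffConstraints.round E)^[exs.length] 0 = D at h
  induction he with
  | nil => simp [DiffConstraints.Sat]
  | @cons e e' _ _ h₁ _ ih =>
    have h₂ := (h₁.2.2.add (h _ _ h₁.2.1)).lt_iff (h _ _ h₁.1)
    simp only [List.all_cons, Bool.and_eq_true, DiffConstraints.Sat, List.forall_mem_cons]
    refine and_congr ?_ ih
    rw [← not_lt, ← h₂]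
    simp

variable {e c : ℕ}

/-- The numbers and bounds of the contingent constraint of `j`. -/
def linkRow (links : Fin c → ContingentLink ℚ e) (j : Fin c) : ℕ × ℕ × ℚ × ℚ :=
  (e + j, (links j).start, (links j).lo, (links j).hi)

/-- The numbers and bounds of a requirement constraint. -/
def reqRow (r : Requirement ℚ e c) : ℕ × ℕ × ℚ × ℚ := (r.x.idx, r.y.idx, r.lo, r.hi)

theorem resolve_spec (links : Fin c → ContingentLink ℚ e) (x : Timepoint e c) :
    bval (resolve ((List.finRange c).map fun j => constraintRec (linkRow links j))
        (encodeNat x.idx)).1 = x.base links ∧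
      (resolve ((List.finRange c).map fun j => constraintRec (linkRow links j))
        (encodeNat x.idx)).2.1.Is (x.minDelay links : ℚ) ∧
      (resolve ((List.finRange c).map fun j => constraintRec (linkRow links j))
        (encodeNat x.idx)).2.2.Is (x.maxDelay links : ℚ) := by
  -- For the induction it suffices that the list contains the link of `x` if `x` is contingent. An
  -- executable timepoint matches no entry, numbers being injective, and gets the default with zero
  -- delays.
  have key (l : List (Fin c)) (hl : ∀ j, x = Sum.inr j → j ∈ l) :
      bval (resolve (l.map fun j => constraintRec (linkRow links j))
        (encodeNat x.idx)).1 = x.base links ∧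
      (resolve (l.map fun j => constraintRec (linkRow links j))
        (encodeNat x.idx)).2.1.Is (x.minDelay links : ℚ) ∧
      (resolve (l.map fun j => constraintRec (linkRow links j))
        (encodeNat x.idx)).2.2.Is (x.maxDelay links : ℚ) := by
    induction l with
    | nil =>
      rcases x with i | j
      · refine ⟨by simp [resolve, Timepoint.idx, Timepoint.base], ?_, ?_⟩
        · simpa [resolve, Timepoint.minDelay] using Frac.Is.zero
        · simpa [resolve, Timepoint.maxDelay] using Frac.Is.zero
      · exact absurd (hl j rfl) (by simp)
    | cons j l ih =>
      have h : resolve ((j :: l).map fun j => constraintRec (linkRow links j)) (encodeNat x.idx) =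
        bif keq (encodeNat (e + j)) (encodeNat x.idx) then (constraintRec (linkRow links j)).2
        else resolve (l.map fun j => constraintRec (linkRow links j)) (encodeNat x.idx) := rfl
      rw [h]
      have h₁ : keq (encodeNat (e + j)) (encodeNat x.idx) = true ↔ x = Sum.inr j := by
        rw [keq_iff, bval_encodeNat, bval_encodeNat]
        exact ⟨fun h => (Timepoint.idx_injective (a₁ := Sum.inr j) h).symm, fun h => by rw [h]; rfl⟩
      cases hk : keq (encodeNat (e + j)) (encodeNat x.idx) with
      | true =>
        obtain rfl := h₁.1 hk
        exact ⟨by simp [constraintRec, linkRow, Timepoint.base], ratFrac_is _, ratFrac_is _⟩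
      | false =>
        rw [hk] at h₁
        refine ih fun j' hj' => ?_
        rcases List.mem_cons.1 (hl j' hj') with rfl | hj
        · simp [hj'] at h₁
        · exact hj
  exact key _ fun j _ => List.mem_finRange j

end Binary

/-! ### Agreement of the rational and the real constraint systems -/

section CastReal

open Computability Binary

variable {e c : ℕ}

/-- Contingent constraints with rational bounds, seen as ones with real bounds. -/
noncomputable def realLinks (links : Fin c → ContingentLink ℚ e) : Fin c → ContingentLink ℝ e :=
  fun j =>
    { start := (links j).start
      lo := ((links j).lo : ℝ)
      hi := ((links j).hi : ℝ)
      lo_nonneg := Rat.cast_nonneg.mpr (links j).lo_nonneg }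

/-- A requirement with rational bounds, seen as one with real bounds. -/
noncomputable def Requirement.toReal (r : Requirement ℚ e c) : Requirement ℝ e c :=
  ⟨r.x, r.y, (r.lo : ℝ), (r.hi : ℝ)⟩

variable (links : Fin c → ContingentLink ℚ e)

theorem Timepoint.base_realLinks (x : Timepoint e c) : x.base (realLinks links) = x.base links := by
  cases x <;> rfl

theorem Timepoint.minDelay_realLinks (x : Timepoint e c) :
    x.minDelay (realLinks links) = (x.minDelay links : ℚ) := by
  cases x
  · exact Rat.cast_zero.symm
  · rfl

theorem Timepoint.maxDelay_realLinks (x : Timepoint e c) :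
    x.maxDelay (realLinks links) = (x.maxDelay links : ℚ) := by
  cases x
  · exact Rat.cast_zero.symm
  · rfl

/-- The records of the contingent constraints. -/
def linkRecs : List Rec := (List.finRange c).map fun j => constraintRec (linkRow links j)

/-- Both edge lists are built by the same case distinction and the same order of additions, so they
correspond entry by entry. -/
theorem forall₂_recEdges (r : Requirement ℚ e c) :
    List.Forall₂ EdgeIs (recEdges (linkRecs links) (constraintRec (reqRow r)))
      (r.toReal.edges (realLinks links)) := by
  obtain ⟨hx₁, hx₂, hx₃⟩ := resolve_spec links r.x
  obtain ⟨hy₁, hy₂, hy₃⟩ := resolve_spec links r.y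
  rw [← Timepoint.base_realLinks] at hx₁ hy₁
  rw [← Timepoint.minDelay_realLinks] at hx₂ hy₂
  rw [← Timepoint.maxDelay_realLinks] at hx₃ hy₃
  have hlo : (ratFrac r.lo).Is r.lo := ratFrac_is _
  have hhi : (ratFrac r.hi).Is r.hi := ratFrac_is _
  have hk : keq (encodeNat r.x.idx) (encodeNat r.y.idx) = true ↔ r.x = r.y := by
    simp [Timepoint.idx_injective.eq_iff]
  unfold recEdges Requirement.edges
  simp only [constraintRec, reqRow]
  cases h : keq (encodeNat r.x.idx) (encodeNat r.y.idx) with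
  | true =>
    rw [h] at hk
    rw [if_pos (show r.toReal.x = r.toReal.y from hk.1 rfl)]
    exact .cons ⟨hx₁, hx₁, hhi⟩ (.cons ⟨hx₁, hx₁, hlo.neg⟩ .nil)
  | false =>
    rw [h] at hk
    rw [if_neg (show r.toReal.x ≠ r.toReal.y from fun h => absurd (hk.2 h) (by simp))]
    exact .cons ⟨hx₁, hy₁, (hhi.add hx₃.neg).add hy₂⟩
      (.cons ⟨hy₁, hx₁, (hlo.neg.add hx₂).add hy₃.neg⟩ .nil)

theorem forall₂_flatMap_recEdges {p : ℕ} (reqs : List (Label p × Requirement ℚ e c)) :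
    List.Forall₂ EdgeIs
      ((reqs.map fun r => constraintRec (reqRow r.2)).flatMap (recEdges (linkRecs links)))
      ((reqs.map fun r => (r.1, r.2.toReal)).flatMap fun r => r.2.edges (realLinks links)) := by
  induction reqs with
  | nil => exact .nil
  | cons r l ih => exact List.rel_append (forall₂_recEdges links r.2) ih

end CastReal

/-! ### Membership in P -/

namespace CSTNU

open Computability Binary

variable (N : CSTNU ℚ)

theorem controllable_iff (exs : List (List Bool)) (hexs : exs.length = N.numExec) :
    controllable exs (linkRecs N.links) (N.reqs.map fun r => constraintRec (reqRow r.2)) = true ↔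
      N.toReal.StronglyControllable := by
  rw [stronglyControllable_iff_round, controllable, Bool.or_eq_true]
  refine or_congr ?_ ?_
  · have h (j : Fin N.numCtg) : flt (ratFrac (N.links j).hi) (ratFrac (N.links j).lo) = true ↔
        (N.toReal.links j).hi < (N.toReal.links j).lo :=
      (ratFrac_is (N.links j).hi).lt_iff (ratFrac_is (N.links j).lo)
    have h' : (∃ j, (N.toReal.links j).hi < (N.toReal.links j).lo) ↔
        ∃ j, flt (ratFrac (N.links j).hi) (ratFrac (N.links j).lo) = true :=
      exists_congr fun j => (h j).symm
    rw [h']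
    simp [linkRecs, constraintRec, linkRow]
  · have h := solvable_iff (forall₂_flatMap_recEdges N.links N.reqs) exs
    rw [hexs] at h
    exact h

/-- The labels and the observation timepoints come last in the record and form the part `junk` that
the decision procedure ignores. -/
theorem record_tokens : ∃ junk : List (List Bool), N.record.flatMap entryTokens =
    encodeNat N.numExec :: encodeNat N.numCtg :: encodeNat N.numProp :: encodeNat N.reqs.length ::
      ((List.range N.numExec).map encodeNat ++
      (((List.finRange N.numCtg).map (linkRow N.links) ++
        N.reqs.map (fun r : Label N.numProp × Requirement ℚ N.numExec N.numCtg => reqRow r.2)).flatMap constraintTokens ++ junk)) := by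
  refine ⟨((N.reqs.flatMap (fun r : Label N.numProp × Requirement ℚ N.numExec N.numCtg =>
    r.1.record ℚ)) ++ (List.finRange N.numProp).map
      (fun i => (Sum.inl (N.obs i).idx : ℕ ⊕ ℚ))).flatMap entryTokens, ?_⟩
  have h₁ : ((List.range N.numExec).map (Sum.inl : ℕ → ℕ ⊕ ℚ)).flatMap entryTokens =
      (List.range N.numExec).map encodeNat := by
    rw [List.flatMap_map]
    exact List.map_eq_flatMap.symm
  simp only [record, List.flatMap_append, h₁, List.flatMap_assoc, List.flatMap_map,
    List.append_assoc, List.flatMap_cons, List.flatMap_nil]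
  rfl

theorem controllableTokens_iff : controllableTokens (tokens (N.encode.map symbol)) = true ↔
    N.toReal.StronglyControllable := by
  obtain ⟨junk, h⟩ := N.record_tokens
  have ht : tokens (N.encode.map symbol) = N.record.flatMap entryTokens := tokens_entries _
  obtain ⟨m, hm⟩ := records_flatMap ((List.finRange N.numCtg).map (linkRow N.links) ++
    N.reqs.map fun r : Label N.numProp × Requirement ℚ N.numExec N.numCtg => reqRow r.2) junk
  rw [ht, h]
  simp only [controllableTokens, List.headD_cons, List.tail_cons, splitN_eq, bval_encodeNat]
  rw [List.drop_left' (by simp), List.take_left' (by simp), hm, List.map_append, List.append_assoc,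
    List.take_left' (by simp), List.drop_left' (by simp), List.take_left' (by simp)]
  rw [← N.controllable_iff ((List.range N.numExec).map encodeNat) (by simp)]
  simp [linkRecs, Function.comp_def]

theorem inP_stronglyControllable :
    InP CSTNU.encode fun N : CSTNU ℚ => N.toReal.StronglyControllable := by
  classical
  obtain ⟨h⟩ := polyFun_controllableWord.polyTime CSTNU.encode
  refine ⟨?_⟩
  convert h using 2 with N
  rw [Bool.eq_iff_iff, controllableTokens_iff, decide_eq_true_iff]

end CSTNU

/-! ## Structured programs for random access machines -/

namespace Cmd

variable {O T D : Type} {act : O → D → D} {tst : T → D → Bool}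

/-- A list of operations as a program. -/
def ops (l : List O) : Cmd O T := l.foldr (fun o p => .op o ;; p) .skip

variable (act tst) in
/-- Started in a state with property `P`, the program ends in one with property `Q` after at most
`n` steps. -/
def Triple (P : D → Prop) (p : Cmd O T) (n : ℕ) (Q : D → Prop) : Prop :=
  ∀ d, P d → ∃ d', Run act tst p d n d' ∧ Q d'

theorem Run.ops (l : List O) (d : D) :
    Run act tst (ops l) d l.length (l.foldl (fun d o => act o d) d) := by
  induction l generalizing d with
  | nil => exact .skip
  | cons o l ih => exact .seq (.op le_rfl) (ih _) (by simp [add_comm])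

theorem Triple.loop {I : ℕ → D → Prop} {t : T} {p : Cmd O T} {n m : ℕ}
    (ht : ∀ i d, I i d → tst t d = decide (i < n))
    (hp : ∀ i < n, Triple act tst (I i) p m (I (i + 1))) :
    Triple act tst (I 0) (.loop t p) (n * (m + 2) + 2) (I n) := by
  suffices ∀ k i, i + k = n → Triple act tst (I i) (.loop t p) (k * (m + 2) + 2) (I n) from
    this n 0 (zero_add n)
  intro k
  induction k with
  | zero =>
    rintro i rfl d hd
    exact ⟨d, .loopF (by simpa using ht i d hd) (by omega), hd⟩
  | succ k ih =>
    intro i hi d hd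
    obtain ⟨d', h₁, h₂⟩ := hp i (by omega) d hd
    obtain ⟨d'', h₃, h₄⟩ := ih (i + 1) (by omega) d' h₂
    refine ⟨d'', .loopT ?_ h₁ h₃ (by ring_nf; omega), h₄⟩
    rw [ht i d hd]
    exact decide_eq_true (by omega)

end Cmd

/-- The conditions of the conditional jumps. -/
inductive RAMTest where
  | ltN (a b : ℕ)
  | ltR (a b : ℕ)

namespace RAMTest

/-- The truth value of a condition. -/
noncomputable def eval : RAMTest → RAMState → Bool
  | ltN a b, σ => decide (σ.regN a < σ.regN b)
  | ltR a b, σ => decide (σ.regR a < σ.regR b)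

/-- The conditional jump. -/
def jump : RAMTest → ℕ → RAMInstr
  | ltN a b, l => .jumpLtN a b l
  | ltR a b, l => .jumpLtR a b l

end RAMTest

/-- The instruction neither jumps nor halts. -/
def RAMInstr.straight : RAMInstr → Bool
  | jump _ | jumpLtN _ _ _ | jumpLtR _ _ _ | halt _ => false
  | _ => true

namespace Flat

/-- Instructions of flat code as instructions of the machine. -/
def toRAM : Flat RAMInstr RAMTest → RAMInstr
  | op i => i
  | jump l => .jump l
  | cjump t l => t.jump l

/-- The operation, if any, neither jumps nor halts. -/
def straight : Flat RAMInstr RAMTest → Bool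
  | op i => i.straight
  | _ => true

end Flat

/-- The effect of an operation. -/
noncomputable def ramAct (i : RAMInstr) (σ : RAMState) : RAMState := i.exec σ

/-- The state with the given program counter. -/
def RAMState.at (c : ℕ × RAMState) : RAMState := { c.2 with pc := c.1 }

/-- Operations must be straight: an instruction that jumps or halts would not advance the program
counter by one, as flat code assumes. The counter stored in the state is overwritten by the address
of the flat configuration. -/
theorem ramStep_at {code : List (Flat RAMInstr RAMTest)} (hc : code.all Flat.straight = true)
    (tail : List RAMInstr) {c : ℕ × RAMState} (h : c.1 < code.length) :
    ramStep (code.map Flat.toRAM ++ tail) (.at c) =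
      .at (Cmd.flatStep ramAct RAMTest.eval code c) := by
  have h₁ : (code.map Flat.toRAM ++ tail)[(RAMState.at c).pc]? = some (code[c.1].toRAM) := by
    rw [List.getElem?_append_left (by simpa [RAMState.at] using h)]
    simp [RAMState.at, h]
  have h₂ : code[c.1].straight = true := List.all_eq_true.1 hc _ (List.getElem_mem h)
  rw [ramStep, h₁, Cmd.flatStep, List.getElem?_eq_getElem h]
  generalize code[c.1] = i at h₂
  rcases i with i | l | ⟨t, l⟩
  · cases i <;> first | rfl | cases h₂
  · rfl
  · cases t <;> simp [Flat.toRAM, RAMTest.jump, RAMTest.eval, RAMState.at, RAMInstr.exec] <;> congr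

/-- Flat code stands still once it has left its range, whereas the machine would go on with `tail`;
hence the machine may have to stop after `l ≤ k` steps. -/
theorem exists_ramStep_iterate {code : List (Flat RAMInstr RAMTest)}
    (hc : code.all Flat.straight = true) (tail : List RAMInstr) (k : ℕ) (c : ℕ × RAMState) :
    ∃ l ≤ k, (ramStep (code.map Flat.toRAM ++ tail))^[l] (.at c) =
      .at ((Cmd.flatStep ramAct RAMTest.eval code)^[k] c) := by
  induction k generalizing c with
  | zero => exact ⟨0, le_rfl, rfl⟩
  | succ k ih =>
    rw [Function.iterate_succ_apply]
    by_cases h : c.1 < code.length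
    · obtain ⟨l, hl, hl'⟩ := ih (Cmd.flatStep ramAct RAMTest.eval code c)
      refine ⟨l + 1, by omega, ?_⟩
      rw [Function.iterate_succ_apply, ramStep_at hc tail h, hl']
    · obtain ⟨l, hl, hl'⟩ := ih c
      refine ⟨l, by omega, ?_⟩
      rw [hl', Cmd.flatStep, List.getElem?_eq_none (not_lt.1 h)]

/-- The program runs `p` and answers whether, at the end, register `a` is less than register `b`. -/
def ramProgram (p : Cmd RAMInstr RAMTest) (a b : ℕ) : List RAMInstr :=
  (Cmd.compile 0 p).map Flat.toRAM ++ [.jumpLtN a b (p.size + 2), .halt false, .halt true]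

theorem ramAnswers_of_run {p : Cmd RAMInstr RAMTest}
    (hp : (Cmd.compile 0 p).all Flat.straight = true) {input : List (ℕ ⊕ ℝ)} {n : ℕ}
    {σ : RAMState} (h : Cmd.Run ramAct RAMTest.eval p (ramInit input) n σ) {a b : ℕ} {ans : Bool}
    (hans : ans = decide (σ.regN a < σ.regN b)) :
    RAMAnswers (ramProgram p a b) input ans (n + 1) := by
  obtain ⟨k, hk, hk'⟩ := h.flatRun_compile []
  rw [List.append_nil] at hk'
  obtain ⟨l, hl, hl'⟩ := exists_ramStep_iterate hp
    [.jumpLtN a b (p.size + 2), .halt false, .halt true] k (0, ramInit input)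
  have h₁ (i : ℕ) : (ramProgram p a b)[p.size + i]? =
      [RAMInstr.jumpLtN a b (p.size + 2), .halt false, .halt true][i]? := by
    rw [ramProgram, List.getElem?_append_right (by simp)]
    simp
  refine ⟨l + 1, by omega, ?_⟩
  have h₂ : (ramStep (ramProgram p a b))^[l] (ramInit input) = .at (p.size, σ) := by
    rw [← hk']
    exact hl'
  have h₃ : ramStep (ramProgram p a b) (.at (p.size, σ)) =
      .at (if σ.regN a < σ.regN b then p.size + 2 else p.size + 1, σ) := by
    have := h₁ 0
    rw [add_zero] at this
    simp [ramStep, RAMState.at, this, RAMInstr.exec]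
    congr
  rw [Function.iterate_succ_apply', h₂, h₃, hans]
  by_cases hlt : σ.regN a < σ.regN b
  · simp [RAMState.at, hlt, h₁]
  · simp [RAMState.at, hlt, h₁]

/-! ## A linear number of rounds on a random access machine -/

namespace DiffConstraints

variable {V : Type} [DecidableEq V]

/-- Relax a constraint, and raise the flag if it is violated. -/
noncomputable def relaxFlag (s : (V → ℝ) × ℕ) (e : V × V × ℝ) : (V → ℝ) × ℕ :=
  (relax s.1 e, if e.2.2 + s.1 e.2.1 < s.1 e.1 then 1 else s.2)

theorem foldl_relaxFlag_fst (E : List (V × V × ℝ)) (s : (V → ℝ) × ℕ) :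
    (E.foldl relaxFlag s).1 = round E s.1 := by
  induction E generalizing s with
  | nil => rfl
  | cons e E ih => exact ih _

/-- As long as no constraint is violated, `d` stays unchanged, so a pass without flag has tested all
constraints on `d` itself; a raised flag is never lowered. Thus an ordinary round also serves as the
final check. -/
theorem foldl_relaxFlag_snd (E : List (V × V × ℝ)) (d : V → ℝ) :
    (E.foldl relaxFlag (d, 0)).2 < 1 ↔ Sat E d := by
  have h (E : List (V × V × ℝ)) (s : (V → ℝ) × ℕ) : s.2 ≤ (E.foldl relaxFlag s).2 ∨
      1 ≤ (E.foldl relaxFlag s).2 := by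
    induction E generalizing s with
    | nil => exact .inl le_rfl
    | cons e E ih =>
      have := ih (relaxFlag s e)
      rw [List.foldl_cons]
      unfold relaxFlag at this ⊢
      split_ifs at this ⊢ <;> simp only at this ⊢ <;> omega
  induction E with
  | nil => simp [Sat]
  | cons e E ih =>
    rw [List.foldl_cons, Sat, List.forall_mem_cons, relaxFlag]
    by_cases he : e.2.2 + d e.2.1 < d e.1
    · refine iff_of_false (fun hlt => ?_) fun hs => absurd he (not_lt.2 hs.1)
      simp only [he, if_true] at hlt
      have := h E (relax d e, 1)
      simp only at this
      omega
    · simp only [relax, if_neg he]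
      exact ih.trans (and_iff_right (not_lt.1 he)).symm

end DiffConstraints

theorem List.getElem?_flatMap_append {α β : Type} (l : List α) (f : α → List β) {n : ℕ}
    (hf : ∀ a, (f a).length = n) (rest : List β) {i k : ℕ} (hi : i < l.length) (hk : k < n) :
    (l.flatMap f ++ rest)[n * i + k]? = (f l[i])[k]? := by
  induction l generalizing i with
  | nil => simp at hi
  | cons a l ih =>
    rw [List.flatMap_cons, List.append_assoc]
    cases i with
    | zero =>
      rw [List.getElem?_append_left (by rw [hf]; omega)]
      simp
    | succ i =>
      have h : n * (i + 1) + k = n + (n * i + k) := by ring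
      rw [h, List.getElem?_append_right (by rw [hf]; omega), hf, Nat.add_sub_cancel_left,
        ih (by simpa using hi)]
      rfl

/-! ### Frame conditions for machine states -/

namespace RAMState

/-- The program leads from one state to another in at most `n` steps. -/
abbrev Runs (σ : RAMState) (p : Cmd RAMInstr RAMTest) (n : ℕ) (σ' : RAMState) : Prop :=
  Cmd.Run ramAct RAMTest.eval p σ n σ'

/-- The states agree except for the registers in the lists and for real memory cells. -/
structure Agree (I J : List ℕ) (σ σ' : RAMState) : Prop where
  regN : ∀ k, k ∉ I → σ'.regN k = σ.regN k
  regR : ∀ k, k ∉ J → σ'.regR k = σ.regR k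
  memN : σ'.memN = σ.memN

theorem Agree.trans {I J I' J' : List ℕ} {σ σ' σ'' : RAMState} (h : σ.Agree I J σ')
    (h' : σ'.Agree I' J' σ'') : σ.Agree (I ++ I') (J ++ J') σ'' := by
  refine ⟨fun k hk => ?_, fun k hk => ?_, h'.memN.trans h.memN⟩
  · rw [List.mem_append, not_or] at hk
    exact (h'.regN k hk.2).trans (h.regN k hk.1)
  · rw [List.mem_append, not_or] at hk
    exact (h'.regR k hk.2).trans (h.regR k hk.1)

end RAMState

/-! ### Memory layout and subroutines -/

namespace CSTNU

open DiffConstraints Cmd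

variable (N : CSTNU ℝ)

/-- The record begins with four cardinalities and the executable timepoints; then each constraint
takes four cells. -/
theorem getElem?_record_link (j : Fin N.numCtg) {k : ℕ} (hk : k < 4) :
    N.record[4 + N.numExec + (4 * j + k)]? = (constraintRecord (N.numExec + (j : ℕ))
      ((N.links j).start : ℕ) (N.links j).lo (N.links j).hi)[k]? := by
  have h : ([Sum.inl N.numExec, Sum.inl N.numCtg, Sum.inl N.numProp, Sum.inl N.reqs.length]
      ++ (List.range N.numExec).map (Sum.inl : ℕ → ℕ ⊕ ℝ)).length = 4 + N.numExec := by
    simp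
    ring
  rw [record, List.append_assoc, List.append_assoc, List.append_assoc,
    List.getElem?_append_right (by rw [h]; omega), h, Nat.add_sub_cancel_left,
    List.getElem?_flatMap_append (n := 4) _ _ (fun _ => rfl) _ (by simp) hk, List.getElem_finRange]
  rfl

theorem getElem?_record_req {i : ℕ} (hi : i < N.reqs.length) {k : ℕ} (hk : k < 4) :
    N.record[4 + N.numExec + 4 * N.numCtg + (4 * i + k)]? = (constraintRecord N.reqs[i].2.x.idx
      N.reqs[i].2.y.idx N.reqs[i].2.lo N.reqs[i].2.hi)[k]? := by
  have h : ([Sum.inl N.numExec, Sum.inl N.numCtg, Sum.inl N.numProp, Sum.inl N.reqs.length]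
      ++ (List.range N.numExec).map Sum.inl
      ++ (List.finRange N.numCtg).flatMap (fun j : Fin N.numCtg => constraintRecord
        (N.numExec + (j : ℕ)) ((N.links j).start : ℕ) (N.links j).lo (N.links j).hi)).length =
      4 + N.numExec + 4 * N.numCtg := by
    simp [constraintRecord, List.length_flatMap]
    ring
  rw [record, List.append_assoc, List.append_assoc, List.getElem?_append_right (by rw [h]; omega),
    h, Nat.add_sub_cancel_left]
  exact List.getElem?_flatMap_append (n := 4) _ _ (fun _ => rfl) _ hi hk

/-- The values of the constant registers and of the part of the memory that is not changed. -/
structure Ready (σ : RAMState) : Prop where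
  zero : σ.regN 0 = 0
  one : σ.regN 1 = 1
  exec : σ.regN 2 = N.numExec
  four : σ.regN 3 = 4
  linksAt : σ.regN 4 = 4 + N.numExec
  reqsAt : σ.regN 5 = 4 + N.numExec + 4 * N.numCtg
  stopAt : σ.regN 6 = 4 + N.numExec + 4 * N.numCtg + 4 * N.reqs.length
  rounds : σ.regN 7 = N.numExec + 1
  zeroR : σ.regR 0 = 0
  memN : σ.memN = (ramInit N.record).memN
  memR : ∀ a, 4 + N.numExec ≤ a → σ.memR a = (ramInit N.record).memR a

variable {N} {σ σ' : RAMState}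

theorem Ready.link (h : N.Ready σ) (j : Fin N.numCtg) :
    σ.memN (4 + N.numExec + 4 * j + 1) = (N.links j).start ∧
      σ.memR (4 + N.numExec + 4 * j + 2) = (N.links j).lo ∧
      σ.memR (4 + N.numExec + 4 * j + 3) = (N.links j).hi := by
  rw [h.memN, h.memR _ (by omega), h.memR _ (by omega)]
  simp only [ramInit, add_assoc (4 + N.numExec) (4 * (j : ℕ))]
  rw [N.getElem?_record_link j (by omega), N.getElem?_record_link j (by omega),
    N.getElem?_record_link j (by omega)]
  exact ⟨rfl, rfl, rfl⟩

theorem Ready.req (h : N.Ready σ) {i : ℕ} (hi : i < N.reqs.length) :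
    σ.memN (4 + N.numExec + 4 * N.numCtg + 4 * i) = N.reqs[i].2.x.idx ∧
      σ.memN (4 + N.numExec + 4 * N.numCtg + 4 * i + 1) = N.reqs[i].2.y.idx ∧
      σ.memR (4 + N.numExec + 4 * N.numCtg + 4 * i + 2) = N.reqs[i].2.lo ∧
      σ.memR (4 + N.numExec + 4 * N.numCtg + 4 * i + 3) = N.reqs[i].2.hi := by
  have h₀ := N.getElem?_record_req hi (k := 0) (by omega)
  rw [add_zero] at h₀
  rw [h.memN, h.memR _ (by omega), h.memR _ (by omega)]
  simp only [ramInit, add_assoc (4 + N.numExec + 4 * N.numCtg) (4 * i)]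
  rw [N.getElem?_record_req hi (by omega), N.getElem?_record_req hi (by omega),
    N.getElem?_record_req hi (by omega), h₀]
  exact ⟨rfl, rfl, rfl, rfl⟩

/-- Natural registers below `8` and real register `0` are reserved for constants. Real cells below
`4 + N.numExec` may change: they hold the current values of the executable timepoints. -/
theorem Ready.of_agree {I J : List ℕ} (h : N.Ready σ) (ha : σ.Agree I J σ')
    (hI : ∀ k ∈ I, 8 ≤ k) (hJ : ∀ k ∈ J, 1 ≤ k)
    (hm : ∀ a, 4 + N.numExec ≤ a → σ'.memR a = σ.memR a) : N.Ready σ' := by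
  have hN (k : ℕ) (hk : k < 8) := ha.regN k fun hk' => absurd (hI k hk') (by omega)
  have hR := ha.regR 0 fun hk' => absurd (hJ 0 hk') (by omega)
  obtain ⟨h₀, h₁, h₂, h₃, h₄, h₅, h₆, h₇, h₈, h₉, h₁₀⟩ := h
  refine ⟨?_, ?_, ?_, ?_, ?_, ?_, ?_, ?_, hR.trans h₈, ha.memN.trans h₉,
    fun a h => (hm a h).trans (h₁₀ a h)⟩ <;> rwa [hN _ (by omega)]

/-- The values `s.1 v` are stored in the real memory cells `4 + v`, and register `11` holds the
flag `s.2`. -/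
def Stores (N : CSTNU ℝ) (s : (Fin N.numExec → ℝ) × ℕ) (σ : RAMState) : Prop :=
  (∀ v : Fin N.numExec, σ.memR (4 + v) = s.1 v) ∧ σ.regN 11 = s.2

/-- Find the address of the value of the timepoint on which timepoint number `n_x` depends, and its
least and greatest distance to the latter. -/
def resolveCmd (x b l : ℕ) : Cmd RAMInstr RAMTest :=
  .ite (.ltN x 2) (ops [.addN b 3 x, .addR l 0 0, .addR (l + 1) 0 0])
    (ops [.subN 9 x 2, .addN 9 9 9, .addN 9 9 9, .addN 9 4 9, .addN 9 9 1, .loadN b 9, .addN b 3 b,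
      .addN 9 9 1, .loadR l 9, .addN 9 9 1, .loadR (l + 1) 9])

/-- A number below `N.numExec` is an executable timepoint with zero delays. Otherwise the link's
address is computed from the difference, and start and bounds are loaded from there. -/
theorem Ready.resolveCmd (h : N.Ready σ) {x b l : ℕ} (hb : 9 < b) (hl : 0 < l)
    (X : Timepoint N.numExec N.numCtg) (hX : σ.regN x = X.idx) :
    ∃ σ', σ.Runs (resolveCmd x b l) 13 σ' ∧ σ.Agree [9, b] [l, l + 1] σ' ∧ σ'.memR = σ.memR ∧
      σ'.regN b = 4 + X.base N.links ∧ σ'.regR l = X.minDelay N.links ∧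
      σ'.regR (l + 1) = X.maxDelay N.links := by
  rcases X with i | j
  · simp only [Timepoint.idx] at hX
    refine ⟨_, .iteT ?_ (.ops _ _) ?_, ⟨?_, ?_, rfl⟩, rfl, ?_, ?_, ?_⟩
    · simp [RAMTest.eval, hX, h.exec]
    · simp
    · intro k hk
      simp only [List.mem_cons, List.not_mem_nil, or_false, not_or] at hk
      simp [ramAct, RAMInstr.exec, hk]
    · intro k hk
      simp only [List.mem_cons, List.not_mem_nil, or_false, not_or] at hk
      simp [ramAct, RAMInstr.exec, hk]
    · simp [ramAct, RAMInstr.exec, hX, h.four, Timepoint.base]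
    · simp [ramAct, RAMInstr.exec, h.zeroR, Timepoint.minDelay]
    · simp [ramAct, RAMInstr.exec, h.zeroR, Timepoint.maxDelay, hl.ne]
  · simp only [Timepoint.idx] at hX
    obtain ⟨h₁, h₂, h₃⟩ := h.link j
    -- Multiplication by four is done by doubling twice.
    have ha : 4 + N.numExec + ((j : ℕ) + j + (j + j)) = 4 + N.numExec + 4 * j := by ring
    refine ⟨_, .iteF ?_ (.ops _ _) ?_, ⟨?_, ?_, rfl⟩, rfl, ?_, ?_, ?_⟩
    · simp [RAMTest.eval, hX, h.exec]
    · simp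
    · intro k hk
      simp only [List.mem_cons, List.not_mem_nil, or_false, not_or] at hk
      simp [ramAct, RAMInstr.exec, hk]
    · intro k hk
      simp only [List.mem_cons, List.not_mem_nil, or_false, not_or] at hk
      simp [ramAct, RAMInstr.exec, hk]
    · simp (disch := omega) [ramAct, RAMInstr.exec, Function.update_of_ne, hX, h.four, h.one,
        h.exec, h.linksAt, ha, h₁, Timepoint.base]
    · simp (disch := omega) [ramAct, RAMInstr.exec, Function.update_of_ne, hX, h.four, h.one,
        h.exec, h.linksAt, ha, h₂, Timepoint.minDelay]
    · simp (disch := omega) [ramAct, RAMInstr.exec, Function.update_of_ne, hX, h.four, h.one,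
        h.exec, h.linksAt, ha, h₃, Timepoint.maxDelay]

/-- Relax the constraint on the values with addresses `n_a` and `n_b` and with weight `r_7`. -/
def relaxCmd (a b : ℕ) : Cmd RAMInstr RAMTest :=
  ops [.loadR 8 b, .addR 8 7 8, .loadR 9 a] ;; .ite (.ltR 8 9) (ops [.storeR a 8, .constN 11 1]) .skip

theorem Stores.relaxCmd {s : (Fin N.numExec → ℝ) × ℕ} (hs : N.Stores s σ) {a b : ℕ}
    {u v : Fin N.numExec} (ha : σ.regN a = 4 + u) (hb : σ.regN b = 4 + v) :
    ∃ σ', σ.Runs (relaxCmd a b) 7 σ' ∧ N.Stores (relaxFlag s (u, v, σ.regR 7)) σ' ∧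
      σ.Agree [11] [8, 9] σ' ∧ ∀ a, 4 + N.numExec ≤ a → σ'.memR a = σ.memR a := by
  have h₁ : σ.memR (4 + u) = s.1 u := hs.1 u
  have h₂ : σ.memR (4 + v) = s.1 v := hs.1 v
  by_cases hlt : σ.regR 7 + s.1 v < s.1 u
  · refine ⟨_, .seq (.ops _ _) (.iteT ?_ (.ops _ _) le_rfl) (by simp), ⟨?_, ?_⟩,
      ⟨?_, ?_, rfl⟩, ?_⟩
    · simp [ramAct, RAMInstr.exec, RAMTest.eval, ha, hb, h₁, h₂, hlt]
    · intro w
      by_cases hw : w = u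
      · subst hw
        simp [ramAct, RAMInstr.exec, ha, hb, h₂, hlt, relaxFlag, relax]
      · have hw' : (w : ℕ) ≠ u := fun h => hw (Fin.ext h)
        simp [ramAct, RAMInstr.exec, ha, hlt, relaxFlag, relax, hw, hw',
          hs.1 w]
    · simp [ramAct, RAMInstr.exec, relaxFlag, hlt]
    · intro k hk
      simp only [List.mem_cons, List.not_mem_nil, or_false] at hk
      simp [ramAct, RAMInstr.exec, hk]
    · intro k hk
      simp only [List.mem_cons, List.not_mem_nil, or_false, not_or] at hk
      simp [ramAct, RAMInstr.exec, hk]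
    -- The cell written to is `4 + u` with `u < N.numExec`, in front of all constraints.
    · intro c hc
      simp [ramAct, RAMInstr.exec, Function.update_apply, ha]
      intro h
      omega
  · refine ⟨_, .seq (.ops _ _) (.iteF ?_ (.skip (n := 0)) le_rfl) (by simp), ⟨?_, ?_⟩,
      ⟨?_, ?_, rfl⟩, fun _ _ => rfl⟩
    · simp [ramAct, RAMInstr.exec, RAMTest.eval, ha, hb, h₁, h₂, hlt]
    · intro w
      simp [ramAct, RAMInstr.exec, relaxFlag, relax, hlt, hs.1 w]
    · simp [ramAct, RAMInstr.exec, relaxFlag, hlt, hs.2]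
    · intro k hk
      simp [ramAct, RAMInstr.exec]
    · intro k hk
      simp only [List.mem_cons, List.not_mem_nil, or_false, not_or] at hk
      simp [ramAct, RAMInstr.exec, hk]

end CSTNU

/-! ### Processing one requirement -/

namespace CSTNU

open DiffConstraints Cmd

variable {N : CSTNU ℝ} {σ σ' : RAMState}

/-- Relax the two constraints for the requirement at address `n_8`. -/
def requirementCmd : Cmd RAMInstr RAMTest :=
  ops [.loadN 12 8, .addN 9 8 1, .loadN 13 9, .addN 9 9 1, .loadR 1 9, .addN 9 9 1, .loadR 2 9] ;;
  resolveCmd 12 14 3 ;; resolveCmd 13 15 5 ;;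
  .ite (.ltN 12 13) .skip (.ite (.ltN 13 12) .skip
    (ops [.addR 3 0 0, .addR 4 0 0, .addR 5 0 0, .addR 6 0 0])) ;;
  ops [.subR 7 2 4, .addR 7 7 5] ;; relaxCmd 14 15 ;;
  ops [.subR 7 0 1, .addR 7 7 3, .subR 7 7 6] ;; relaxCmd 15 14

/-- If neither timepoint number is smaller than the other, the four delay registers are cleared;
then the general formulas yield the weights `hi` and `-lo` of the self-loops. The number `60` is the
sum of the bounds for the eight pieces. -/
theorem Ready.requirementCmd (h : N.Ready σ) {i : ℕ} (hi : i < N.reqs.length)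
    (ha : σ.regN 8 = 4 + N.numExec + 4 * N.numCtg + 4 * i) {s : (Fin N.numExec → ℝ) × ℕ}
    (hs : N.Stores s σ) :
    ∃ σ', σ.Runs requirementCmd 60 σ' ∧ N.Ready σ' ∧ σ'.regN 8 = σ.regN 8 ∧
      σ'.regN 10 = σ.regN 10 ∧
      N.Stores ((N.reqs[i].2.edges N.links).foldl relaxFlag s) σ' := by
  obtain ⟨hx, hy, hlo, hhi⟩ := h.req hi
  generalize N.reqs[i].2 = q at hx hy hlo hhi
  -- load the requirement
  obtain ⟨σ₁, run₁, agree₁, mem₁, x₁, y₁, lo₁, hi₁⟩ : ∃ σ₁, σ.Runs (ops [.loadN 12 8, .addN 9 8 1,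
      .loadN 13 9, .addN 9 9 1, .loadR 1 9, .addN 9 9 1, .loadR 2 9]) 7 σ₁ ∧
      σ.Agree [9, 12, 13] [1, 2] σ₁ ∧ σ₁.memR = σ.memR ∧ σ₁.regN 12 = q.x.idx ∧
      σ₁.regN 13 = q.y.idx ∧ σ₁.regR 1 = q.lo ∧ σ₁.regR 2 = q.hi := by
    refine ⟨_, .ops _ _, ⟨?_, ?_, rfl⟩, rfl, ?_, ?_, ?_, ?_⟩
    · intro k hk
      simp only [List.mem_cons, List.not_mem_nil, or_false, not_or] at hk
      simp [ramAct, RAMInstr.exec, hk]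
    · intro k hk
      simp only [List.mem_cons, List.not_mem_nil, or_false, not_or] at hk
      simp [ramAct, RAMInstr.exec, hk]
    all_goals simp [ramAct, RAMInstr.exec, h.one, *]
  have ready₁ : N.Ready σ₁ := h.of_agree agree₁ (by decide) (by decide) fun a _ => by rw [mem₁]
  obtain ⟨σ₂, run₂, agree₂, mem₂, bx₂, mnx₂, mxx₂⟩ :=
    ready₁.resolveCmd (b := 14) (l := 3) (by omega) (by omega) q.x x₁
  have ready₂ : N.Ready σ₂ :=
    ready₁.of_agree agree₂ (by decide) (by decide) fun a _ => by rw [mem₂]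
  have y₂ : σ₂.regN 13 = q.y.idx := (agree₂.regN 13 (by decide)).trans y₁
  obtain ⟨σ₃, run₃, agree₃, mem₃, by₃, mny₃, mxy₃⟩ :=
    ready₂.resolveCmd (b := 15) (l := 5) (by omega) (by omega) q.y y₂
  have ready₃ : N.Ready σ₃ :=
    ready₂.of_agree agree₃ (by decide) (by decide) fun a _ => by rw [mem₃]
  have agree₁₃ := (agree₁.trans agree₂).trans agree₃
  have bx₃ : σ₃.regN 14 = _ := (agree₃.regN 14 (by decide)).trans bx₂
  have mnx₃ : σ₃.regR 3 = _ := (agree₃.regR 3 (by decide)).trans mnx₂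
  have mxx₃ : σ₃.regR 4 = _ := (agree₃.regR 4 (by decide)).trans mxx₂
  have x₃ : σ₃.regN 12 = q.x.idx := ((agree₂.trans agree₃).regN 12 (by decide)).trans x₁
  have y₃ : σ₃.regN 13 = q.y.idx := (agree₃.regN 13 (by decide)).trans y₂
  have lo₃ : σ₃.regR 1 = q.lo := ((agree₂.trans agree₃).regR 1 (by decide)).trans lo₁
  have hi₃ : σ₃.regR 2 = q.hi := ((agree₂.trans agree₃).regR 2 (by decide)).trans hi₁
  -- the offsets do not matter if the timepoints are equal
  obtain ⟨w₁, w₂, hw, σ₄, run₄, agree₄, mem₄, hw₁, hw₂⟩ : ∃ w₁ w₂, q.edges N.links =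
      [(q.x.base N.links, q.y.base N.links, w₁), (q.y.base N.links, q.x.base N.links, w₂)] ∧
      ∃ σ₄, σ₃.Runs (.ite (.ltN 12 13) .skip (.ite (.ltN 13 12) .skip
        (ops [.addR 3 0 0, .addR 4 0 0, .addR 5 0 0, .addR 6 0 0]))) 8 σ₄ ∧
      σ₃.Agree [] [3, 4, 5, 6] σ₄ ∧ σ₄.memR = σ₃.memR ∧
      σ₄.regR 2 - σ₄.regR 4 + σ₄.regR 5 = w₁ ∧
      σ₄.regR 0 - σ₄.regR 1 + σ₄.regR 3 - σ₄.regR 6 = w₂ := by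
    by_cases hxy : q.x = q.y
    · refine ⟨q.hi, -q.lo, ?_, _, .iteF ?_ (.iteF ?_ (.ops _ _) le_rfl) (by simp), ⟨?_, ?_, rfl⟩,
        rfl, ?_, ?_⟩
      · rw [Requirement.edges, if_pos hxy, ← hxy]
      · simp [RAMTest.eval, x₃, y₃, hxy]
      · simp [RAMTest.eval, x₃, y₃, hxy]
      · exact fun k hk => rfl
      · intro k hk
        simp only [List.mem_cons, List.not_mem_nil, or_false, not_or] at hk
        simp [ramAct, RAMInstr.exec, hk]
      · simp [ramAct, RAMInstr.exec, ready₃.zeroR, hi₃]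
      · simp [ramAct, RAMInstr.exec, ready₃.zeroR, lo₃]
    · refine ⟨_, _, by rw [Requirement.edges, if_neg hxy], σ₃, ?_,
        ⟨fun _ _ => rfl, fun _ _ => rfl, rfl⟩, rfl, ?_, ?_⟩
      · have hne : q.x.idx ≠ q.y.idx := fun h => hxy (Timepoint.idx_injective h)
        rcases hne.lt_or_gt with hlt | hlt
        · exact .iteT (by simp [RAMTest.eval, x₃, y₃, hlt]) (.skip (n := 0)) (by omega)
        · exact .iteF (by simp [RAMTest.eval, x₃, y₃, hlt.le])
            (.iteT (by simp [RAMTest.eval, x₃, y₃, hlt]) (.skip (n := 0)) le_rfl) (by omega)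
      · rw [hi₃, mxx₃, mny₃]; ring
      · rw [ready₃.zeroR, lo₃, mnx₃, mxy₃]; ring
  have ready₄ : N.Ready σ₄ :=
    ready₃.of_agree agree₄ (by decide) (by decide) fun a _ => by rw [mem₄]
  -- the first constraint
  obtain ⟨σ₅, run₅, agree₅, mem₅, w₅⟩ : ∃ σ₅, σ₄.Runs (ops [.subR 7 2 4, .addR 7 7 5]) 2 σ₅ ∧
      σ₄.Agree [] [7] σ₅ ∧ σ₅.memR = σ₄.memR ∧ σ₅.regR 7 = w₁ := by
    refine ⟨_, .ops _ _, ⟨fun _ _ => rfl, ?_, rfl⟩, rfl, ?_⟩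
    · intro k hk
      simp only [List.mem_cons, List.not_mem_nil, or_false] at hk
      simp [ramAct, RAMInstr.exec, hk]
    · simp [ramAct, RAMInstr.exec, ← hw₁]
  have ready₅ : N.Ready σ₅ :=
    ready₄.of_agree agree₅ (by decide) (by decide) fun a _ => by rw [mem₅]
  have agree₃₅ := agree₄.trans agree₅
  have stores₅ : N.Stores s σ₅ := by
    refine ⟨fun v => ?_, ?_⟩
    · rw [mem₅, mem₄, mem₃, mem₂, mem₁]
      exact hs.1 v
    · exact ((agree₁₃.trans agree₃₅).regN 11 (by decide)).trans hs.2
  have bx₅ : σ₅.regN 14 = _ := (agree₃₅.regN 14 (by decide)).trans bx₃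
  have by₅ : σ₅.regN 15 = _ := (agree₃₅.regN 15 (by decide)).trans by₃
  obtain ⟨σ₆, run₆, stores₆, agree₆, mem₆⟩ := stores₅.relaxCmd bx₅ by₅
  have ready₆ : N.Ready σ₆ := ready₅.of_agree agree₆ (by decide) (by decide) mem₆
  -- the second constraint
  obtain ⟨σ₇, run₇, agree₇, mem₇, w₇⟩ : ∃ σ₇, σ₆.Runs (ops [.subR 7 0 1, .addR 7 7 3,
      .subR 7 7 6]) 3 σ₇ ∧ σ₆.Agree [] [7] σ₇ ∧ σ₇.memR = σ₆.memR ∧ σ₇.regR 7 = w₂ := by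
    refine ⟨_, .ops _ _, ⟨fun _ _ => rfl, ?_, rfl⟩, rfl, ?_⟩
    · intro k hk
      simp only [List.mem_cons, List.not_mem_nil, or_false] at hk
      simp [ramAct, RAMInstr.exec, hk]
    · have agree₄₆ := agree₅.trans agree₆
      have h₀ := agree₄₆.regR 0 (by decide)
      have h₁ := agree₄₆.regR 1 (by decide)
      have h₃ := agree₄₆.regR 3 (by decide)
      have h₆ := agree₄₆.regR 6 (by decide)
      simp [ramAct, RAMInstr.exec, ← hw₂, h₀, h₁, h₃, h₆]
  have ready₇ : N.Ready σ₇ :=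
    ready₆.of_agree agree₇ (by decide) (by decide) fun a _ => by rw [mem₇]
  have agree₅₇ := agree₆.trans agree₇
  have stores₇ : N.Stores _ σ₇ := ⟨fun v => by rw [mem₇]; exact stores₆.1 v,
    (agree₇.regN 11 (by decide)).trans stores₆.2⟩
  have bx₇ : σ₇.regN 14 = _ := (agree₅₇.regN 14 (by decide)).trans bx₅
  have by₇ : σ₇.regN 15 = _ := (agree₅₇.regN 15 (by decide)).trans by₅
  obtain ⟨σ₈, run₈, stores₈, agree₈, mem₈⟩ := stores₇.relaxCmd by₇ bx₇
  have agree₁₈ := ((agree₁₃.trans agree₃₅).trans agree₅₇).trans agree₈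
  refine ⟨σ₈, ?_, ready₇.of_agree agree₈ (by decide) (by decide) mem₈,
    agree₁₈.regN 8 (by decide), agree₁₈.regN 10 (by decide), ?_⟩
  · exact (Run.seq run₁ (.seq run₂ (.seq run₃ (.seq run₄ (.seq run₅ (.seq run₆
      (.seq run₇ run₈ le_rfl) le_rfl) le_rfl) le_rfl) le_rfl) le_rfl) le_rfl).mono (by omega)
  · rw [hw]
    rw [w₇, w₅] at stores₈
    exact stores₈

end CSTNU

/-! ### The complete program and its running time -/

namespace CSTNU

open DiffConstraints Cmd

/-- Set up the constant registers. -/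
def setupCmd : Cmd RAMInstr RAMTest :=
  ops [.constN 0 0, .constN 1 1, .constN 3 4, .loadN 2 0, .addN 7 2 1, .addN 4 3 2, .loadN 9 1,
    .addN 9 9 9, .addN 9 9 9, .addN 5 4 9, .constN 9 3, .loadN 9 9, .addN 9 9 9, .addN 9 9 9,
    .addN 6 5 9]

/-- Set register `16` to `1` if some contingent constraint has an empty range. -/
def linksCmd : Cmd RAMInstr RAMTest :=
  ops [.addN 8 0 4] ;; .loop (.ltN 8 5)
    (ops [.addN 9 8 1, .addN 9 9 1, .loadR 1 9, .addN 9 9 1, .loadR 2 9] ;;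
      .ite (.ltR 2 1) (ops [.constN 16 1]) .skip ;; ops [.addN 8 8 3])

/-- Relax all constraints. -/
def roundCmd : Cmd RAMInstr RAMTest :=
  ops [.constN 11 0, .addN 8 0 5] ;; .loop (.ltN 8 6) (requirementCmd ;; ops [.addN 8 8 3]) ;;
    ops [.addN 10 10 1]

/-- Decide strong controllability. At the end, register `11` holds `0` if and only if the network
is strongly controllable. -/
def controllableCmd : Cmd RAMInstr RAMTest :=
  setupCmd ;; .ite (.ltN 5 6)
    (linksCmd ;; .ite (.ltN 0 16) .skip (.loop (.ltN 10 7) roundCmd)) .skip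

theorem straight_controllableCmd :
    (Cmd.compile 0 controllableCmd).all Flat.straight = true := by
  decide +kernel

variable (N : CSTNU ℝ) {σ : RAMState}

theorem setupCmd_run : ∃ σ, (ramInit N.record).Runs setupCmd 15 σ ∧ N.Ready σ ∧
    N.Stores (0, 0) σ ∧ σ.regN 10 = 0 ∧ σ.regN 16 = 0 := by
  have h₀ : (ramInit N.record).memN 0 = N.numExec := rfl
  have h₁ : (ramInit N.record).memN 1 = N.numCtg := rfl
  have h₃ : (ramInit N.record).memN 3 = N.reqs.length := rfl
  have hr : (ramInit N.record).regR 0 = 0 := rfl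
  have hreg (k : ℕ) (hk : k ≠ 0) : (ramInit N.record).regN k = 0 := by simp [ramInit, hk]
  -- The executable timepoints are listed as natural numbers, so the real cells at these positions
  -- are zero, which is the starting value for Bellman-Ford.
  have hmem (v : Fin N.numExec) : (ramInit N.record).memR (4 + v) = 0 := by
    have : N.record[4 + (v : ℕ)]? = some (Sum.inl (v : ℕ)) := by
      simp only [record, List.append_assoc]
      rw [List.getElem?_append_right (by simp), List.getElem?_append_left (by simp)]
      simp
    simp only [ramInit, this]
    rfl
  refine ⟨_, .ops _ _, ⟨?_, ?_, ?_, ?_, ?_, ?_, ?_, ?_, hr, rfl, fun _ _ => rfl⟩, ⟨hmem, ?_⟩, ?_, ?_⟩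
  all_goals simp [ramAct, RAMInstr.exec, h₀, h₁, h₃, hreg]
  all_goals ring

variable {N}

open Classical in
theorem Ready.linksCmd (h : N.Ready σ) (h' : N.Stores (0, 0) σ) (h₁₀ : σ.regN 10 = 0)
    (h₁₆ : σ.regN 16 = 0) : ∃ σ', σ.Runs linksCmd (N.numCtg * 11 + 3) σ' ∧ N.Ready σ' ∧
      N.Stores (0, 0) σ' ∧ σ'.regN 10 = 0 ∧
      σ'.regN 16 = if ∃ j, (N.links j).hi < (N.links j).lo then 1 else 0 := by
  let I (i : ℕ) (σ : RAMState) : Prop := N.Ready σ ∧ N.Stores (0, 0) σ ∧ σ.regN 10 = 0 ∧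
    σ.regN 8 = 4 + N.numExec + 4 * i ∧
    σ.regN 16 = if ∃ j : Fin N.numCtg, j < i ∧ (N.links j).hi < (N.links j).lo then 1 else 0
  have hloop : Cmd.Triple ramAct RAMTest.eval (I 0) (.loop (.ltN 8 5)
      (ops [.addN 9 8 1, .addN 9 9 1, .loadR 1 9, .addN 9 9 1, .loadR 2 9] ;;
      .ite (.ltR 2 1) (ops [.constN 16 1]) .skip ;; ops [.addN 8 8 3])) (N.numCtg * (9 + 2) + 2)
      (I N.numCtg) := by
    refine Cmd.Triple.loop (fun i σ hi => ?_) fun i hi σ hσ => ?_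
    · simp [RAMTest.eval, hi.1.reqsAt, hi.2.2.2.1]
    · obtain ⟨hr, hs, h₁₀, h₈, h₁₆⟩ := hσ
      obtain ⟨_, hlo, hhi⟩ := hr.link ⟨i, hi⟩
      simp only at hlo hhi
      obtain ⟨σ₁, run₁, agree₁, mem₁, lo₁, hi₁⟩ : ∃ σ₁, σ.Runs (ops [.addN 9 8 1, .addN 9 9 1,
          .loadR 1 9, .addN 9 9 1, .loadR 2 9]) 5 σ₁ ∧ σ.Agree [9] [1, 2] σ₁ ∧
          σ₁.memR = σ.memR ∧ σ₁.regR 1 = (N.links ⟨i, hi⟩).lo ∧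
          σ₁.regR 2 = (N.links ⟨i, hi⟩).hi := by
        refine ⟨_, .ops _ _, ⟨?_, ?_, rfl⟩, rfl, ?_, ?_⟩
        · intro k hk
          simp only [List.mem_cons, List.not_mem_nil, or_false] at hk
          simp [ramAct, RAMInstr.exec, hk]
        · intro k hk
          simp only [List.mem_cons, List.not_mem_nil, or_false, not_or] at hk
          simp [ramAct, RAMInstr.exec, hk]
        all_goals simp [ramAct, RAMInstr.exec, hr.one, *]
      obtain ⟨σ₂, run₂, agree₂, mem₂, h₁₆'⟩ : ∃ σ₂, σ₁.Runs (.ite (.ltR 2 1)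
          (ops [.constN 16 1]) .skip) 2 σ₂ ∧ σ₁.Agree [16] [] σ₂ ∧ σ₂.memR = σ₁.memR ∧
          σ₂.regN 16 = if ∃ j : Fin N.numCtg, j < i + 1 ∧ (N.links j).hi < (N.links j).lo
            then 1 else 0 := by
        by_cases hlt : (N.links ⟨i, hi⟩).hi < (N.links ⟨i, hi⟩).lo
        · refine ⟨_, .iteT ?_ (.ops _ _) le_rfl, ⟨?_, fun _ _ => rfl, rfl⟩, rfl, ?_⟩
          · simp [RAMTest.eval, lo₁, hi₁, hlt]
          · intro k hk
            simp only [List.mem_cons, List.not_mem_nil, or_false] at hk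
            simp [ramAct, RAMInstr.exec, hk]
          · rw [if_pos ⟨⟨i, hi⟩, Nat.lt_succ_self i, hlt⟩]
            simp [ramAct, RAMInstr.exec]
        · refine ⟨σ₁, .iteF ?_ (.skip (n := 0)) le_rfl,
            ⟨fun _ _ => rfl, fun _ _ => rfl, rfl⟩, rfl, ?_⟩
          · simp [RAMTest.eval, lo₁, hi₁, hlt]
          · rw [agree₁.regN 16 (by decide), h₁₆]
            refine if_congr (exists_congr fun j => ⟨fun h => ⟨by omega, h.2⟩, fun h =>
              ⟨lt_of_le_of_ne (by omega) ?_, h.2⟩⟩) rfl rfl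
            rintro rfl
            exact hlt h.2
      have agree₁₂ := agree₁.trans agree₂
      have agree₃ : σ₂.Agree [8] [] (ramAct (.addN 8 8 3) σ₂) := by
        refine ⟨?_, fun _ _ => rfl, rfl⟩
        intro k hk
        simp only [List.mem_cons, List.not_mem_nil, or_false] at hk
        simp [ramAct, RAMInstr.exec, hk]
      have agree₁₃ := agree₁₂.trans agree₃
      have ready₂ : N.Ready σ₂ :=
        hr.of_agree agree₁₂ (by decide) (by decide) fun a _ => by rw [mem₂, mem₁]
      refine ⟨ramAct (.addN 8 8 3) σ₂, .seq run₁ (.seq run₂ (.ops [RAMInstr.addN 8 8 3] _) le_rfl) (by simp),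
        ready₂.of_agree agree₃ (by decide) (by decide) fun _ _ => rfl, ⟨fun v => ?_, ?_⟩, ?_, ?_, ?_⟩
      · exact (congrFun (mem₂.trans mem₁) _).trans (hs.1 v)
      · exact (agree₁₃.regN 11 (by decide)).trans hs.2
      · exact (agree₁₃.regN 10 (by decide)).trans h₁₀
      · have := agree₁₂.regN 8 (by decide)
        simp only [ramAct, RAMInstr.exec, Function.update_self, this, h₈, ready₂.four]
        ring
      · exact (agree₃.regN 16 (by decide)).trans h₁₆'
  have agree₁ : σ.Agree [8] [] (ramAct (.addN 8 0 4) σ) := by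
    refine ⟨?_, fun _ _ => rfl, rfl⟩
    intro k hk
    simp only [List.mem_cons, List.not_mem_nil, or_false] at hk
    simp [ramAct, RAMInstr.exec, hk]
  obtain ⟨σ', run, h₁, h₂, h₃, _, h₅⟩ := hloop (ramAct (.addN 8 0 4) σ)
    ⟨h.of_agree agree₁ (by decide) (by decide) fun _ _ => rfl,
      ⟨h'.1, (agree₁.regN 11 (by decide)).trans h'.2⟩, (agree₁.regN 10 (by decide)).trans h₁₀,
      by simp [ramAct, RAMInstr.exec, h.zero, h.linksAt], by
        simpa using (agree₁.regN 16 (by decide)).trans h₁₆⟩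
  refine ⟨σ', .seq (.ops [RAMInstr.addN 8 0 4] σ) run (by simp; omega), h₁, h₂, h₃, ?_⟩
  simpa using h₅

theorem Ready.roundCmd (h : N.Ready σ) {d : Fin N.numExec → ℝ} {f : ℕ}
    (h' : N.Stores (d, f) σ) : ∃ σ', σ.Runs roundCmd (N.reqs.length * 63 + 5) σ' ∧ N.Ready σ' ∧
      N.Stores (N.edges.foldl relaxFlag (d, 0)) σ' ∧ σ'.regN 10 = σ.regN 10 + 1 := by
  let I (i : ℕ) (σ' : RAMState) : Prop := N.Ready σ' ∧ σ'.regN 10 = σ.regN 10 ∧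
    σ'.regN 8 = 4 + N.numExec + 4 * N.numCtg + 4 * i ∧
    N.Stores (((N.reqs.take i).flatMap fun r => r.2.edges N.links).foldl relaxFlag (d, 0)) σ'
  have hloop : Cmd.Triple ramAct RAMTest.eval (I 0) (.loop (.ltN 8 6)
  (CSTNU.requirementCmd ;; ops [.addN 8 8 3])) (N.reqs.length * (61 + 2) + 2) (I N.reqs.length) := by
    refine Cmd.Triple.loop (fun i σ hi => ?_) fun i hi σ₁ hσ => ?_
    · simp [RAMTest.eval, hi.1.stopAt, hi.2.2.1]
    · obtain ⟨hr, h₁₀, h₈, hs⟩ := hσ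
      obtain ⟨σ₂, run₂, hr₂, h₈', h₁₀', hs₂⟩ := hr.requirementCmd hi h₈ hs
      have agree₃ : σ₂.Agree [8] [] (ramAct (.addN 8 8 3) σ₂) := by
        refine ⟨?_, fun _ _ => rfl, rfl⟩
        intro k hk
        simp only [List.mem_cons, List.not_mem_nil, or_false] at hk
        simp [ramAct, RAMInstr.exec, hk]
      refine ⟨ramAct (.addN 8 8 3) σ₂, .seq run₂ (.ops [RAMInstr.addN 8 8 3] _) (by simp),
        hr₂.of_agree agree₃ (by decide) (by decide) fun _ _ => rfl,
        (agree₃.regN 10 (by decide)).trans (h₁₀'.trans h₁₀), ?_, ?_⟩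
      · simp only [ramAct, RAMInstr.exec, Function.update_self, h₈', h₈, hr₂.four]
        ring
      · rw [List.take_add_one, List.getElem?_eq_getElem hi, Option.toList_some,
          List.flatMap_append, List.foldl_append, List.flatMap_cons, List.flatMap_nil,
          List.append_nil]
        exact ⟨hs₂.1, (agree₃.regN 11 (by decide)).trans hs₂.2⟩
  obtain ⟨σ₁, run₁, agree₁, mem₁, h₁₁, h₈⟩ : ∃ σ₁, σ.Runs (ops [.constN 11 0, .addN 8 0 5]) 2 σ₁ ∧
      σ.Agree [8, 11] [] σ₁ ∧ σ₁.memR = σ.memR ∧ σ₁.regN 11 = 0 ∧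
      σ₁.regN 8 = 4 + N.numExec + 4 * N.numCtg := by
    refine ⟨_, .ops _ _, ⟨?_, fun _ _ => rfl, rfl⟩, rfl, ?_, ?_⟩
    · intro k hk
      simp only [List.mem_cons, List.not_mem_nil, or_false, not_or] at hk
      simp [ramAct, RAMInstr.exec, hk]
    all_goals simp [ramAct, RAMInstr.exec, h.zero, h.reqsAt]
  obtain ⟨σ₂, run₂, hr₂, h₁₀, _, hs₂⟩ := hloop σ₁
    ⟨h.of_agree agree₁ (by decide) (by decide) fun _ _ => by rw [mem₁],
      agree₁.regN 10 (by decide), h₈, fun v => by rw [mem₁]; exact h'.1 v, h₁₁⟩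
  have agree₃ : σ₂.Agree [10] [] (ramAct (.addN 10 10 1) σ₂) := by
    refine ⟨?_, fun _ _ => rfl, rfl⟩
    intro k hk
    simp only [List.mem_cons, List.not_mem_nil, or_false] at hk
    simp [ramAct, RAMInstr.exec, hk]
  rw [List.take_length] at hs₂
  refine ⟨ramAct (.addN 10 10 1) σ₂, .seq run₁ (.seq run₂ (.ops [RAMInstr.addN 10 10 1] _) le_rfl)
      (by simp; omega), hr₂.of_agree agree₃ (by decide) (by decide) fun _ _ => rfl,
    ⟨hs₂.1, (agree₃.regN 11 (by decide)).trans hs₂.2⟩, ?_⟩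
  simp only [ramAct, RAMInstr.exec, Function.update_self, h₁₀, hr₂.one]

/-- Of the `N.numExec + 1` rounds the last one is run only for its flag, which tells whether the
values before it satisfy all constraints. -/
theorem Ready.roundsCmd (h : N.Ready σ) (h' : N.Stores (0, 0) σ) (h₁₀ : σ.regN 10 = 0) :
    ∃ σ', σ.Runs (.loop (.ltN 10 7) CSTNU.roundCmd)
        ((N.numExec + 1) * (N.reqs.length * 63 + 5 + 2) + 2) σ' ∧ N.Ready σ' ∧
      (σ'.regN 11 < 1 ↔ Sat N.edges ((round N.edges)^[N.numExec] 0)) := by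
  -- The flag after round `j + 1` refers to the values after round `j`; before the first round it
  -- says nothing.
  let I (i : ℕ) (σ' : RAMState) : Prop := N.Ready σ' ∧ σ'.regN 10 = i ∧
    ∃ f, N.Stores ((round N.edges)^[i] 0, f) σ' ∧
      ∀ j, i = j + 1 → (f < 1 ↔ Sat N.edges ((round N.edges)^[j] 0))
  have hloop : Cmd.Triple ramAct RAMTest.eval (I 0) (.loop (.ltN 10 7) CSTNU.roundCmd)
      ((N.numExec + 1) * (N.reqs.length * 63 + 5 + 2) + 2) (I (N.numExec + 1)) := by
    refine Cmd.Triple.loop (fun i σ hi => ?_) fun i hi σ₁ hσ => ?_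
    · simp [RAMTest.eval, hi.1.rounds, hi.2.1]
    · obtain ⟨hr, hi', f, hs, _⟩ := hσ
      obtain ⟨σ₂, run₂, hr₂, hs₂, hi₂⟩ := hr.roundCmd hs
      refine ⟨σ₂, run₂, hr₂, hi₂.trans (by rw [hi']), _, ⟨fun v => ?_, hs₂.2⟩, ?_⟩
      · rw [Function.iterate_succ_apply', ← foldl_relaxFlag_fst N.edges (_, 0)]
        exact hs₂.1 v
      · intro j hj
        obtain rfl : i = j := by omega
        exact foldl_relaxFlag_snd _ _
  obtain ⟨σ', run, hr, _, f, hs, hf⟩ := hloop σ ⟨h, h₁₀, 0, h', by simp⟩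
  refine ⟨σ', run, hr, ?_⟩
  rw [hs.2]
  exact hf _ rfl

theorem stronglyControllable_of_reqs_eq_nil (h : N.reqs = []) : N.StronglyControllable :=
  ⟨0, fun _ _ _ r hr => by simp [h] at hr⟩

variable (N)

/-- Without requirements the answer is yes at once. This exit matters for the bound: with `m = 0`
even empty rounds would take time proportional to the number of executable timepoints. -/
theorem controllableCmd_run :
    ∃ σ, (ramInit N.record).Runs controllableCmd
        (1000 * (N.numConstraints * N.numTimepoints) + 999) σ ∧
      (σ.regN 11 < σ.regN 1 ↔ N.StronglyControllable) := by
  classical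
  obtain ⟨σ₁, run₁, hr₁, hs₁, h₁₀, h₁₆⟩ := N.setupCmd_run
  by_cases hreqs : N.reqs = []
  · refine ⟨σ₁, .seq run₁ (.iteF ?_ (.skip (n := 0)) le_rfl) (by omega), ?_⟩
    · simp [RAMTest.eval, hr₁.reqsAt, hr₁.stopAt, hreqs]
    · exact iff_of_true (by simp [hs₁.2, hr₁.one]) (stronglyControllable_of_reqs_eq_nil hreqs)
  have hlen : 1 ≤ N.reqs.length := List.length_pos_of_ne_nil hreqs
  -- A requirement mentions a timepoint, which depends on an executable one. This lets `m * n`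
  -- absorb the lower-order terms.
  have hexec : 1 ≤ N.numExec := Fin.pos_iff_nonempty.2 ⟨(N.reqs[0].2.x).base N.links⟩
  have hbound : 2 * (N.numExec * N.reqs.length) + N.numCtg ≤
      2 * (N.numConstraints * N.numTimepoints) := by
    unfold numConstraints numTimepoints
    nlinarith [Nat.zero_le (N.reqs.length * N.numCtg), Nat.zero_le (N.numCtg * N.numCtg),
      Nat.mul_le_mul_left N.numCtg hexec]
  have htest : RAMTest.eval (.ltN 5 6) σ₁ = true := by
    simp [RAMTest.eval, hr₁.reqsAt, hr₁.stopAt]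
    omega
  obtain ⟨σ₂, run₂, hr₂, hs₂, h₁₀', h₁₆'⟩ := hr₁.linksCmd hs₁ h₁₀ h₁₆
  rw [stronglyControllable_iff_round]
  by_cases hl : ∃ j, (N.links j).hi < (N.links j).lo
  · rw [if_pos hl] at h₁₆'
    refine ⟨σ₂, .seq run₁ (.iteT htest (.seq run₂ (.iteT ?_ (.skip (n := 0)) le_rfl) le_rfl)
      le_rfl) ?_, iff_of_true (by simp [hs₂.2, hr₂.one]) (.inl hl)⟩
    · simp [RAMTest.eval, hr₂.zero, h₁₆']
    · omega
  · rw [if_neg hl] at h₁₆'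
    obtain ⟨σ₃, run₃, hr₃, hσ₃⟩ := hr₂.roundsCmd hs₂ h₁₀'
    refine ⟨σ₃, .seq run₁ (.iteT htest (.seq run₂ (.iteF ?_ run₃ le_rfl) le_rfl)
      le_rfl) ?_, by rw [hr₃.one, hσ₃, or_iff_right hl]⟩
    · simp [RAMTest.eval, hr₂.zero, h₁₆']
    -- Both factors are at least doubled estimates: `N.numExec + 1 ≤ 2 * N.numExec`, and `63 * r + 7
    -- ≤ 70 * r` for `r ≥ 1` requirements.
    · have : (N.numExec + 1) * (N.reqs.length * 63 + 5 + 2) ≤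
          140 * (N.numExec * N.reqs.length) := by nlinarith
      omega

theorem decidableInTime_stronglyControllable :
    DecidableInTime CSTNU.record (fun N : CSTNU ℝ => N.StronglyControllable)
      (fun N => N.numConstraints * N.numTimepoints) := by
  refine ⟨ramProgram controllableCmd 11 1, 1000, fun N => ?_⟩
  obtain ⟨σ, run, h⟩ := N.controllableCmd_run
  exact ramAnswers_of_run straight_controllableCmd run (decide_eq_decide.2 h.symm)

end CSTNU

theorem theorem4 :
    (∀ N : CSTNU ℝ, N.StronglyControllable ↔ N.dropLabels.StronglyControllable) ∧
    InP CSTNU.encode (fun N : CSTNU ℚ => N.toReal.StronglyControllable) ∧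
    DecidableInTime CSTNU.record (fun N : CSTNU ℝ => N.StronglyControllable)
      (fun N => N.numConstraints * N.numTimepoints) :=
  ⟨CSTNU.stronglyControllable_iff_dropLabels, CSTNU.inP_stronglyControllable,
    CSTNU.decidableInTime_stronglyControllable⟩
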